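/- **Conventions.** Let $\mathfrak{gl}_\infty$ be the Lie algebra of complex $\mathbb Z\times\mathbb Z$ matrices with finitely many non-zero entries, with weight lattice $P=\bigoplus_{i\in\mathbb Z}\mathbb Z\epsilon_i\oplus\mathbb Z\Lambda_0$, simple roots $\alpha_i=\epsilon_i-\epsilon_{i+1}$ and simple coroots $h_i=E_{ii}-E_{i+1,i+1}$, $i\in\mathbb Z$ ($\langle\epsilon_j,h_i\rangle=\delta_{ij}-\delta_{i+1,j}$, $\langle\Lambda_0,h_i\rangle=\delta_{i0}$); $\mathfrak{gl}_n$ has weight lattice $\bigoplus_{1\le i\le n}\mathbb Z\epsilon_i$ and the simple roots and coroots with $1\le i\le n-1$. A crystal is a set $B$ with maps $\mathrm{wt}$, $\varepsilon_i,\varphi_i:B\to\mathbb Z\cup\{-\infty\}$, $\tilde e_i,\tilde f_i:B\to B\cup\{\mathbf 0\}$ satisfying Kashiwara's axioms, and the tensor product is taken with the convention $\tilde e_i(b_1\otimes b_2)=\tilde e_ib_1\otimes b_2$ if $\varphi_i(b_1)\ge\varepsilon_i(b_2)$ and $b_1\otimes\tilde e_ib_2$ otherwise; $\tilde f_i(b_1\otimes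 b_2)=\tilde f_ib_1\otimes b_2$ if $\varphi_i(b_1)>\varepsilon_i(b_2)$ and $b_1\otimes\tilde f_ib_2$ otherwise. A $(\mathfrak{gl}_\infty,\mathfrak{gl}_n)$-bicrystal is a set with a $\mathfrak{gl}_\infty$-crystal structure ($\tilde e_k,\tilde f_k$) and a $\mathfrak{gl}_n$-crystal structure ($\tilde E_l,\tilde F_l$) such that each of $\tilde e_k,\tilde f_k$ commutes with each of $\tilde E_l,\tilde F_l$ as maps on the set together with $\mathbf 0$. Isomorphisms of bicrystals are bijections that preserve $\mathrm{wt},\varepsilon,\varphi$ and commute with the operators, for both structures. On a product $B_1\times B_2$ of a $\mathfrak{gl}_\infty$-crystal and a $\mathfrak{gl}_n$-crystal the first structure acts on $B_1$ and the second one on $B_2$. **The crystals on binary matrices.** For $n\ge1$ let $\mathcal E^n$ be the set of $n\times\mathbb Z$ matrices $A=(a_{ij})$ with entries in $\{0,1\}$ and finitely many $1$s in each row. For $k\in\mathbb Z$ give the $i$-th row the sign $+$ if $(a_{ik},a_{i,k+1})=(1,0)$, the sign $-$ if $(a_{ik},a_{i,k+1})=(0,1)$, and no sign otherwise; in the sequence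 of signs of the rows $i=1,\dots,n$ cancel successively all pairs $(+,-)$ in this order with no uncancelled sign between them. Then $\tilde f_kA$ (resp. $\tilde e_kA$) is obtained by exchanging $a_{ik}$ and $a_{i,k+1}$ in the row $i$ of the left-most remaining $+$ (resp. right-most remaining $-$), and is $\mathbf 0$ if there is none; $\varphi_k(A)$ and $\varepsilon_k(A)$ are the numbers of remaining $+$ and $-$, and $\mathrm{wt}(A)=\sum_{i,j}a_{ij}\epsilon_j$. For $1\le l\le n-1$ the operators $\tilde E_l,\tilde F_l$ (and $\varepsilon_l,\varphi_l$) are obtained by applying the same rule to the matrix $\rho(A)=(a_{i,-j})$ whose rows are the columns of $A$ in the order from right to left, and to its columns $l,l+1$; the weight is $\sum_{i,j}a_{ij}\epsilon_i$. **The tableau crystals.** For a partition $\mu$ let $\mathbf B_\mu$ be the $\mathfrak{gl}_\infty$-crystal of semistandard tableaux of shape $\mu$ (weakly increasing rows, strictly increasing columns) with entries in $\mathbb Z$, and for a partition $\lambda$ with at most $n$ parts let $\mathbf B_{[n]}(\omega_\lambda)$ be the crystal of the irreducible $U_q(\mathfrak{gl}_n)$-module of highest weight $\omega_\lambda=\lambda_1\epsilon_1+\dots+\lambda_n\epsilon_n$,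 that is, the $\mathfrak{gl}_n$-crystal of semistandard tableaux of shape $\lambda$ with entries in $\{1,\dots,n\}$. In both cases a tableau is identified with the tensor product of its entries, read column by column from right to left and in each column from top to bottom, where the letters form the crystal of the natural representation, $\cdots\to k\xrightarrow{\,k\,}k+1\to\cdots$. **Proposition.** For every $n\ge 1$, $\mathcal E^n$ is a $(\mathfrak{gl}_\infty,\mathfrak{gl}_n)$-bicrystal, and as a $(\mathfrak{gl}_\infty,\mathfrak{gl}_n)$-bicrystal $$\mathcal E^n\;\simeq\;\bigsqcup_{\mu:\ \mu_1\le n}\mathbf B_\mu\times\mathbf B_{[n]}(\omega_{\mu'}),$$ where $\mu$ runs over all partitions with $\mu_1\le n$ and $\mu'$ is the conjugate partition of $\mu$. -/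

import Mathlib

/-! ## Crystals for Lie algebras of type `𝔤𝔩` -/

/-- The data attached to a general linear Lie algebra whose natural representation has a basis
indexed by `κ`: the index set of the simple roots, where the index `k` joins the basis vectors
`fst k = k` and `snd k = k + 1`, the weight lattice, the weights `ϵ_a` and the pairings
`⟨·, h_k⟩` with the simple coroots `h_k = E_{kk} - E_{k+1,k+1}`. -/
structure GlDatum (κ : Type) where
  Idx : Type
  Wt : Type
  [addCommGroup : AddCommGroup Wt]
  fst : Idx → κ
  snd : Idx → κ
  eps : κ → Wt
  coroot : Idx → Wt →+ ℤ

attribute [instance] GlDatum.addCommGroup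

/-- The simple root `α_k = ϵ_k - ϵ_{k+1}`. -/
def GlDatum.root {κ : Type} (D : GlDatum κ) (k : D.Idx) : D.Wt :=
  D.eps (D.fst k) - D.eps (D.snd k)

/-- The datum of `𝔤𝔩_∞`. The pair `(x, c)` stands for the weight `∑ i, x i • ϵ_i + c • Λ_0` of
`P = ⨁ i, ℤ ϵ_i ⊕ ℤ Λ_0`. Since `⟨Λ_0, E_{jj}⟩` is `1/2` for `j ≤ 0` and `-1/2` for `j ≥ 1`, one has
`⟨Λ_0, h_i⟩ = 1` for `i = 0` and `⟨Λ_0, h_i⟩ = 0` for `i ≠ 0`. -/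
noncomputable def glInfty : GlDatum ℤ where
  Idx := ℤ
  Wt := (ℤ →₀ ℤ) × ℤ
  fst k := k
  snd k := k + 1
  eps a := (Finsupp.single a 1, 0)
  coroot i :=
    { toFun := fun x => x.1 i - x.1 (i + 1) + if i = 0 then x.2 else 0
      map_zero' := by simp
      map_add' := by
        intro x y
        by_cases h : i = 0 <;> simp [h] <;> ring }

/-- The datum of `𝔤𝔩_n`: the basis is indexed by `Fin n` (so `0, …, n - 1` stand for `1, …, n`),
the weight lattice is `⨁ ℤ ϵ_i` and the simple roots are indexed by the `i` with `i + 1 < n`. -/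
def glFin (n : ℕ) : GlDatum (Fin n) where
  Idx := {i : ℕ // i + 1 < n}
  Wt := Fin n → ℤ
  fst k := ⟨k.1, Nat.lt_of_succ_lt k.2⟩
  snd k := ⟨k.1 + 1, k.2⟩
  eps a := Pi.single a 1
  coroot k :=
    { toFun := fun x => x ⟨k.1, Nat.lt_of_succ_lt k.2⟩ - x ⟨k.1 + 1, k.2⟩
      map_zero' := by simp
      map_add' := by
        intro x y
        simp only [Pi.add_apply]
        ring }

/-- The structure maps of a crystal on the set `B`. The formal symbol `𝟎` is `none`, and `-∞` is
`⊥`. The axioms are in `CrystalData.IsCrystal`. -/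
structure CrystalData {κ : Type} (D : GlDatum κ) (B : Type) where
  wt : B → D.Wt
  ε : D.Idx → B → WithBot ℤ
  φ : D.Idx → B → WithBot ℤ
  e : D.Idx → B → Option B
  f : D.Idx → B → Option B

namespace CrystalData

variable {κ : Type} {D : GlDatum κ} {B B' : Type}

/-- The axioms of a crystal. -/
structure IsCrystal (C : CrystalData D B) : Prop where
  φ_eq : ∀ i b, C.φ i b = ((D.coroot i (C.wt b) : ℤ) : WithBot ℤ) + C.ε i b
  ε_e : ∀ i b b', C.e i b = some b' → C.ε i b' = C.ε i b + ((-1 : ℤ) : WithBot ℤ)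
  φ_e : ∀ i b b', C.e i b = some b' → C.φ i b' = C.φ i b + ((1 : ℤ) : WithBot ℤ)
  wt_e : ∀ i b b', C.e i b = some b' → C.wt b' = C.wt b + D.root i
  ε_f : ∀ i b b', C.f i b = some b' → C.ε i b' = C.ε i b + ((1 : ℤ) : WithBot ℤ)
  φ_f : ∀ i b b', C.f i b = some b' → C.φ i b' = C.φ i b + ((-1 : ℤ) : WithBot ℤ)
  wt_f : ∀ i b b', C.f i b = some b' → C.wt b' = C.wt b - D.root i
  f_iff_e : ∀ i b b', C.f i b = some b' ↔ C.e i b' = some b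
  of_φ_eq_bot : ∀ i b, C.φ i b = ⊥ → C.e i b = none ∧ C.f i b = none

/-- A bijection that is an isomorphism of crystals. -/
structure IsIso (C : CrystalData D B) (C' : CrystalData D B') (ψ : B ≃ B') : Prop where
  wt_eq : ∀ b, C'.wt (ψ b) = C.wt b
  ε_eq : ∀ i b, C'.ε i (ψ b) = C.ε i b
  φ_eq : ∀ i b, C'.φ i (ψ b) = C.φ i b
  e_eq : ∀ i b, C'.e i (ψ b) = (C.e i b).map ψ
  f_eq : ∀ i b, C'.f i (ψ b) = (C.f i b).map ψ

/-! A word `b₁ b₂ … b_r` with letters in a crystal is identified with `b₁ ⊗ (b₂ ⊗ (⋯ ⊗ b_r))`, and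
the structure maps on words are those of the tensor product `b₁ ⊗ w`. The empty word is the trivial
crystal. -/

/-- `wt (b ⊗ w) = wt b + wt w`. -/
def wordWt (C : CrystalData D B) : List B → D.Wt
  | [] => 0
  | b :: w => C.wt b + C.wordWt w

/-- `ε_i (b ⊗ w) = max (ε_i b) (ε_i w - ⟨wt b, h_i⟩)`. -/
noncomputable def wordε (C : CrystalData D B) (i : D.Idx) : List B → WithBot ℤ
  | [] => 0
  | b :: w => max (C.ε i b) (C.wordε i w + ((-(D.coroot i (C.wt b)) : ℤ) : WithBot ℤ))

/-- `φ_i (b ⊗ w) = max (φ_i b + ⟨wt w, h_i⟩) (φ_i w)`. -/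
noncomputable def wordφ (C : CrystalData D B) (i : D.Idx) : List B → WithBot ℤ
  | [] => 0
  | b :: w => max (C.φ i b + ((D.coroot i (C.wordWt w) : ℤ) : WithBot ℤ)) (C.wordφ i w)

/-- `ẽ_i (b ⊗ w)` is `ẽ_i b ⊗ w` if `φ_i b ≥ ε_i w`, and `b ⊗ ẽ_i w` otherwise. -/
noncomputable def wordE (C : CrystalData D B) (i : D.Idx) : List B → Option (List B)
  | [] => none
  | b :: w =>
    if C.wordε i w ≤ C.φ i b then (C.e i b).map (fun b' => b' :: w)
    else (C.wordE i w).map (fun w' => b :: w')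

/-- `f̃_i (b ⊗ w)` is `f̃_i b ⊗ w` if `φ_i b > ε_i w`, and `b ⊗ f̃_i w` otherwise. -/
noncomputable def wordF (C : CrystalData D B) (i : D.Idx) : List B → Option (List B)
  | [] => none
  | b :: w =>
    if C.wordε i w < C.φ i b then (C.f i b).map (fun b' => b' :: w)
    else (C.wordF i w).map (fun w' => b :: w')

/-- The crystal of all finite words with letters in the crystal `B`. -/
noncomputable def words (C : CrystalData D B) : CrystalData D (List B) where
  wt := C.wordWt
  ε := C.wordε
  φ := C.wordφ
  e := C.wordE
  f := C.wordF

open Classical in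
/-- The crystal structure on a set `B'` that an injection `g : B' → B` identifies with a subset of
the crystal `B` which, together with `𝟎`, is invariant under the crystal operators. -/
noncomputable def pullback (C : CrystalData D B) (g : B' → B) : CrystalData D B' where
  wt b := C.wt (g b)
  ε i b := C.ε i (g b)
  φ i b := C.φ i (g b)
  e i b := if h : ∃ b', C.e i (g b) = some (g b') then some h.choose else none
  f i b := if h : ∃ b', C.f i (g b) = some (g b') then some h.choose else none

end CrystalData

open Classical in
/-- The crystal of the natural representation, `⋯ → k → k + 1 → ⋯`, with `ϵ_a` the weight of `a`. -/
noncomputable def naturalCrystal {κ : Type} (D : GlDatum κ) : CrystalData D κ where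
  wt a := D.eps a
  ε k a := if a = D.snd k then 1 else 0
  φ k a := if a = D.fst k then 1 else 0
  e k a := if a = D.snd k then some (D.fst k) else none
  f k a := if a = D.fst k then some (D.snd k) else none

/-! ## Bicrystals -/

/-- The structure maps of two crystals on one set `B`. -/
structure BicrystalData {κ₁ κ₂ : Type} (D₁ : GlDatum κ₁) (D₂ : GlDatum κ₂) (B : Type) where
  left : CrystalData D₁ B
  right : CrystalData D₂ B

namespace BicrystalData

variable {κ₁ κ₂ : Type} {D₁ : GlDatum κ₁} {D₂ : GlDatum κ₂} {B B' : Type}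

/-- A bicrystal: two crystal structures on one set such that the operators `ẽ_i, f̃_i` of the first
commute with the operators `Ẽ_j, F̃_j` of the second, as maps on `B ∪ {𝟎}`. -/
structure IsBicrystal (C : BicrystalData D₁ D₂ B) : Prop where
  left_isCrystal : C.left.IsCrystal
  right_isCrystal : C.right.IsCrystal
  e_E : ∀ i j b, (C.right.e j b).bind (C.left.e i) = (C.left.e i b).bind (C.right.e j)
  e_F : ∀ i j b, (C.right.f j b).bind (C.left.e i) = (C.left.e i b).bind (C.right.f j)
  f_E : ∀ i j b, (C.right.e j b).bind (C.left.f i) = (C.left.f i b).bind (C.right.e j)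
  f_F : ∀ i j b, (C.right.f j b).bind (C.left.f i) = (C.left.f i b).bind (C.right.f j)

/-- A bijection that is an isomorphism for both crystal structures. -/
structure IsIso (C : BicrystalData D₁ D₂ B) (C' : BicrystalData D₁ D₂ B') (ψ : B ≃ B') :
    Prop where
  left_isIso : C.left.IsIso C'.left ψ
  right_isIso : C.right.IsIso C'.right ψ

/-- The product `B₁ × B₂`: the first structure acts on the first factor, and the second one on the
second factor. -/
def prod {B₁ B₂ : Type} (C₁ : CrystalData D₁ B₁) (C₂ : CrystalData D₂ B₂) :
    BicrystalData D₁ D₂ (B₁ × B₂) where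
  left :=
    { wt := fun b => C₁.wt b.1
      ε := fun i b => C₁.ε i b.1
      φ := fun i b => C₁.φ i b.1
      e := fun i b => (C₁.e i b.1).map (fun x => (x, b.2))
      f := fun i b => (C₁.f i b.1).map (fun x => (x, b.2)) }
  right :=
    { wt := fun b => C₂.wt b.2
      ε := fun i b => C₂.ε i b.2
      φ := fun i b => C₂.φ i b.2
      e := fun i b => (C₂.e i b.2).map (fun x => (b.1, x))
      f := fun i b => (C₂.f i b.2).map (fun x => (b.1, x)) }

/-- The disjoint union of a family. -/
def disjointUnion {M : Type} {X : M → Type} (C : ∀ m, BicrystalData D₁ D₂ (X m)) :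
    BicrystalData D₁ D₂ (Σ m, X m) where
  left :=
    { wt := fun b => (C b.1).left.wt b.2
      ε := fun i b => (C b.1).left.ε i b.2
      φ := fun i b => (C b.1).left.φ i b.2
      e := fun i b => ((C b.1).left.e i b.2).map (Sigma.mk b.1)
      f := fun i b => ((C b.1).left.f i b.2).map (Sigma.mk b.1) }
  right :=
    { wt := fun b => (C b.1).right.wt b.2
      ε := fun i b => (C b.1).right.ε i b.2
      φ := fun i b => (C b.1).right.φ i b.2
      e := fun i b => ((C b.1).right.e i b.2).map (Sigma.mk b.1)
      f := fun i b => ((C b.1).right.f i b.2).map (Sigma.mk b.1) }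

end BicrystalData

/-! ## Crystals of semistandard tableaux -/

/-- Semistandard tableaux of shape `μ` with entries in `κ`: weakly increasing along rows and strictly
increasing down columns. The cell `(i, j)` lies in row `i` and column `j`, counted from `0`. -/
structure Tableau (μ : YoungDiagram) (κ : Type) [LinearOrder κ] where
  entry : {c : ℕ × ℕ // c ∈ μ} → κ
  row_weak : ∀ c d, c.1.1 = d.1.1 → c.1.2 < d.1.2 → entry c ≤ entry d
  col_strict : ∀ c d, c.1.2 = d.1.2 → c.1.1 < d.1.1 → entry c < entry d

/-- The column reading word: the columns from right to left, each of them from top to bottom. -/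
def Tableau.colWord {μ : YoungDiagram} {κ : Type} [LinearOrder κ] (T : Tableau μ κ) : List κ :=
  (List.range (μ.rowLen 0)).reverse.flatMap fun j =>
    (List.finRange (μ.colLen j)).map fun i =>
      T.entry ⟨(i.1, j), YoungDiagram.mem_iff_lt_colLen.mpr i.2⟩

/-- The crystal of semistandard tableaux of shape `μ`, embedded by the column reading word in the
crystal of words with letters in the natural crystal; the image together with `𝟎` is invariant
under the crystal operators. -/
noncomputable def tableauCrystal {κ : Type} [LinearOrder κ] (D : GlDatum κ) (μ : YoungDiagram) :
    CrystalData D (Tableau μ κ) :=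
  (naturalCrystal D).words.pullback Tableau.colWord

/-- The `𝔤𝔩_∞`-crystal `𝐁_μ` of semistandard tableaux of shape `μ` with entries in `ℤ`. -/
noncomputable def crystalB (μ : YoungDiagram) : CrystalData glInfty (Tableau μ ℤ) :=
  tableauCrystal glInfty μ

/-- The crystal `𝐁_{[n]}(ω_lam)` of the irreducible `U_q(𝔤𝔩_n)`-module with highest weight
`ω_lam = ∑ i, lam_i ϵ_i`, for a partition `lam` of length at most `n`: the crystal of the semistandard
tableaux of shape `lam` with entries in `{1, …, n}` (here `Fin n`). Its highest weight element is the
tableau whose `i`-th row is constant with value `i`. -/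
noncomputable def crystalBFin (n : ℕ) (lam : YoungDiagram) :
    CrystalData (glFin n) (Tableau lam (Fin n)) :=
  tableauCrystal (glFin n) lam

/-! ## Crystal operators on binary matrices -/

section Signature

variable {ι : Type} [LinearOrder ι] [LocallyFiniteOrder ι]

/-- Cancel in a sequence `σ` of signs `+`, `-`, `·` (encoded by `1`, `-1`, `0`) successively all pairs
`+`, `-` in this order with only `·` or cancelled signs between them. A sign `+` at `s` is cancelled
against the first place `t > s` at which `-` outnumber `+` in the interval `(s, t]`. So it survives
if and only if there is no such place. -/
def SurvivingPlus (σ : ι → SignType) (s : ι) : Prop :=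
  σ s = 1 ∧ ∀ t, s < t → 0 ≤ ∑ u ∈ Finset.Ioc s t, (σ u : ℤ)

/-- Symmetrically, a sign `-` at `s` survives the cancellation if and only if `+` do not outnumber
`-` in any interval `[t, s)`. -/
def SurvivingMinus (σ : ι → SignType) (s : ι) : Prop :=
  σ s = -1 ∧ ∀ t, t < s → ∑ u ∈ Finset.Ico t s, (σ u : ℤ) ≤ 0

/-- The good `+` sign: the left-most `+` of the reduced sequence. -/
def GoodPlus (σ : ι → SignType) (s : ι) : Prop :=
  SurvivingPlus σ s ∧ ∀ t, SurvivingPlus σ t → s ≤ t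

/-- The good `-` sign: the right-most `-` of the reduced sequence. -/
def GoodMinus (σ : ι → SignType) (s : ι) : Prop :=
  SurvivingMinus σ s ∧ ∀ t, SurvivingMinus σ t → t ≤ s

end Signature

section Matrices

variable {ι κ : Type} [LinearOrder ι] [LocallyFiniteOrder ι] [DecidableEq κ]

/-- The sign of the `s`-th row of a binary matrix `A` with respect to the columns `k` and `k'`
(`k' = k + 1` below): `+` if the entries there are `1, 0`, and `-` if they are `0, 1`. -/
def rowSign (k k' : κ) (A : Matrix ι κ Bool) (s : ι) : SignType :=
  match A s k, A s k' with
  | true, false => 1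
  | false, true => -1
  | _, _ => 0

open Classical in
/-- `f̃_k`: in the row of the good `+` sign, move the entry `1` from column `k` to column `k'`. -/
noncomputable def matF (k k' : κ) (A : Matrix ι κ Bool) : Option (Matrix ι κ Bool) :=
  if h : ∃ s, GoodPlus (rowSign k k' A) s then
    some (A.updateRow h.choose
      (Function.update (Function.update (A h.choose) k false) k' true))
  else none

open Classical in
/-- `ẽ_k`: in the row of the good `-` sign, move the entry `1` from column `k'` to column `k`. -/
noncomputable def matE (k k' : κ) (A : Matrix ι κ Bool) : Option (Matrix ι κ Bool) :=
  if h : ∃ s, GoodMinus (rowSign k k' A) s then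
    some (A.updateRow h.choose
      (Function.update (Function.update (A h.choose) k true) k' false))
  else none

/-- `φ_k`: the number of signs `+` in the reduced sequence. -/
noncomputable def matφ (k k' : κ) (A : Matrix ι κ Bool) : ℤ :=
  (Nat.card {s // SurvivingPlus (rowSign k k' A) s} : ℤ)

/-- `ε_k`: the number of signs `-` in the reduced sequence. -/
noncomputable def matε (k k' : κ) (A : Matrix ι κ Bool) : ℤ :=
  (Nat.card {s // SurvivingMinus (rowSign k k' A) s} : ℤ)

end Matrices

/-- The bijection `ρ(A) = (a_{i,-j})` from `[n] × ℤ` matrices to `ℤ × [n]` matrices, whose row `m` is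
the column `-m` of `A`. -/
def rho {n : ℕ} : Matrix (Fin n) ℤ Bool ≃ Matrix ℤ (Fin n) Bool where
  toFun A := fun m i => A i (-m)
  invFun A := fun i j => A (-j) i
  left_inv A := by
    funext i j
    simp
  right_inv A := by
    funext i j
    simp

/-- Finitely many entries `1` in each row. -/
def RowFinite {n : ℕ} (A : Matrix (Fin n) ℤ Bool) : Prop :=
  ∀ i, {j | A i j = true}.Finite

/-- The set `ℰⁿ` of the `n × ℤ` binary matrices with finitely many entries `1` in each row. -/
def BinMat (n : ℕ) : Type := {A : Matrix (Fin n) ℤ Bool // RowFinite A}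

theorem rho_symm_apply {n : ℕ} (A : Matrix ℤ (Fin n) Bool) (i : Fin n) (j : ℤ) :
    rho.symm A i j = A (-j) i := rfl

theorem rowFinite_of_matF {n : ℕ} {k k' : ℤ} {A A' : Matrix (Fin n) ℤ Bool} (hA : RowFinite A)
    (h : matF k k' A = some A') : RowFinite A' := by
  unfold matF at h
  split_ifs at h with hs
  obtain rfl := Option.some.inj h
  intro i
  refine ((hA i).union (Set.finite_singleton k')).subset ?_
  intro j hj
  simp only [Set.mem_ofPred_eq, Matrix.updateRow_apply, Function.update_apply] at hj
  simp only [Set.mem_union, Set.mem_ofPred_eq, Set.mem_singleton_iff]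
  split_ifs at hj <;> simp_all

theorem rowFinite_of_matE {n : ℕ} {k k' : ℤ} {A A' : Matrix (Fin n) ℤ Bool} (hA : RowFinite A)
    (h : matE k k' A = some A') : RowFinite A' := by
  unfold matE at h
  split_ifs at h with hs
  obtain rfl := Option.some.inj h
  intro i
  refine ((hA i).union (Set.finite_singleton k)).subset ?_
  intro j hj
  simp only [Set.mem_ofPred_eq, Matrix.updateRow_apply, Function.update_apply] at hj
  simp only [Set.mem_union, Set.mem_ofPred_eq, Set.mem_singleton_iff]
  split_ifs at hj <;> simp_all

theorem rowFinite_of_rho_matF {n : ℕ} {l l' : Fin n} {A : Matrix (Fin n) ℤ Bool}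
    {A' : Matrix ℤ (Fin n) Bool} (hA : RowFinite A) (h : matF l l' (rho A) = some A') :
    RowFinite (rho.symm A') := by
  unfold matF at h
  split_ifs at h with hs
  obtain rfl := Option.some.inj h
  intro i
  refine ((hA i).union (Set.finite_singleton (-hs.choose))).subset ?_
  intro j hj
  rw [Set.mem_ofPred_eq, rho_symm_apply, Matrix.updateRow_apply] at hj
  simp only [Set.mem_union, Set.mem_ofPred_eq, Set.mem_singleton_iff]
  split_ifs at hj with hj'
  · right
    rw [show hs.choose = -j from hj'.symm, neg_neg]
  · left
    have hj2 : rho.symm (rho A) i j = true := hj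
    rwa [Equiv.symm_apply_apply] at hj2

theorem rowFinite_of_rho_matE {n : ℕ} {l l' : Fin n} {A : Matrix (Fin n) ℤ Bool}
    {A' : Matrix ℤ (Fin n) Bool} (hA : RowFinite A) (h : matE l l' (rho A) = some A') :
    RowFinite (rho.symm A') := by
  unfold matE at h
  split_ifs at h with hs
  obtain rfl := Option.some.inj h
  intro i
  refine ((hA i).union (Set.finite_singleton (-hs.choose))).subset ?_
  intro j hj
  rw [Set.mem_ofPred_eq, rho_symm_apply, Matrix.updateRow_apply] at hj
  simp only [Set.mem_union, Set.mem_ofPred_eq, Set.mem_singleton_iff]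
  split_ifs at hj with hj'
  · right
    rw [show hs.choose = -j from hj'.symm, neg_neg]
  · left
    have hj2 : rho.symm (rho A) i j = true := hj
    rwa [Equiv.symm_apply_apply] at hj2

/-- The two crystal structures on `ℰⁿ`: the `𝔤𝔩_∞`-structure with the weight `∑ a_{ij} ϵ_j` and the
operators `ẽ_k, f̃_k`, and the `𝔤𝔩_n`-structure with the weight `∑ a_{ij} ϵ_i` and the operators
`Ẽ_l = ρ⁻¹ ẽ_l ρ`, `F̃_l = ρ⁻¹ f̃_l ρ`. -/
noncomputable def binMatBicrystal (n : ℕ) : BicrystalData glInfty (glFin n) (BinMat n) where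
  left :=
    { wt := fun A => ∑ i : Fin n, ∑ j ∈ (A.2 i).toFinset, glInfty.eps j
      ε := fun k A => (matε (glInfty.fst k) (glInfty.snd k) A.1 : ℤ)
      φ := fun k A => (matφ (glInfty.fst k) (glInfty.snd k) A.1 : ℤ)
      e := fun k A => (matE (glInfty.fst k) (glInfty.snd k) A.1).pmap
        (fun A' h => ⟨A', rowFinite_of_matE A.2 h⟩) (fun _ h => h)
      f := fun k A => (matF (glInfty.fst k) (glInfty.snd k) A.1).pmap
        (fun A' h => ⟨A', rowFinite_of_matF A.2 h⟩) (fun _ h => h) }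
  right :=
    { wt := fun A => ∑ i : Fin n, ∑ _j ∈ (A.2 i).toFinset, (glFin n).eps i
      ε := fun l A => (matε ((glFin n).fst l) ((glFin n).snd l) (rho A.1) : ℤ)
      φ := fun l A => (matφ ((glFin n).fst l) ((glFin n).snd l) (rho A.1) : ℤ)
      e := fun l A => (matE ((glFin n).fst l) ((glFin n).snd l) (rho A.1)).pmap
        (fun A' h => ⟨rho.symm A', rowFinite_of_rho_matE A.2 h⟩) (fun _ h => h)
      f := fun l A => (matF ((glFin n).fst l) ((glFin n).snd l) (rho A.1)).pmap
        (fun A' h => ⟨rho.symm A', rowFinite_of_rho_matF A.2 h⟩) (fun _ h => h) }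

/-!
The theorem is a crystal version of the dual Robinson–Schensted–Knuth correspondence, and the proof
is the double crystal argument: no insertion algorithm occurs. There are three parts.

*The two structures commute.* `F̃_l` moves an entry within one column `j` from row `l` to row
`l + 1`. For the operators `ẽ_k, f̃_k` with `j ∈ {k, k + 1}` this changes only the signs of these two
consecutive rows, and since the entry moved belongs to a good sign `+`, the new pair of signs has
the same reduced sequence as the old one. So the surviving signs `+` stay in place up to a
transposition of the two rows (`exists_perm_survivingPlus`, `BinMat.sameUpTo_of_right_f`). Hence
`F̃_l` preserves `φ_k` and `ε_k`, the same holds with the two structures exchanged, and where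
`f̃_k` and `F̃_l` are both defined, they commute by an inspection of the `2 × 2` blocks
(`BinMat.square`). All commutation relations follow formally (`BinMat.isBicrystal`).

*Normal forms.* By operators of the `𝔤𝔩_n`-structure a matrix `A` can be brought into a matrix `P`
that is annihilated by all `F̃_l`, and by operators of the `𝔤𝔩_∞`-structure into a matrix `Q` that
is zero in the negative columns and annihilated by the `ẽ_k` with `k ≥ 0`. (Without the restriction
to `k ≥ 0` the entries could be moved to the left for ever.) Each structure preserves the normal
forms of the other one. A matrix that is normal for both structures is, up to a reflection, the
diagram of a partition, and it is determined by its row sums and also by its column sums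
(`BinMat.apply_iff_card_row`, `BinMat.apply_iff_card_col`). Since the operators of one structure
preserve the sums that are the weight for the other one, it follows formally that `P` and `Q` are
unique and that they determine `A` (`NormalForms.unique_r`, `NormalForms.eq_of_connected`). A pair
`(P, Q)` belongs to a matrix `A` exactly if the normal form of `P` for `𝔤𝔩_∞` and that of `Q` for
`𝔤𝔩_n` coincide, that is, if the row sums of `P` and the column sums of `Q` come from conjugate
partitions.

*Tableaux.* The rows of `P`, from the last one to the first one, are the columns of a semistandard
tableau with entries in `ℤ`, and the columns of `Q` are the columns of a semistandard tableau with
entries in `[n]`; the condition that the operators annihilate the matrix is the condition on the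
rows of the tableau (`Dominates`). Read in the order in which the signature rule goes through the
matrix, the entries of `P` and of `Q` form the column reading words of these tableaux, and the
signature rule becomes the tensor product rule (`IsReading`). As `A` is connected with `P` by
operators that commute with the `𝔤𝔩_∞`-structure, the map from `A` to the tableau of `P` is a
morphism of `𝔤𝔩_∞`-crystals, and in the same way the map from `A` to the tableau of `Q` is a
morphism of `𝔤𝔩_n`-crystals.
-/

/-! ### Signatures -/

theorem sum_update_of_notMem {ι : Type} [DecidableEq ι] {f : ι → SignType} {s : ι} {x : SignType}
    {S : Finset ι} (h : s ∉ S) :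
    ∑ v ∈ S, (Function.update f s x v : ℤ) = ∑ v ∈ S, (f v : ℤ) := by
  refine Finset.sum_congr rfl fun v hv => ?_
  rw [Function.update_of_ne]
  rintro rfl
  exact h hv

section SignatureLemmas

variable {ι : Type} [LinearOrder ι] [LocallyFiniteOrder ι]

theorem sum_Ioc_add_sum_Ioc (f : ι → ℤ) {s t u : ι} (h₁ : s ≤ t) (h₂ : t ≤ u) :
    ∑ v ∈ Finset.Ioc s t, f v + ∑ v ∈ Finset.Ioc t u, f v = ∑ v ∈ Finset.Ioc s u, f v := by
  rw [← Finset.Ioc_union_Ioc_eq_Ioc h₁ h₂, Finset.sum_union]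
  rw [Finset.disjoint_left]
  intro v hv hv'
  rw [Finset.mem_Ioc] at hv hv'
  exact absurd hv.2 (not_le.mpr hv'.1)

theorem sum_Ioc_eq_sum_Ioo_add (f : ι → ℤ) {s t : ι} (h : s < t) :
    ∑ v ∈ Finset.Ioc s t, f v = ∑ v ∈ Finset.Ioo s t, f v + f t := by
  rw [← Finset.Ioo_insert_right h, Finset.sum_insert (by simp), add_comm]

theorem sum_Ico_eq_add_sum_Ioo (f : ι → ℤ) {s t : ι} (h : s < t) :
    ∑ v ∈ Finset.Ico s t, f v = f s + ∑ v ∈ Finset.Ioo s t, f v := by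
  rw [← Finset.Ioo_insert_left h, Finset.sum_insert (by simp)]

theorem sum_Ioc_of_covBy (f : ι → ℤ) {s t : ι} (h : s ⋖ t) :
    ∑ v ∈ Finset.Ioc s t, f v = f t := by
  have : Finset.Ioo s t = ∅ := Finset.eq_empty_of_forall_notMem fun u hu =>
    h.2 (Finset.mem_Ioo.mp hu).1 (Finset.mem_Ioo.mp hu).2
  rw [sum_Ioc_eq_sum_Ioo_add f h.lt, this, Finset.sum_empty, zero_add]

theorem sum_Ioo_eq_zero_or (f : ι → ℤ) {s t : ι} :
    ∑ v ∈ Finset.Ioo s t, f v = 0 ∨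
      ∃ u, s < u ∧ u < t ∧ ∑ v ∈ Finset.Ioo s t, f v = ∑ v ∈ Finset.Ioc s u, f v := by
  rcases (Finset.Ioo s t).eq_empty_or_nonempty with h | h
  · left
    rw [h, Finset.sum_empty]
  · right
    have hm := Finset.max'_mem _ h
    refine ⟨(Finset.Ioo s t).max' h, (Finset.mem_Ioo.mp hm).1, (Finset.mem_Ioo.mp hm).2, ?_⟩
    congr 1
    ext v
    rw [Finset.mem_Ioc]
    constructor
    · exact fun hv => ⟨(Finset.mem_Ioo.mp hv).1, Finset.le_max' _ v hv⟩
    · exact fun hv => Finset.mem_Ioo.mpr ⟨hv.1, hv.2.trans_lt (Finset.mem_Ioo.mp hm).2⟩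

theorem sum_Ioo_eq_zero_or' (f : ι → ℤ) {s t : ι} :
    ∑ v ∈ Finset.Ioo s t, f v = 0 ∨
      ∃ u, s < u ∧ u < t ∧ ∑ v ∈ Finset.Ioo s t, f v = ∑ v ∈ Finset.Ico u t, f v := by
  rcases (Finset.Ioo s t).eq_empty_or_nonempty with h | h
  · left
    rw [h, Finset.sum_empty]
  · right
    have hm := Finset.min'_mem _ h
    refine ⟨(Finset.Ioo s t).min' h, (Finset.mem_Ioo.mp hm).1, (Finset.mem_Ioo.mp hm).2, ?_⟩
    congr 1
    ext v
    rw [Finset.mem_Ico]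
    constructor
    · exact fun hv => ⟨Finset.min'_le _ v hv, (Finset.mem_Ioo.mp hv).2⟩
    · exact fun hv => Finset.mem_Ioo.mpr ⟨(Finset.mem_Ioo.mp hm).1.trans_le hv.1, hv.2⟩

theorem SurvivingPlus.sum_Ioo_nonneg {σ : ι → SignType} {s : ι} (h : SurvivingPlus σ s) (t : ι) :
    0 ≤ ∑ v ∈ Finset.Ioo s t, (σ v : ℤ) := by
  rcases sum_Ioo_eq_zero_or (fun v => (σ v : ℤ)) (s := s) (t := t) with h' | ⟨u, hu, -, h'⟩
  · exact h'.ge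
  · rw [h']
    exact h.2 u hu

/-- Reversing the order and the signs exchanges the two kinds of surviving signs. -/
theorem survivingMinus_iff_dual (σ : ι → SignType) (s : ι) :
    SurvivingMinus σ s ↔
      SurvivingPlus (ι := ιᵒᵈ) (fun u => -σ (OrderDual.ofDual u)) (OrderDual.toDual s) := by
  unfold SurvivingMinus SurvivingPlus
  refine and_congr ?_ ?_
  · simp only [OrderDual.ofDual_toDual]
    generalize σ s = x
    revert x
    decide
  · constructor
    · intro h t ht
      have := h (OrderDual.ofDual t) ht
      obtain ⟨t, rfl⟩ := OrderDual.toDual.surjective t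
      rw [Finset.Ioc_toDual, Finset.sum_map]
      simpa using this
    · intro h t ht
      have := h (OrderDual.toDual t) ht
      rw [Finset.Ioc_toDual, Finset.sum_map] at this
      simpa using this

theorem survivingPlus_iff_dual (σ : ι → SignType) (s : ι) :
    SurvivingPlus σ s ↔
      SurvivingMinus (ι := ιᵒᵈ) (fun u => -σ (OrderDual.ofDual u)) (OrderDual.toDual s) := by
  unfold SurvivingMinus SurvivingPlus
  refine and_congr ?_ ?_
  · simp only [OrderDual.ofDual_toDual]
    generalize σ s = x
    revert x
    decide
  · constructor
    · intro h t ht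
      have := h (OrderDual.ofDual t) ht
      obtain ⟨t, rfl⟩ := OrderDual.toDual.surjective t
      rw [Finset.Ico_toDual, Finset.sum_map]
      simpa using this
    · intro h t ht
      have := h (OrderDual.toDual t) ht
      rw [Finset.Ico_toDual, Finset.sum_map] at this
      simpa using this

theorem goodMinus_iff_dual (σ : ι → SignType) (s : ι) :
    GoodMinus σ s ↔
      GoodPlus (ι := ιᵒᵈ) (fun u => -σ (OrderDual.ofDual u)) (OrderDual.toDual s) := by
  unfold GoodMinus GoodPlus
  rw [survivingMinus_iff_dual]
  refine and_congr Iff.rfl ⟨fun h t ht => ?_, fun h t ht => ?_⟩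
  · exact h (OrderDual.ofDual t) ((survivingMinus_iff_dual σ _).mpr ht)
  · exact h (OrderDual.toDual t) ((survivingMinus_iff_dual σ _).mp ht)

theorem goodPlus_iff_dual (σ : ι → SignType) (s : ι) :
    GoodPlus σ s ↔
      GoodMinus (ι := ιᵒᵈ) (fun u => -σ (OrderDual.ofDual u)) (OrderDual.toDual s) := by
  unfold GoodMinus GoodPlus
  rw [survivingPlus_iff_dual]
  refine and_congr Iff.rfl ⟨fun h t ht => ?_, fun h t ht => ?_⟩
  · exact h (OrderDual.ofDual t) ((survivingPlus_iff_dual σ _).mpr ht)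
  · exact h (OrderDual.toDual t) ((survivingPlus_iff_dual σ _).mp ht)

theorem GoodPlus.unique {σ : ι → SignType} {s t : ι} (hs : GoodPlus σ s) (ht : GoodPlus σ t) :
    s = t :=
  le_antisymm (hs.2 t ht.1) (ht.2 s hs.1)

theorem GoodMinus.unique {σ : ι → SignType} {s t : ι} (hs : GoodMinus σ s) (ht : GoodMinus σ t) :
    s = t :=
  le_antisymm (ht.2 s hs.1) (hs.2 t ht.1)

/-- To the left of the good sign `+`, every `+` is cancelled against a `-` that is also to the left
of it. -/
theorem GoodPlus.sum_Ico_nonpos {σ : ι → SignType} {s : ι} (h : GoodPlus σ s) (t : ι) (ht : t < s) :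
    ∑ u ∈ Finset.Ico t s, (σ u : ℤ) ≤ 0 := by
  by_contra hpos
  -- the right-most place `m` where the claim fails would carry a surviving sign `+`
  have hne : ((Finset.Ico t s).filter fun u => 0 < ∑ v ∈ Finset.Ico u s, (σ v : ℤ)).Nonempty :=
    ⟨t, by simpa [ht] using hpos⟩
  obtain ⟨hm, hmax⟩ := (Finset.isGreatest_max' _ hne)
  set m := Finset.max' _ hne with hmdef
  simp only [Finset.coe_filter, Finset.mem_Ico, Set.mem_ofPred_eq] at hm
  obtain ⟨⟨htm, hms⟩, hm⟩ := hm
  have hle : ∀ u, m < u → u < s → ∑ v ∈ Finset.Ico u s, (σ v : ℤ) ≤ 0 := by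
    intro u hmu hus
    by_contra hu
    have : u ≤ m := hmax (by
      simp only [Finset.coe_filter, Finset.mem_Ico, Set.mem_ofPred_eq]
      exact ⟨⟨htm.trans hmu.le, hus⟩, not_le.mp hu⟩)
    exact absurd this (not_le.mpr hmu)
  have hIoo : ∀ u, m ≤ u → ∑ v ∈ Finset.Ioo u s, (σ v : ℤ) ≤ 0 := by
    intro u hu
    rcases sum_Ioo_eq_zero_or' (fun v => (σ v : ℤ)) (s := u) (t := s) with h' | ⟨w, hw, hws, h'⟩
    · exact h'.le
    · rw [h']
      exact hle w (hu.trans_lt hw) hws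
  rw [sum_Ico_eq_add_sum_Ioo _ hms] at hm
  have hm0 := hIoo m le_rfl
  have hσm : σ m = 1 ∧ ∑ v ∈ Finset.Ioo m s, (σ v : ℤ) = 0 := by
    have : ∀ x : SignType, x = 1 ∨ (x : ℤ) ≤ 0 := by decide
    rcases this (σ m) with h1 | h1
    · rw [h1] at hm
      refine ⟨h1, ?_⟩
      simp only [SignType.coe_one] at hm
      omega
    · omega
  have hs1 : (σ s : ℤ) = 1 := by rw [h.1.1]; rfl
  refine absurd (h.2 m ⟨hσm.1, fun u hu => ?_⟩) (not_le.mpr hms)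
  have hms' := sum_Ioc_eq_sum_Ioo_add (fun v => (σ v : ℤ)) hms
  simp only [hσm.2, hs1] at hms'
  rcases lt_or_ge u s with hus | hus
  · have h1 := sum_Ioc_add_sum_Ioc (fun v => (σ v : ℤ)) hu.le hus.le
    have h2 := sum_Ioc_eq_sum_Ioo_add (fun v => (σ v : ℤ)) hus
    have h3 := hIoo u hu.le
    simp only [hs1] at h2
    omega
  · have h1 := sum_Ioc_add_sum_Ioc (fun v => (σ v : ℤ)) hms.le hus
    rcases hus.eq_or_lt with rfl | hus
    · omega
    · have := h.1.2 u hus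
      omega

/-- The operator `ẽ_k` undoes `f̃_k`: if the good `+` is turned into a `-`, this is the good `-`. -/
theorem GoodPlus.goodMinus_update {σ : ι → SignType} {s : ι} (h : GoodPlus σ s) :
    GoodMinus (Function.update σ s (-1)) s := by
  refine ⟨⟨Function.update_self .., fun t ht => ?_⟩, fun t ht => ?_⟩
  · rw [sum_update_of_notMem (by simp)]
    exact h.sum_Ico_nonpos t ht
  · by_contra hst
    rw [not_le] at hst
    -- a surviving `-` at `t` needs `∑_{(s,t)} ≤ 0`, and the `+` at `s` needs `∑_{(s,t]} ≥ 0`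
    have h1 := h.1.2 t hst
    rw [sum_Ioc_eq_sum_Ioo_add _ hst] at h1
    have ht1 : σ t = -1 := by
      have := ht.1
      rwa [Function.update_of_ne hst.ne'] at this
    rw [ht1] at h1
    have h2 : ∑ v ∈ Finset.Ioo s t, (σ v : ℤ) ≤ 0 := by
      rcases sum_Ioo_eq_zero_or' (fun v => (σ v : ℤ)) (s := s) (t := t) with h' | ⟨w, hw, hwt, h'⟩
      · exact h'.le
      · rw [h']
        have := ht.2 w hwt
        rwa [sum_update_of_notMem (by simp [hw])] at this
    have h3 : (((-1 : SignType) : SignType) : ℤ) = -1 := rfl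
    omega

theorem GoodMinus.goodPlus_update {σ : ι → SignType} {s : ι} (h : GoodMinus σ s) :
    GoodPlus (Function.update σ s 1) s := by
  have h1 := ((goodMinus_iff_dual σ s).mp h).goodMinus_update
  rw [goodPlus_iff_dual]
  convert! h1 using 1
  funext u
  obtain ⟨u, rfl⟩ := OrderDual.toDual.surjective u
  rw [OrderDual.ofDual_toDual]
  by_cases hu : u = s
  · rw [hu, Function.update_self, Function.update_self]
  · have : OrderDual.toDual u ≠ OrderDual.toDual s := hu
    rw [Function.update_of_ne hu, Function.update_of_ne this, OrderDual.ofDual_toDual]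

theorem GoodPlus.survivingPlus_update_iff {σ : ι → SignType} {s : ι} (h : GoodPlus σ s) (u : ι) :
    SurvivingPlus (Function.update σ s (-1)) u ↔ SurvivingPlus σ u ∧ u ≠ s := by
  rcases lt_trichotomy u s with hu | rfl | hu
  · refine iff_of_false (fun h' => ?_) (fun h' => absurd (h.2 u h'.1) (not_le.mpr hu))
    refine absurd (h.2 u ⟨?_, fun t ht => (h'.2 t ht).trans ?_⟩) (not_le.mpr hu)
    · have := h'.1
      rwa [Function.update_of_ne hu.ne] at this
    · refine Finset.sum_le_sum fun v _ => ?_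
      by_cases hv : v = s
      · subst hv
        rw [Function.update_self, h.1.1]
        decide
      · rw [Function.update_of_ne hv]
  · refine iff_of_false (fun h' => ?_) (fun h' => h'.2 rfl)
    have := h'.1
    rw [Function.update_self] at this
    exact absurd this (by decide)
  · unfold SurvivingPlus
    rw [Function.update_of_ne hu.ne']
    have : ∀ t, ∑ v ∈ Finset.Ioc u t, (Function.update σ s (-1) v : ℤ) =
        ∑ v ∈ Finset.Ioc u t, (σ v : ℤ) := fun t => sum_update_of_notMem (by simp [hu.le])
    simp only [this, hu.ne', ne_eq, not_false_eq_true, and_true]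

/-! Replacing the signs at two consecutive places by signs with the same reduced sequence. -/

/-- A sign to the left of two consecutive places `l` and `l'` sees the signs at these places only
through their sum and the least partial sum. -/
theorem survivingPlus_of_lt_block {σ : ι → SignType} {l l' : ι} (h : l ⋖ l') {s : ι} (hs : s < l) :
    SurvivingPlus σ s ↔ σ s = 1 ∧ (∀ t, s < t → t < l → 0 ≤ ∑ v ∈ Finset.Ioc s t, (σ v : ℤ)) ∧
      0 ≤ ∑ v ∈ Finset.Ioo s l, (σ v : ℤ) + min 0 (min (σ l : ℤ) (σ l + σ l')) ∧
      ∀ t, l' < t → 0 ≤ ∑ v ∈ Finset.Ioo s l, (σ v : ℤ) + (σ l + σ l') +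
        ∑ v ∈ Finset.Ioc l' t, (σ v : ℤ) := by
  have e1 := sum_Ioc_eq_sum_Ioo_add (fun v => (σ v : ℤ)) hs
  have e2 := sum_Ioc_add_sum_Ioc (fun v => (σ v : ℤ)) hs.le h.lt.le
  rw [sum_Ioc_of_covBy _ h] at e2
  have e3 : ∀ t, l' < t → _ := fun t ht =>
    sum_Ioc_add_sum_Ioc (fun v => (σ v : ℤ)) (hs.trans h.lt).le ht.le
  constructor
  · intro hσ
    have h0 := hσ.sum_Ioo_nonneg l
    have h1 := hσ.2 l hs
    have h2 := hσ.2 l' (hs.trans h.lt)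
    refine ⟨hσ.1, fun t ht _ => hσ.2 t ht, by omega, fun t ht => ?_⟩
    have := hσ.2 t ((hs.trans h.lt).trans ht)
    have := e3 t ht
    omega
  · rintro ⟨h1, h2, h3, h4⟩
    refine ⟨h1, fun t ht => ?_⟩
    rcases lt_trichotomy t l with htl | rfl | htl
    · exact h2 t ht htl
    · omega
    · rcases (h.ge_of_gt htl).eq_or_lt with rfl | htl'
      · omega
      · have := e3 t htl'
        have := h4 t htl'
        omega

theorem survivingPlus_block_left {σ : ι → SignType} {l l' : ι} (h : l ⋖ l') :
    SurvivingPlus σ l ↔ σ l = 1 ∧ 0 ≤ (σ l' : ℤ) ∧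
      ∀ t, l' < t → 0 ≤ (σ l' : ℤ) + ∑ v ∈ Finset.Ioc l' t, (σ v : ℤ) := by
  have e2 := sum_Ioc_of_covBy (fun v => (σ v : ℤ)) h
  have e3 : ∀ t, l' < t → _ := fun t ht =>
    sum_Ioc_add_sum_Ioc (fun v => (σ v : ℤ)) h.lt.le ht.le
  refine and_congr Iff.rfl ⟨fun hσ => ⟨e2 ▸ hσ l' h.lt, fun t ht => ?_⟩, fun hσ t ht => ?_⟩
  · rw [← e2, e3 t ht]
    exact hσ t (h.lt.trans ht)
  · rcases (h.ge_of_gt ht).eq_or_lt with rfl | ht'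
    · exact e2.symm ▸ hσ.1
    · rw [← e3 t ht', e2]
      exact hσ.2 t ht'

/-- If the signs at two consecutive places are replaced by signs with the same reduced sequence, as
the conditions on the sum and on the least partial sum express, then the surviving signs `+` stay
where they are, up to a transposition of the two places. -/
theorem exists_perm_survivingPlus {σ σ' : ι → SignType} {l l' : ι} (h : l ⋖ l')
    (hoff : ∀ u, u ≠ l → u ≠ l' → σ' u = σ u)
    (hsum : (σ' l : ℤ) + σ' l' = σ l + σ l')
    (hmin : min 0 (min (σ' l : ℤ) (σ' l + σ' l')) = min 0 (min (σ l : ℤ) (σ l + σ l'))) :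
    ∃ π : Equiv.Perm ι, (∀ u, u ≠ l → u ≠ l' → π u = u) ∧
      (∀ u, (u = l ∨ u = l') → (π u = l ∨ π u = l')) ∧
      ∀ u, SurvivingPlus σ' (π u) ↔ SurvivingPlus σ u := by
  have hIoc : ∀ s, l' ≤ s → ∀ t, ∑ v ∈ Finset.Ioc s t, (σ' v : ℤ) =
      ∑ v ∈ Finset.Ioc s t, (σ v : ℤ) := by
    intro s hs t
    refine Finset.sum_congr rfl fun v hv => ?_
    have := hs.trans_lt (Finset.mem_Ioc.mp hv).1
    rw [hoff v (h.lt.trans this).ne' this.ne']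
  have hout : ∀ u, u ≠ l → u ≠ l' → (SurvivingPlus σ' u ↔ SurvivingPlus σ u) := by
    intro u hu hu'
    rcases lt_or_gt_of_ne hu with hlt | hgt
    · rw [survivingPlus_of_lt_block h hlt, survivingPlus_of_lt_block h hlt, hoff u hu hu',
        hmin, hsum]
      have e1 : ∀ t, t < l → ∑ v ∈ Finset.Ioc u t, (σ' v : ℤ) =
          ∑ v ∈ Finset.Ioc u t, (σ v : ℤ) := by
        intro t ht
        refine Finset.sum_congr rfl fun v hv => ?_
        have := (Finset.mem_Ioc.mp hv).2.trans_lt ht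
        rw [hoff v this.ne (this.trans h.lt).ne]
      have e2 : ∑ v ∈ Finset.Ioo u l, (σ' v : ℤ) = ∑ v ∈ Finset.Ioo u l, (σ v : ℤ) := by
        refine Finset.sum_congr rfl fun v hv => ?_
        have := (Finset.mem_Ioo.mp hv).2
        rw [hoff v this.ne (this.trans h.lt).ne]
      rw [e2]
      simp only [hIoc l' le_rfl]
      refine and_congr Iff.rfl (and_congr (forall_congr' fun t => ?_) Iff.rfl)
      refine forall_congr' fun _ => forall_congr' fun ht => ?_
      rw [e1 t ht]
    · have hgt' : l' ≤ u := h.ge_of_gt hgt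
      unfold SurvivingPlus
      simp only [hIoc u hgt', hoff u hu hu']
  have hl := survivingPlus_block_left (σ := σ) h
  have hl2 := survivingPlus_block_left (σ := σ') h
  have hr : SurvivingPlus σ l' ↔ σ l' = 1 ∧ ∀ t, l' < t → 0 ≤ ∑ v ∈ Finset.Ioc l' t, (σ v : ℤ) :=
    Iff.rfl
  have hr2 : SurvivingPlus σ' l' ↔
      σ' l' = 1 ∧ ∀ t, l' < t → 0 ≤ ∑ v ∈ Finset.Ioc l' t, (σ v : ℤ) := by
    unfold SurvivingPlus
    simp only [hIoc l' le_rfl]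
  simp only [hIoc l' le_rfl] at hl2
  have key :
      ((SurvivingPlus σ' l ↔ SurvivingPlus σ l) ∧ (SurvivingPlus σ' l' ↔ SurvivingPlus σ l')) ∨
      ((SurvivingPlus σ' l' ↔ SurvivingPlus σ l) ∧ (SurvivingPlus σ' l ↔ SurvivingPlus σ l')) := by
    rw [hl, hl2, hr, hr2]
    revert hsum hmin
    generalize σ l = x, σ l' = y, σ' l = x', σ' l' = y'
    clear hl hl2 hr hr2 hout hIoc hoff
    intro hsum hmin
    rcases x with _ | _ | _ <;> rcases y with _ | _ | _ <;> rcases x' with _ | _ | _ <;>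
      rcases y' with _ | _ | _ <;> simp at hsum hmin ⊢
  rcases key with ⟨k1, k2⟩ | ⟨k1, k2⟩
  · refine ⟨1, fun _ _ _ => rfl, fun _ hu => hu, fun u => ?_⟩
    rw [Equiv.Perm.one_apply]
    by_cases hu : u = l
    · rw [hu, k1]
    by_cases hu' : u = l'
    · rw [hu', k2]
    exact hout u hu hu'
  · refine ⟨Equiv.swap l l', fun u hu hu' => Equiv.swap_apply_of_ne_of_ne hu hu', ?_, fun u => ?_⟩
    · rintro u (rfl | rfl)
      · exact Or.inr (Equiv.swap_apply_left _ _)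
      · exact Or.inl (Equiv.swap_apply_right _ _)
    by_cases hu : u = l
    · rw [hu, Equiv.swap_apply_left, k1]
    by_cases hu' : u = l'
    · rw [hu', Equiv.swap_apply_right, k2]
    rw [Equiv.swap_apply_of_ne_of_ne hu hu']
    exact hout u hu hu'

end SignatureLemmas

/-! ### Counting the surviving signs -/

/-- The number of signs `-` in the reduced sequence of a list of signs. In terms of the partial
sums it is the largest value of `0` and of the opposites of the sums of the initial segments. -/
def listEps : List ℤ → ℤ
  | [] => 0
  | x :: l => max (max 0 (-x)) (listEps l - x)

theorem listEps_nonneg (l : List ℤ) : 0 ≤ listEps l := by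
  cases l with
  | nil => exact le_rfl
  | cons x l => exact (le_max_left _ _).trans (le_max_left _ _)

theorem listEps_append (l m : List ℤ) :
    listEps (l ++ m) = max (listEps l) (listEps m - l.sum) := by
  induction l with
  | nil => simp [listEps, listEps_nonneg]
  | cons x l ih =>
    rw [List.cons_append, listEps, ih, listEps, List.sum_cons]
    omega

theorem listEps_reverse_neg (l : List ℤ) :
    listEps (l.map Neg.neg).reverse = listEps l + l.sum := by
  induction l with
  | nil => simp [listEps]
  | cons x l ih =>
    rw [List.map_cons, List.reverse_cons, listEps_append, ih, List.sum_reverse, ← List.sum_neg,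
      List.sum_cons, listEps, listEps, listEps]
    omega

section Count

variable {ι : Type} [LinearOrder ι] [LocallyFiniteOrder ι]

/-- The list `L` enumerates, in increasing order, all places with a sign to the right of `s`. Then
`listEps` is the largest value of `0` and of the opposites of the partial sums that start behind
`s`, which is how the definition of `SurvivingPlus` counts. -/
theorem listEps_le_iff {σ : ι → SignType} {L : List ι} (hL : L.Pairwise (· < ·)) {s : ι}
    (hs : ∀ u ∈ L, s < u) (hσ : ∀ u, s < u → σ u ≠ 0 → u ∈ L) (c : ℤ) :
    listEps (L.map fun u => (σ u : ℤ)) ≤ c ↔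
      0 ≤ c ∧ ∀ t, s < t → -c ≤ ∑ v ∈ Finset.Ioc s t, (σ v : ℤ) := by
  induction L generalizing s c with
  | nil =>
    have h0 : ∀ t, ∑ v ∈ Finset.Ioc s t, (σ v : ℤ) = 0 := by
      intro t
      refine Finset.sum_eq_zero fun v hv => ?_
      by_contra hv'
      refine List.not_mem_nil (hσ v (Finset.mem_Ioc.mp hv).1 fun h => hv' ?_)
      rw [h]
      rfl
    simp only [List.map_nil, listEps, h0]
    exact ⟨fun h => ⟨h, fun _ _ => by omega⟩, fun h => h.1⟩
  | cons a L ih =>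
    rw [List.pairwise_cons] at hL
    have hsa := hs a List.mem_cons_self
    have ih := ih hL.2 hL.1 (fun u hu hu' =>
      (List.mem_cons.mp (hσ u (hsa.trans hu) hu')).resolve_left hu.ne') (c + σ a)
    have hz : ∀ v, s < v → v < a → (σ v : ℤ) = 0 := by
      intro v hv hva
      by_contra h0
      rcases List.mem_cons.mp (hσ v hv fun h => h0 (by rw [h]; rfl)) with h | h
      · exact hva.ne h
      · exact absurd (hL.1 v h) (not_lt.mpr hva.le)
    have hlt : ∀ t, t < a → ∑ v ∈ Finset.Ioc s t, (σ v : ℤ) = 0 := fun t ht =>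
      Finset.sum_eq_zero fun v hv =>
        hz v (Finset.mem_Ioc.mp hv).1 ((Finset.mem_Ioc.mp hv).2.trans_lt ht)
    have ha : ∑ v ∈ Finset.Ioc s a, (σ v : ℤ) = σ a := by
      rw [sum_Ioc_eq_sum_Ioo_add _ hsa, Finset.sum_eq_zero fun v hv =>
        hz v (Finset.mem_Ioo.mp hv).1 (Finset.mem_Ioo.mp hv).2, zero_add]
    have hgt : ∀ t, a < t → _ := fun t ht =>
      sum_Ioc_add_sum_Ioc (fun v => (σ v : ℤ)) hsa.le ht.le
    rw [List.map_cons, listEps, max_le_iff, max_le_iff, sub_le_iff_le_add, ih]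
    constructor
    · rintro ⟨⟨h1, h2⟩, h3, h4⟩
      refine ⟨h1, fun t ht => ?_⟩
      rcases lt_trichotomy t a with hta | rfl | hta
      · rw [hlt t hta]
        omega
      · omega
      · have := hgt t hta
        have := h4 t hta
        omega
    · rintro ⟨h1, h2⟩
      have := h2 a hsa
      refine ⟨⟨h1, by omega⟩, by omega, fun t ht => ?_⟩
      have := hgt t ht
      have := h2 t (hsa.trans ht)
      omega

theorem survivingPlus_iff_listEps {σ : ι → SignType} {L : List ι} (hL : L.Pairwise (· < ·)) {s : ι}
    (hs : ∀ u ∈ L, s < u) (hσ : ∀ u, s < u → σ u ≠ 0 → u ∈ L) :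
    SurvivingPlus σ s ↔ σ s = 1 ∧ listEps (L.map fun u => (σ u : ℤ)) = 0 := by
  have := listEps_le_iff hL hs hσ 0
  have h0 := listEps_nonneg (L.map fun u => (σ u : ℤ))
  refine and_congr Iff.rfl ⟨fun h => ?_, fun h => ?_⟩
  · exact le_antisymm (this.mpr ⟨le_rfl, by simpa using h⟩) h0
  · simpa using (this.mp h.le).2

open Classical in
theorem length_filter_survivingPlus {σ : ι → SignType} {L : List ι} (hL : L.Pairwise (· < ·))
    (hσ : ∀ s ∈ L, ∀ u, s < u → σ u ≠ 0 → u ∈ L) :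
    ((L.filter fun s => SurvivingPlus σ s).length : ℤ) =
      (L.map fun u => (σ u : ℤ)).sum + listEps (L.map fun u => (σ u : ℤ)) := by
  induction L with
  | nil => simp [listEps]
  | cons a L ih =>
    rw [List.pairwise_cons] at hL
    have hσa : ∀ u, a < u → σ u ≠ 0 → u ∈ L := fun u hu hu' =>
      (List.mem_cons.mp (hσ a List.mem_cons_self u hu hu')).resolve_left hu.ne'
    have ih := ih hL.2 fun s hs u hu => hσa u ((hL.1 s hs).trans hu)
    have hsurv := survivingPlus_iff_listEps hL.2 hL.1 hσa
    have h0 := listEps_nonneg (L.map fun u => (σ u : ℤ))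
    rw [List.map_cons, List.sum_cons, listEps, List.filter_cons]
    generalize listEps (L.map fun u => (σ u : ℤ)) = e at *
    split_ifs with h
    · rw [decide_eq_true_iff, hsurv] at h
      rw [List.length_cons, Nat.cast_succ, ih, h.1, h.2, SignType.coe_one]
      omega
    · rw [decide_eq_true_iff, hsurv] at h
      rw [ih]
      have : σ a = 1 ∨ σ a = 0 ∨ σ a = -1 := by
        generalize σ a = x
        revert x
        decide
      rcases this with h1 | h1 | h1
      · rw [h1, SignType.coe_one]
        have : e ≠ 0 := fun h' => h ⟨h1, h'⟩
        omega
      · rw [h1, SignType.coe_zero]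
        omega
      · rw [h1, SignType.coe_neg_one]
        omega

theorem natCard_survivingPlus {σ : ι → SignType} {L : List ι} (hL : L.Pairwise (· < ·))
    (hσ : ∀ u, σ u ≠ 0 → u ∈ L) :
    (Nat.card {s // SurvivingPlus σ s} : ℤ) =
      (L.map fun u => (σ u : ℤ)).sum + listEps (L.map fun u => (σ u : ℤ)) := by
  classical
  rw [← length_filter_survivingPlus hL fun _ _ u _ => hσ u]
  have hnd : (L.filter fun s => SurvivingPlus σ s).Nodup :=
    List.Nodup.filter _ (hL.imp fun h => h.ne)
  rw [← List.toFinset_card_of_nodup hnd, ← Nat.card_eq_finsetCard]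
  congr 1
  refine Nat.card_congr (Equiv.subtypeEquivRight fun s => ?_)
  rw [List.mem_toFinset, List.mem_filter, decide_eq_true_iff]
  refine ⟨fun h => ⟨hσ s ?_, h⟩, fun h => h.2⟩
  rw [h.1]
  decide

theorem natCard_survivingMinus {σ : ι → SignType} {L : List ι} (hL : L.Pairwise (· < ·))
    (hσ : ∀ u, σ u ≠ 0 → u ∈ L) :
    (Nat.card {s // SurvivingMinus σ s} : ℤ) = listEps (L.map fun u => (σ u : ℤ)) := by
  have h1 := natCard_survivingPlus (ι := ιᵒᵈ) (σ := fun u => -σ (OrderDual.ofDual u))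
    (L := (L.map OrderDual.toDual).reverse)
    (by
      rw [List.pairwise_reverse, List.pairwise_map]
      exact hL)
    (by
      intro u hu
      rw [List.mem_reverse, List.mem_map]
      refine ⟨OrderDual.ofDual u, hσ _ fun h => hu ?_, rfl⟩
      rw [h]
      rfl)
  have h2 : (L.map OrderDual.toDual).reverse.map
      (fun u => ((-σ (OrderDual.ofDual u) : SignType) : ℤ)) =
      ((L.map fun u => (σ u : ℤ)).map Neg.neg).reverse := by
    rw [List.map_reverse, List.map_map, List.map_map]
    congr 1
    refine List.map_congr_left fun u _ => ?_
    simp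
  rw [h2, listEps_reverse_neg, List.sum_reverse, ← List.sum_neg] at h1
  rw [Nat.card_congr (Equiv.subtypeEquiv OrderDual.toDual fun s => survivingMinus_iff_dual σ s), h1]
  omega

theorem finite_survivingPlus {σ : ι → SignType} (h : {s | σ s ≠ 0}.Finite) :
    {s | SurvivingPlus σ s}.Finite :=
  h.subset fun s hs => by
    show σ s ≠ 0
    rw [show σ s = 1 from hs.1]
    decide

theorem natCard_sub_natCard {σ : ι → SignType} (h : {s | σ s ≠ 0}.Finite) :
    (Nat.card {s // SurvivingPlus σ s} : ℤ) - Nat.card {s // SurvivingMinus σ s} =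
      ∑ s ∈ h.toFinset, (σ s : ℤ) := by
  have hL : (h.toFinset.sort (· ≤ ·)).Pairwise (· < ·) := (Finset.sortedLT_sort _).pairwise
  have hσ : ∀ u, σ u ≠ 0 → u ∈ h.toFinset.sort (· ≤ ·) := fun u hu => by simpa using hu
  rw [natCard_survivingPlus hL hσ, natCard_survivingMinus hL hσ, add_sub_cancel_right,
    ← List.sum_toFinset _ (Finset.sort_nodup _ _), Finset.sort_toFinset]

theorem exists_goodPlus {σ : ι → SignType} (h : {s | σ s ≠ 0}.Finite) {s : ι}
    (hs : SurvivingPlus σ s) : ∃ t, GoodPlus σ t := by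
  obtain ⟨m, hm, hmin⟩ := (finite_survivingPlus h).exists_minimalFor id _ ⟨s, hs⟩
  refine ⟨m, hm, fun t ht => ?_⟩
  rcases le_total m t with h | h
  · exact h
  · exact hmin ht h

theorem exists_goodMinus {σ : ι → SignType} (h : {s | σ s ≠ 0}.Finite) {s : ι}
    (hs : SurvivingMinus σ s) : ∃ t, GoodMinus σ t := by
  rw [survivingMinus_iff_dual] at hs
  have hfin : {u : ιᵒᵈ | -σ (OrderDual.ofDual u) ≠ 0}.Finite := h.subset fun u hu h0 => hu (by
    rw [show σ (OrderDual.ofDual u) = 0 from h0]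
    rfl)
  obtain ⟨t, ht⟩ := exists_goodPlus hfin hs
  exact ⟨OrderDual.ofDual t, (goodMinus_iff_dual σ _).mpr ht⟩

end Count

/-! ### Crystal operators on binary matrices -/

section MatrixOperators

variable {ι κ : Type} [LinearOrder ι] [LocallyFiniteOrder ι] [DecidableEq κ] {k k' : κ}
  {A A' : Matrix ι κ Bool}

/-- `A'` arises from `A` by moving an entry `1` from the position `(i₀, j₀)` to the position
`(i₁, j₁)`. -/
structure IsMove {ι κ : Type} [DecidableEq ι] [DecidableEq κ] (A A' : Matrix ι κ Bool) (i₀ : ι)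
    (j₀ : κ) (i₁ : ι) (j₁ : κ) : Prop where
  source : A i₀ j₀ = true
  target : A i₁ j₁ = false
  apply : ∀ i j, A' i j =
    if i = i₁ ∧ j = j₁ then true else if i = i₀ ∧ j = j₀ then false else A i j

omit [LinearOrder ι] [LocallyFiniteOrder ι] [DecidableEq κ] in
theorem rowSign_eq_one_iff {s : ι} : rowSign k k' A s = 1 ↔ A s k = true ∧ A s k' = false := by
  unfold rowSign
  cases A s k <;> cases A s k' <;> decide

omit [LinearOrder ι] [LocallyFiniteOrder ι] [DecidableEq κ] in
theorem rowSign_eq_neg_one_iff {s : ι} :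
    rowSign k k' A s = -1 ↔ A s k = false ∧ A s k' = true := by
  unfold rowSign
  cases A s k <;> cases A s k' <;> decide

omit [LinearOrder ι] [LocallyFiniteOrder ι] [DecidableEq κ] in
theorem coe_rowSign (k k' : κ) (A : Matrix ι κ Bool) (s : ι) : (rowSign k k' A s : ℤ) =
    (if A s k = true then 1 else 0) - (if A s k' = true then 1 else 0) := by
  unfold rowSign
  cases A s k <;> cases A s k' <;> rfl

theorem matF_eq_some_iff : matF k k' A = some A' ↔
    ∃ s, GoodPlus (rowSign k k' A) s ∧ IsMove A A' s k s k' := by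
  have key : ∀ s, GoodPlus (rowSign k k' A) s → ((A.updateRow s
      (Function.update (Function.update (A s) k false) k' true)) = A' ↔ IsMove A A' s k s k') := by
    intro s hs
    have h1 := rowSign_eq_one_iff.mp hs.1.1
    constructor
    · rintro rfl
      refine ⟨h1.1, h1.2, fun i j => ?_⟩
      by_cases hi : i = s
      · subst hi
        simp [Matrix.updateRow_apply, Function.update_apply]
      · simp [Matrix.updateRow_apply, hi]
    · intro h
      ext i j
      rw [h.apply]
      by_cases hi : i = s
      · subst hi
        simp [Matrix.updateRow_apply, Function.update_apply]
      · simp [Matrix.updateRow_apply, hi]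
  unfold matF
  split_ifs with h
  · rw [Option.some_inj, key _ h.choose_spec]
    constructor
    · exact fun h' => ⟨_, h.choose_spec, h'⟩
    · rintro ⟨s, hs, h'⟩
      rwa [h.choose_spec.unique hs]
  · refine iff_of_false (by simp) ?_
    rintro ⟨s, hs, -⟩
    exact h ⟨s, hs⟩

theorem matE_eq_some_iff (hk : k ≠ k') : matE k k' A = some A' ↔
    ∃ s, GoodMinus (rowSign k k' A) s ∧ IsMove A A' s k' s k := by
  have key : ∀ s, GoodMinus (rowSign k k' A) s → ((A.updateRow s
      (Function.update (Function.update (A s) k true) k' false)) = A' ↔ IsMove A A' s k' s k) := by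
    intro s hs
    have h1 := rowSign_eq_neg_one_iff.mp hs.1.1
    constructor
    · rintro rfl
      refine ⟨h1.2, h1.1, fun i j => ?_⟩
      by_cases hi : i = s
      · subst hi
        by_cases hj : j = k' <;> simp [Matrix.updateRow_apply, Function.update_apply, hj, hk.symm]
      · simp [Matrix.updateRow_apply, hi]
    · intro h
      ext i j
      rw [h.apply]
      by_cases hi : i = s
      · subst hi
        by_cases hj : j = k' <;> simp [Matrix.updateRow_apply, Function.update_apply, hj, hk.symm]
      · simp [Matrix.updateRow_apply, hi]
  unfold matE
  split_ifs with h
  · rw [Option.some_inj, key _ h.choose_spec]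
    constructor
    · exact fun h' => ⟨_, h.choose_spec, h'⟩
    · rintro ⟨s, hs, h'⟩
      rwa [h.choose_spec.unique hs]
  · refine iff_of_false (by simp) ?_
    rintro ⟨s, hs, -⟩
    exact h ⟨s, hs⟩

omit [LocallyFiniteOrder ι] in
theorem IsMove.symm {i₀ i₁ : ι} {j₀ j₁ : κ} (h : IsMove A A' i₀ j₀ i₁ j₁) :
    IsMove A' A i₁ j₁ i₀ j₀ := by
  have hne : ¬(i₀ = i₁ ∧ j₀ = j₁) := by
    rintro ⟨rfl, rfl⟩
    exact absurd (h.source.symm.trans h.target) (by decide)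
  refine ⟨?_, ?_, fun i j => ?_⟩
  · simp [h.apply]
  · simp [h.apply, hne]
  · by_cases h0 : i = i₀ ∧ j = j₀
    · simp only [h0, and_self, if_true, h.source]
    · by_cases h1 : i = i₁ ∧ j = j₁
      · rw [if_neg h0, if_pos h1, h1.1, h1.2, h.target]
      · rw [if_neg h0, if_neg h1, h.apply, if_neg h1, if_neg h0]

omit [LocallyFiniteOrder ι] in
theorem IsMove.rowSign_eq (hk : k ≠ k') {s : ι} (h : IsMove A A' s k s k') :
    rowSign k k' A' = Function.update (rowSign k k' A) s (-1) := by
  funext i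
  by_cases hi : i = s
  · subst hi
    rw [Function.update_self, rowSign_eq_neg_one_iff]
    simp [h.apply, hk]
  · rw [Function.update_of_ne hi]
    unfold rowSign
    simp [h.apply, hi]

omit [LocallyFiniteOrder ι] in
theorem IsMove.rowSign_eq' (hk : k ≠ k') {s : ι} (h : IsMove A A' s k' s k) :
    rowSign k k' A' = Function.update (rowSign k k' A) s 1 := by
  funext i
  by_cases hi : i = s
  · subst hi
    rw [Function.update_self, rowSign_eq_one_iff]
    simp [h.apply, hk.symm]
  · rw [Function.update_of_ne hi]
    unfold rowSign
    simp [h.apply, hi]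

theorem matF_eq_some_iff_matE (hk : k ≠ k') : matF k k' A = some A' ↔ matE k k' A' = some A := by
  rw [matF_eq_some_iff, matE_eq_some_iff hk]
  constructor
  · rintro ⟨s, hs, h⟩
    refine ⟨s, ?_, h.symm⟩
    rw [h.rowSign_eq hk]
    exact hs.goodMinus_update
  · rintro ⟨s, hs, h⟩
    refine ⟨s, ?_, h.symm⟩
    rw [h.rowSign_eq' hk]
    exact hs.goodPlus_update

theorem matφ_of_matF (hk : k ≠ k') (hfin : {s | rowSign k k' A s ≠ 0}.Finite)
    (h : matF k k' A = some A') : matφ k k' A' = matφ k k' A - 1 := by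
  obtain ⟨s, hs, h⟩ := (matF_eq_some_iff).mp h
  unfold matφ
  rw [h.rowSign_eq hk]
  have h1 : {u | SurvivingPlus (Function.update (rowSign k k' A) s (-1)) u} =
      {u | SurvivingPlus (rowSign k k' A) u} \ {s} := by
    ext u
    exact hs.survivingPlus_update_iff u
  have h2 := Set.ncard_sdiff_singleton_add_one (s := {u | SurvivingPlus (rowSign k k' A) u})
    hs.1 (finite_survivingPlus hfin)
  rw [← h1] at h2
  have h3 : (Nat.card {u // SurvivingPlus (Function.update (rowSign k k' A) s (-1)) u}) + 1 =
    Nat.card {u // SurvivingPlus (rowSign k k' A) u} := h2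
  omega

theorem matF_eq_none_iff (hfin : {s | rowSign k k' A s ≠ 0}.Finite) :
    matF k k' A = none ↔ ∀ s, ¬SurvivingPlus (rowSign k k' A) s := by
  unfold matF
  split_ifs with h
  · refine iff_of_false (by simp) fun h' => ?_
    obtain ⟨s, hs⟩ := h
    exact h' s hs.1
  · exact iff_of_true rfl fun s hs => h (exists_goodPlus hfin hs)

theorem matE_eq_none_iff (hfin : {s | rowSign k k' A s ≠ 0}.Finite) :
    matE k k' A = none ↔ ∀ s, ¬SurvivingMinus (rowSign k k' A) s := by
  unfold matE
  split_ifs with h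
  · refine iff_of_false (by simp) fun h' => ?_
    obtain ⟨s, hs⟩ := h
    exact h' s hs.1
  · exact iff_of_true rfl fun s hs => h (exists_goodMinus hfin hs)

theorem matφ_eq_zero_iff (hfin : {s | rowSign k k' A s ≠ 0}.Finite) :
    matφ k k' A = 0 ↔ matF k k' A = none := by
  rw [matF_eq_none_iff hfin, matφ, Nat.cast_eq_zero]
  have : Finite {s // SurvivingPlus (rowSign k k' A) s} := (finite_survivingPlus hfin).to_subtype
  rw [Finite.card_eq_zero_iff, isEmpty_subtype]

theorem finite_survivingMinus {σ : ι → SignType} (h : {s | σ s ≠ 0}.Finite) :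
    {s | SurvivingMinus σ s}.Finite :=
  h.subset fun s hs => by
    show σ s ≠ 0
    rw [show σ s = -1 from hs.1]
    decide

theorem matε_eq_zero_iff (hfin : {s | rowSign k k' A s ≠ 0}.Finite) :
    matε k k' A = 0 ↔ matE k k' A = none := by
  rw [matE_eq_none_iff hfin, matε, Nat.cast_eq_zero]
  have : Finite {s // SurvivingMinus (rowSign k k' A) s} := (finite_survivingMinus hfin).to_subtype
  rw [Finite.card_eq_zero_iff, isEmpty_subtype]

omit [DecidableEq κ] in
theorem matφ_sub_matε {S : Finset ι} (hS : ∀ s, rowSign k k' A s ≠ 0 → s ∈ S) :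
    matφ k k' A - matε k k' A = ∑ s ∈ S, (rowSign k k' A s : ℤ) := by
  have hfin : {s | rowSign k k' A s ≠ 0}.Finite := S.finite_toSet.subset hS
  unfold matφ matε
  rw [natCard_sub_natCard hfin]
  refine Finset.sum_subset (fun s hs => hS s (by simpa using hs)) fun s _ hs => ?_
  rw [Set.Finite.mem_toFinset] at hs
  rw [not_not.mp hs]
  rfl

end MatrixOperators

/-! ### The two crystal structures on binary matrices -/

/-- What the data of `𝔤𝔩_∞` and `𝔤𝔩_n` have in common: the basis is linearly ordered, a simple root
joins two consecutive basis vectors, and `⟨ϵ_a, h_k⟩ = δ_{a,k} - δ_{a,k+1}`. -/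
structure GlDatum.IsStandard {κ : Type} [LinearOrder κ] (D : GlDatum κ) : Prop where
  covBy : ∀ k, D.fst k ⋖ D.snd k
  coroot_eps : ∀ k a, D.coroot k (D.eps a) =
    (if a = D.fst k then 1 else 0) - (if a = D.snd k then 1 else 0)

theorem GlDatum.IsStandard.coroot_root {κ : Type} [LinearOrder κ] {D : GlDatum κ}
    (hD : D.IsStandard) (k : D.Idx) : D.coroot k (D.root k) = 2 := by
  have := (hD.covBy k).ne
  unfold GlDatum.root
  rw [map_sub, hD.coroot_eps, hD.coroot_eps, if_pos rfl, if_neg this, if_neg this.symm, if_pos rfl]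
  rfl

theorem glInfty_isStandard : glInfty.IsStandard where
  covBy k := Order.covBy_add_one (α := ℤ) k
  coroot_eps := fun (k a : ℤ) => by
    show ((Finsupp.single a 1 : ℤ →₀ ℤ) k - (Finsupp.single a 1 : ℤ →₀ ℤ) (k + 1) +
      if k = 0 then 0 else 0) = _
    rw [ite_self, add_zero, Finsupp.single_apply, Finsupp.single_apply]
    rfl

theorem glFin_isStandard (n : ℕ) : (glFin n).IsStandard where
  covBy k := by
    refine ⟨Fin.lt_def.mpr (Nat.lt_succ_self k.1), fun c h1 h2 => ?_⟩
    have h1 : k.1 < c.1 := h1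
    have h2 : c.1 < k.1 + 1 := h2
    omega
  coroot_eps k a := by
    show (Pi.single a 1 : Fin n → ℤ) ((glFin n).fst k) -
      (Pi.single a 1 : Fin n → ℤ) ((glFin n).snd k)
      = _
    rw [Pi.single_apply, Pi.single_apply]
    simp only [eq_comm]

/-- A crystal whose `ε` and `φ` have integral values satisfies the axioms as soon as those that
concern `φ`, `wt` and `f̃` hold. -/
theorem CrystalData.isCrystal_of_int {κ B : Type} [LinearOrder κ] {D : GlDatum κ}
    (hD : D.IsStandard) {C : CrystalData D B} (ε φ : D.Idx → B → ℤ)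
    (hε : ∀ i b, C.ε i b = (ε i b : ℤ)) (hφ : ∀ i b, C.φ i b = (φ i b : ℤ))
    (h1 : ∀ i b, φ i b - ε i b = D.coroot i (C.wt b))
    (h2 : ∀ i b b', C.f i b = some b' → φ i b' = φ i b - 1)
    (h3 : ∀ i b b', C.f i b = some b' → C.wt b' = C.wt b - D.root i)
    (h4 : ∀ i b b', C.f i b = some b' ↔ C.e i b' = some b) : C.IsCrystal := by
  have h5 : ∀ i b b', C.f i b = some b' → ε i b' = ε i b + 1 := by
    intro i b b' h
    have e1 := h1 i b
    have e2 := h1 i b'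
    rw [h3 i b b' h, map_sub, hD.coroot_root, h2 i b b' h] at e2
    omega
  constructor
  · intro i b
    rw [hφ, hε, ← WithBot.coe_add, ← h1, sub_add_cancel]
  · intro i b b' h
    rw [hε, hε, ← WithBot.coe_add, h5 i b' b ((h4 i b' b).mpr h), add_neg_cancel_right]
  · intro i b b' h
    rw [hφ, hφ, ← WithBot.coe_add, h2 i b' b ((h4 i b' b).mpr h), sub_add_cancel]
  · intro i b b' h
    rw [h3 i b' b ((h4 i b' b).mpr h), sub_add_cancel]
  · intro i b b' h
    rw [hε, hε, ← WithBot.coe_add, h5 i b b' h]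
  · intro i b b' h
    rw [hφ, hφ, ← WithBot.coe_add, h2 i b b' h, sub_eq_add_neg]
  · exact h3
  · exact h4
  · intro i b h
    rw [hφ] at h
    exact absurd h WithBot.coe_ne_bot

theorem pmap_eq_some_iff_of_leftInverse {α β : Type} {p : α → Prop} {f : ∀ a, p a → β} {g : β → α}
    (hg : ∀ a h, g (f a h) = a) (hg' : Function.Injective g) {x : Option α}
    {hx : ∀ a ∈ x, p a} {b : β} : x.pmap f hx = some b ↔ x = some (g b) := by
  cases x with
  | none => simp
  | some a =>
    rw [Option.pmap_some, Option.some_inj, Option.some_inj, ← hg'.eq_iff, hg]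

theorem rho_apply {n : ℕ} (A : Matrix (Fin n) ℤ Bool) (m : ℤ) (i : Fin n) :
    rho A m i = A i (-m) := rfl

namespace BinMat

variable {n : ℕ}

/-- The positions of the entries `1`. -/
noncomputable def supp (A : BinMat n) : Finset (Σ _ : Fin n, ℤ) :=
  Finset.univ.sigma fun i => (A.2 i).toFinset

theorem mem_supp {A : BinMat n} {p : Σ _ : Fin n, ℤ} : p ∈ A.supp ↔ A.1 p.1 p.2 = true := by
  simp [supp]

theorem sum_supp_of_isMove {M : Type} [AddCommGroup M] {A A' : BinMat n} {i₀ i₁ : Fin n}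
    {j₀ j₁ : ℤ} (h : IsMove A.1 A'.1 i₀ j₀ i₁ j₁) (g : Fin n → ℤ → M) :
    ∑ p ∈ A'.supp, g p.1 p.2 = ∑ p ∈ A.supp, g p.1 p.2 - g i₀ j₀ + g i₁ j₁ := by
  have h0 : (⟨i₀, j₀⟩ : Σ _ : Fin n, ℤ) ∈ A.supp := mem_supp.mpr h.source
  have h1 : (⟨i₁, j₁⟩ : Σ _ : Fin n, ℤ) ∉ A.supp := fun h' =>
    absurd ((mem_supp.mp h').symm.trans h.target) (by decide)
  have hA' : A'.supp = insert ⟨i₁, j₁⟩ (A.supp.erase ⟨i₀, j₀⟩) := by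
    ext ⟨i, j⟩
    rw [mem_supp, h.apply, Finset.mem_insert, Finset.mem_erase, mem_supp]
    simp only [Sigma.mk.injEq, heq_eq_eq, ne_eq]
    split_ifs with e1 e2
    · simp [e1]
    · simp only [e2, and_self, not_true, false_and, or_false]
      exact iff_of_false (by decide) fun h' => e1 ⟨e2.1.trans h'.1, e2.2.trans h'.2⟩
    · simp [e1, e2]
  rw [hA', Finset.sum_insert (fun h' => h1 (Finset.mem_of_mem_erase h')),
    ← Finset.add_sum_erase _ _ h0]
  abel

theorem left_wt (A : BinMat n) :
    (binMatBicrystal n).left.wt A = ∑ p ∈ A.supp, glInfty.eps p.2 := by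
  rw [supp, Finset.sum_sigma]
  rfl

theorem right_wt (A : BinMat n) :
    (binMatBicrystal n).right.wt A = ∑ p ∈ A.supp, (glFin n).eps p.1 := by
  rw [supp, Finset.sum_sigma]
  rfl

theorem left_f_iff_matF {A A' : BinMat n} {k : ℤ} :
    (binMatBicrystal n).left.f k A = some A' ↔ matF k (k + 1) A.1 = some A'.1 :=
  pmap_eq_some_iff_of_leftInverse (β := BinMat n) (p := fun B => matF k (k + 1) A.1 = some B)
    (f := fun B h => ⟨B, rowFinite_of_matF A.2 h⟩) (g := Subtype.val) (hx := fun _ h => h)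
    (fun _ _ => rfl) Subtype.val_injective

theorem left_e_iff_matE {A A' : BinMat n} {k : ℤ} :
    (binMatBicrystal n).left.e k A = some A' ↔ matE k (k + 1) A.1 = some A'.1 :=
  pmap_eq_some_iff_of_leftInverse (β := BinMat n) (p := fun B => matE k (k + 1) A.1 = some B)
    (f := fun B h => ⟨B, rowFinite_of_matE A.2 h⟩) (g := Subtype.val) (hx := fun _ h => h)
    (fun _ _ => rfl) Subtype.val_injective

theorem right_f_iff_matF {A A' : BinMat n} {l : (glFin n).Idx} :
    (binMatBicrystal n).right.f l A = some A' ↔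
      matF ((glFin n).fst l) ((glFin n).snd l) (rho A.1) = some (rho A'.1) :=
  pmap_eq_some_iff_of_leftInverse
    (p := fun B => matF ((glFin n).fst l) ((glFin n).snd l) (rho A.1) = some B)
    (f := fun B h => ⟨rho.symm B, rowFinite_of_rho_matF A.2 h⟩)
    (g := fun A : BinMat n => rho A.1) (hx := fun _ h => h)
    (fun _ _ => Equiv.apply_symm_apply _ _) (rho.injective.comp Subtype.val_injective)

theorem right_e_iff_matE {A A' : BinMat n} {l : (glFin n).Idx} :
    (binMatBicrystal n).right.e l A = some A' ↔
      matE ((glFin n).fst l) ((glFin n).snd l) (rho A.1) = some (rho A'.1) :=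
  pmap_eq_some_iff_of_leftInverse
    (p := fun B => matE ((glFin n).fst l) ((glFin n).snd l) (rho A.1) = some B)
    (f := fun B h => ⟨rho.symm B, rowFinite_of_rho_matE A.2 h⟩)
    (g := fun A : BinMat n => rho A.1) (hx := fun _ h => h)
    (fun _ _ => Equiv.apply_symm_apply _ _) (rho.injective.comp Subtype.val_injective)

theorem isMove_rho_iff {A A' : Matrix (Fin n) ℤ Bool} {m : ℤ} {l l' : Fin n} :
    IsMove (rho A) (rho A') m l m l' ↔ IsMove A A' l (-m) l' (-m) := by
  constructor
  · rintro ⟨h1, h2, h3⟩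
    refine ⟨h1, h2, fun i j => ?_⟩
    have := h3 (-j) i
    simp only [rho_apply, neg_neg] at this
    rw [this]
    simp only [neg_eq_iff_eq_neg, and_comm]
  · rintro ⟨h1, h2, h3⟩
    refine ⟨h1, h2, fun j i => ?_⟩
    have := h3 i (-j)
    simp only [rho_apply]
    rw [this]
    simp only [neg_inj, and_comm]

theorem left_f_iff {A A' : BinMat n} {k : ℤ} : (binMatBicrystal n).left.f k A = some A' ↔
    ∃ s, GoodPlus (rowSign k (k + 1) A.1) s ∧ IsMove A.1 A'.1 s k s (k + 1) := by
  rw [left_f_iff_matF, matF_eq_some_iff]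

theorem right_f_iff {A A' : BinMat n} {l : (glFin n).Idx} :
    (binMatBicrystal n).right.f l A = some A' ↔
      ∃ m, GoodPlus (rowSign ((glFin n).fst l) ((glFin n).snd l) (rho A.1)) m ∧
        IsMove A.1 A'.1 ((glFin n).fst l) (-m) ((glFin n).snd l) (-m) := by
  simp only [right_f_iff_matF, matF_eq_some_iff, isMove_rho_iff]

theorem left_f_iff_e {A A' : BinMat n} {k : ℤ} : (binMatBicrystal n).left.f k A = some A' ↔
    (binMatBicrystal n).left.e k A' = some A := by
  rw [left_f_iff_matF, left_e_iff_matE, matF_eq_some_iff_matE (by simp)]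

theorem right_f_iff_e {A A' : BinMat n} {l : (glFin n).Idx} :
    (binMatBicrystal n).right.f l A = some A' ↔ (binMatBicrystal n).right.e l A' = some A := by
  rw [right_f_iff_matF, right_e_iff_matE, matF_eq_some_iff_matE ((glFin_isStandard n).covBy l).ne]

/-- The columns with an entry `1` in one of the rows `l`, `l'`, numbered as the rows of `rho A`. -/
noncomputable def colSupp (A : BinMat n) (l l' : Fin n) : Finset ℤ :=
  ((A.2 l).toFinset ∪ (A.2 l').toFinset).image Neg.neg

theorem mem_colSupp_of_rowSign {A : BinMat n} {l l' : Fin n} {m : ℤ}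
    (h : rowSign l l' (rho A.1) m ≠ 0) : m ∈ A.colSupp l l' := by
  rw [colSupp, Finset.mem_image]
  refine ⟨-m, ?_, neg_neg m⟩
  rw [Finset.mem_union, Set.Finite.mem_toFinset, Set.Finite.mem_toFinset]
  by_contra h'
  rw [not_or] at h'
  refine h ?_
  have h1 : rho A.1 m l = false := by simpa [rho_apply] using h'.1
  have h2 : rho A.1 m l' = false := by simpa [rho_apply] using h'.2
  unfold rowSign
  rw [h1, h2]

theorem finite_rowSign_rho (A : BinMat n) (l l' : Fin n) :
    {m | rowSign l l' (rho A.1) m ≠ 0}.Finite :=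
  (A.colSupp l l').finite_toSet.subset fun _ => mem_colSupp_of_rowSign

theorem left_isCrystal (n : ℕ) : (binMatBicrystal n).left.IsCrystal := by
  refine CrystalData.isCrystal_of_int glInfty_isStandard
    (fun k A => matε (glInfty.fst k) (glInfty.snd k) A.1)
    (fun k A => matφ (glInfty.fst k) (glInfty.snd k) A.1) (fun _ _ => rfl) (fun _ _ => rfl)
    (fun k A => ?_) (fun k A A' h => ?_) (fun k A A' h => ?_) (fun k A A' => left_f_iff_e)
  · rw [matφ_sub_matε (S := Finset.univ) (fun _ _ => Finset.mem_univ _)]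
    show _ = glInfty.coroot k (∑ i : Fin n, ∑ j ∈ (A.2 i).toFinset, glInfty.eps j)
    rw [map_sum]
    refine Finset.sum_congr rfl fun i _ => ?_
    rw [map_sum, coe_rowSign]
    simp only [glInfty_isStandard.coroot_eps, Finset.sum_sub_distrib, Finset.sum_ite_eq',
      Set.Finite.mem_toFinset, Set.mem_ofPred_eq]
  · exact matφ_of_matF (glInfty_isStandard.covBy k).ne (Set.toFinite _) (left_f_iff_matF.mp h)
  · obtain ⟨s, -, h⟩ := left_f_iff.mp h
    rw [left_wt, left_wt, sum_supp_of_isMove h fun _ j => glInfty.eps j, sub_add]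
    rfl

theorem right_isCrystal (n : ℕ) : (binMatBicrystal n).right.IsCrystal := by
  refine CrystalData.isCrystal_of_int (glFin_isStandard n)
    (fun k A => matε ((glFin n).fst k) ((glFin n).snd k) (rho A.1))
    (fun k A => matφ ((glFin n).fst k) ((glFin n).snd k) (rho A.1)) (fun _ _ => rfl)
    (fun _ _ => rfl) (fun k A => ?_) (fun k A A' h => ?_) (fun k A A' h => ?_)
    (fun k A A' => right_f_iff_e)
  · rw [matφ_sub_matε (S := A.colSupp ((glFin n).fst k) ((glFin n).snd k))
      fun m hm => mem_colSupp_of_rowSign hm]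
    show _ = (glFin n).coroot k (∑ i : Fin n, ∑ _j ∈ (A.2 i).toFinset, (glFin n).eps i)
    have hcount : ∀ i, (A.2 i).toFinset ⊆ (A.2 ((glFin n).fst k)).toFinset ∪
          (A.2 ((glFin n).snd k)).toFinset →
        ∑ m ∈ A.colSupp ((glFin n).fst k) ((glFin n).snd k),
          (if rho A.1 m i = true then (1 : ℤ) else 0) = ∑ _j ∈ (A.2 i).toFinset, 1 := by
      intro i hi
      rw [colSupp, Finset.sum_image fun _ _ _ _ h => neg_injective h, ← Finset.sum_filter]
      refine Finset.sum_congr ?_ fun _ _ => rfl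
      ext j
      rw [Finset.mem_filter]
      simp only [rho_apply, neg_neg]
      constructor
      · intro h
        simpa using h.2
      · intro h
        exact ⟨hi h, by simpa using h⟩
    simp only [coe_rowSign, Finset.sum_sub_distrib]
    rw [hcount _ Finset.subset_union_left, hcount _ Finset.subset_union_right]
    simp only [map_sum, (glFin_isStandard n).coroot_eps, Finset.sum_sub_distrib]
    congr 1
    · rw [Finset.sum_eq_single ((glFin n).fst k)]
      · simp
      · intro b _ hb
        simp [hb]
      · simp
    · rw [Finset.sum_eq_single ((glFin n).snd k)]
      · simp
      · intro b _ hb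
        simp [hb]
      · simp
  · exact matφ_of_matF ((glFin_isStandard n).covBy k).ne (A.finite_rowSign_rho _ _)
      (right_f_iff_matF.mp h)
  · obtain ⟨s, -, h⟩ := right_f_iff.mp h
    rw [right_wt, right_wt, sum_supp_of_isMove h fun i _ => (glFin n).eps i, sub_add]
    rfl

end BinMat

/-! ### The two structures commute -/

section BlockMoves

variable {ι : Type} [LinearOrder ι] [LocallyFiniteOrder ι] {σ σ' : ι → SignType} {l l' : ι}

/-- The surviving signs `+` of `σ` and `σ'` occupy the same places, up to a permutation of the two
places `l` and `l'`. -/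
def SameUpTo (σ σ' : ι → SignType) (l l' : ι) : Prop :=
  ∃ π : Equiv.Perm ι, (∀ u, u ≠ l → u ≠ l' → π u = u) ∧
    (∀ u, (u = l ∨ u = l') → (π u = l ∨ π u = l')) ∧
    ∀ u, SurvivingPlus σ' (π u) ↔ SurvivingPlus σ u

theorem SameUpTo.natCard_eq (h : SameUpTo σ σ' l l') :
    Nat.card {s // SurvivingPlus σ' s} = Nat.card {s // SurvivingPlus σ s} := by
  obtain ⟨π, -, -, h⟩ := h
  exact (Nat.card_congr (Equiv.subtypeEquiv π fun u => (h u).symm)).symm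

theorem SameUpTo.survivingPlus_iff (h : SameUpTo σ σ' l l') {u : ι} (h1 : u ≠ l) (h2 : u ≠ l') :
    SurvivingPlus σ' u ↔ SurvivingPlus σ u := by
  obtain ⟨π, h3, -, h4⟩ := h
  rw [← h4, h3 u h1 h2]

theorem SameUpTo.exists_iff (h : SameUpTo σ σ' l l') :
    (∃ u, (u = l ∨ u = l') ∧ SurvivingPlus σ' u) ↔
      ∃ u, (u = l ∨ u = l') ∧ SurvivingPlus σ u := by
  obtain ⟨π, h3, h4, h5⟩ := h
  constructor
  · rintro ⟨u, hu, hs⟩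
    refine ⟨π.symm u, ?_, ?_⟩
    · by_contra hcon
      rw [not_or] at hcon
      have := h3 _ hcon.1 hcon.2
      rw [Equiv.apply_symm_apply] at this
      rw [← this] at hcon
      exact not_or.mpr hcon hu
    · rw [← h5, Equiv.apply_symm_apply]
      exact hs
  · rintro ⟨u, hu, hs⟩
    exact ⟨π u, h4 u hu, (h5 u).mpr hs⟩

/-- Since the places `l` and `l'` are consecutive, the good signs `+` agree unless both of them are
at these places. -/
theorem SameUpTo.goodPlus (h : SameUpTo σ σ' l l') (hl : l ⋖ l') {s s' : ι} (hs : GoodPlus σ s)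
    (hs' : GoodPlus σ' s') :
    (s' = s ∧ s ≠ l ∧ s ≠ l') ∨ ((s = l ∨ s = l') ∧ (s' = l ∨ s' = l')) := by
  have hblock : ∀ a b c, a ≠ l → a ≠ l' → (b = l ∨ b = l') → (c = l ∨ c = l') → a ≤ b → a ≤ c := by
    intro a b c ha ha' hb hc hab
    have hal : a < l := by
      refine lt_of_not_ge fun hla => ?_
      have := hl.ge_of_gt (lt_of_le_of_ne hla ha.symm)
      rcases hb with rfl | rfl
      · exact ha (le_antisymm hab hla)
      · exact ha' (le_antisymm hab this)
    rcases hc with rfl | rfl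
    · exact hal.le
    · exact (hal.trans hl.lt).le
  by_cases h1 : s = l ∨ s = l'
  · right
    refine ⟨h1, ?_⟩
    by_contra h2
    rw [not_or] at h2
    obtain ⟨u, hu, hsu⟩ := h.exists_iff.mpr ⟨s, h1, hs.1⟩
    have e1 := hs.2 s' ((h.survivingPlus_iff h2.1 h2.2).mp hs'.1)
    have e2 := hblock s' u s h2.1 h2.2 hu h1 (hs'.2 u hsu)
    rw [le_antisymm e1 e2] at h1
    exact not_or.mpr h2 h1
  · left
    rw [not_or] at h1
    refine ⟨le_antisymm (hs'.2 s ((h.survivingPlus_iff h1.1 h1.2).mpr hs.1)) ?_, h1⟩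
    by_cases h2 : s' = l ∨ s' = l'
    · obtain ⟨u, hu, hsu⟩ := h.exists_iff.mp ⟨s', h2, hs'.1⟩
      exact hblock s u s' h1.1 h1.2 hu h2 (hs.2 u hsu)
    · rw [not_or] at h2
      exact hs.2 s' ((h.survivingPlus_iff h2.1 h2.2).mp hs'.1)

theorem GoodPlus.ne_one_of_covBy (h : GoodPlus σ l') (hl : l ⋖ l') : σ l ≠ 1 := by
  intro h1
  have := h.sum_Ico_nonpos l hl.lt
  rw [sum_Ico_eq_add_sum_Ioo _ hl.lt, Finset.eq_empty_of_forall_notMem (s := Finset.Ioo l l')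
    fun u hu => hl.2 (Finset.mem_Ioo.mp hu).1 (Finset.mem_Ioo.mp hu).2, h1,
    Finset.sum_empty] at this
  exact absurd this (by decide)

theorem SurvivingPlus.ne_neg_one_of_covBy (h : SurvivingPlus σ l) (hl : l ⋖ l') : σ l' ≠ -1 := by
  intro h1
  have := h.2 l' hl.lt
  rw [sum_Ioc_of_covBy _ hl, h1] at this
  exact absurd this (by decide)

end BlockMoves

namespace BinMat

variable {n : ℕ} {A A' : BinMat n} {k : ℤ}

/-- The operator `F̃_l` changes the signs for `ẽ_k, f̃_k` only in the rows `l` and `l'`, and only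
if it acts in the column `k` or `k + 1`. In the first case the column `k + 1`, to the left of the
good `+` in the order of `rho`, does not have the sign `+`, and in the second case the column `k`
does not have the sign `-`. This excludes the blocks in which the new pair of signs would reduce
differently. -/
theorem sameUpTo_of_right_f {l l' : Fin n} (hl : l ⋖ l') {m : ℤ}
    (hm : GoodPlus (rowSign l l' (rho A.1)) m) (h : IsMove A.1 A'.1 l (-m) l' (-m)) :
    SameUpTo (rowSign k (k + 1) A.1) (rowSign k (k + 1) A'.1) l l' := by
  have hne := hl.ne
  have h1 := h.source
  have h2 := h.target
  have hcov : -(k + 1) ⋖ -k := by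
    rw [neg_add, ← sub_eq_add_neg]
    exact Order.sub_one_covBy (-k)
  refine exists_perm_survivingPlus hl (fun u hu hu' => ?_) ?_ ?_
  · unfold rowSign
    simp [h.apply, hu, hu']
  · simp only [coe_rowSign, h.apply]
    by_cases e1 : k = -m
    · subst e1
      simp [hne, hne.symm, h1, h2]
      ring
    · by_cases e2 : k + 1 = -m
      · rw [← e2] at h1 h2
        simp [← e2, hne, hne.symm, h1, h2]
        ring
      · simp [e1, e2]
  · simp only [coe_rowSign, h.apply]
    by_cases e1 : k = -m
    · obtain rfl : m = -k := by omega
      have h3 := hm.ne_one_of_covBy hcov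
      rw [Ne, rowSign_eq_one_iff, rho_apply, rho_apply, neg_neg] at h3
      rw [neg_neg] at h1 h2
      revert h3
      simp only [neg_neg, hne, hne.symm, h1, h2]
      cases A.1 l (k + 1) <;> cases A.1 l' (k + 1) <;> simp
    · by_cases e2 : k + 1 = -m
      · obtain rfl : m = -(k + 1) := by omega
        have h3 := hm.1.ne_neg_one_of_covBy hcov
        rw [Ne, rowSign_eq_neg_one_iff, rho_apply, rho_apply, neg_neg] at h3
        rw [neg_neg] at h1 h2
        revert h3
        simp only [neg_neg, hne, hne.symm, h1, h2]
        cases A.1 l k <;> cases A.1 l' k <;> simp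
      · simp [e1, e2]

/-- The counterpart of `sameUpTo_of_right_f` for the action of `f̃_k` on the signs of the columns.
-/
theorem sameUpTo_of_left_f {l l' : Fin n} (hl : l ⋖ l') {s : Fin n}
    (hs : GoodPlus (rowSign k (k + 1) A.1) s) (h : IsMove A.1 A'.1 s k s (k + 1)) :
    SameUpTo (rowSign l l' (rho A.1)) (rowSign l l' (rho A'.1)) (-(k + 1)) (-k) := by
  have hne := hl.ne
  have h1 := h.source
  have h2 := h.target
  have hcov : -(k + 1) ⋖ -k := by
    rw [neg_add, ← sub_eq_add_neg]
    exact Order.sub_one_covBy (-k)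
  refine exists_perm_survivingPlus hcov (fun u hu hu' => ?_) ?_ ?_
  · unfold rowSign
    have e1 : ¬ -u = k := by omega
    have e2 : ¬ -u = k + 1 := by omega
    simp [rho_apply, h.apply, e1, e2]
  · simp only [coe_rowSign, rho_apply, neg_neg, h.apply]
    by_cases e1 : l = s
    · subst e1
      simp [hne.symm, h1, h2]
      ring
    · by_cases e2 : l' = s
      · subst e2
        simp [hne, h1, h2]
        ring
      · simp [e1, e2]
  · simp only [coe_rowSign, rho_apply, neg_neg, h.apply]
    by_cases e1 : l = s
    · subst e1
      have h3 := hs.1.ne_neg_one_of_covBy hl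
      rw [Ne, rowSign_eq_neg_one_iff] at h3
      revert h3
      simp only [hne.symm, h1, h2]
      cases A.1 l' k <;> cases A.1 l' (k + 1) <;> simp
    · by_cases e2 : l' = s
      · subst e2
        have h3 := hs.ne_one_of_covBy hl
        rw [Ne, rowSign_eq_one_iff] at h3
        revert h3
        simp only [hne, h1, h2]
        cases A.1 l k <;> cases A.1 l (k + 1) <;> simp
      · simp [e1, e2]

/-- A horizontal and a vertical move in a `2 × 2` block lead to the same matrix in both orders. The
last hypothesis holds if the row `s` has a surviving sign `+`: then the next row has no sign `-`. -/
theorem eq_of_isMove_block {A A₁ A₂ A₃ A₄ : Matrix (Fin n) ℤ Bool} {l l' s s' : Fin n} {k t t' : ℤ}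
    (hl : l ≠ l') (h1 : IsMove A A₁ s k s (k + 1)) (h2 : IsMove A A₂ l t l' t)
    (h3 : IsMove A₂ A₃ s' k s' (k + 1)) (h4 : IsMove A₁ A₄ l t' l' t')
    (hs : s = l ∨ s = l') (hs' : s' = l ∨ s' = l') (ht : t = k + 1 ∨ t = k)
    (ht' : t' = k + 1 ∨ t' = k) (hr : s = l → ¬(A l' k = false ∧ A l' (k + 1) = true)) :
    A₃ = A₄ := by
  have hk : k ≠ k + 1 := by omega
  have e1 := h1.source
  have e2 := h1.target
  have e3 := h2.source
  have e4 := h2.target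
  have e5 := h3.source
  have e6 := h3.target
  have e7 := h4.source
  have e8 := h4.target
  ext i j
  rw [h3.apply, h4.apply, h1.apply, h2.apply]
  rw [h2.apply] at e5 e6
  rw [h1.apply] at e7 e8
  rcases hs with rfl | rfl <;> rcases hs' with rfl | rfl <;> rcases ht with rfl | rfl <;>
    rcases ht' with rfl | rfl <;> simp_all <;> grind

/-- The operators `f̃_k` and `F̃_l` commute where all four compositions are defined. -/
theorem square {l : (glFin n).Idx} {A A₁ A₂ A₃ A₄ : BinMat n}
    (h1 : (binMatBicrystal n).left.f k A = some A₁)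
    (h2 : (binMatBicrystal n).right.f l A = some A₂)
    (h3 : (binMatBicrystal n).left.f k A₂ = some A₃)
    (h4 : (binMatBicrystal n).right.f l A₁ = some A₄) : A₃ = A₄ := by
  obtain ⟨s, hs, h1⟩ := left_f_iff.mp h1
  obtain ⟨m, hm, h2⟩ := right_f_iff.mp h2
  obtain ⟨s', hs', h3⟩ := left_f_iff.mp h3
  obtain ⟨m', hm', h4⟩ := right_f_iff.mp h4
  have hl := (glFin_isStandard n).covBy l
  generalize (glFin n).fst l = a, (glFin n).snd l = a' at *
  have hcov : -(k + 1) ⋖ -k := by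
    rw [neg_add, ← sub_eq_add_neg]
    exact Order.sub_one_covBy (-k)
  -- if the moves take place in disjoint sets of positions, they can be interchanged
  have hdisj : s' = s → m' = m → ((s ≠ a ∧ s ≠ a') ∨ (m ≠ -(k + 1) ∧ m ≠ -k)) → A₃ = A₄ := by
    rintro rfl rfl hd
    refine Subtype.ext ?_
    ext i j
    rw [h3.apply, h4.apply, h1.apply, h2.apply]
    have : k ≠ k + 1 := by omega
    have := hl.ne
    rcases hd with ⟨d1, d2⟩ | ⟨d1, d2⟩
    · grind
    · have : k ≠ -m' := by omega
      have : k + 1 ≠ -m' := by omega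
      grind
  rcases (sameUpTo_of_right_f (k := k) hl hm h2).goodPlus hl hs hs' with ⟨e1, e2⟩ | ⟨e1, e2⟩ <;>
    rcases (sameUpTo_of_left_f hl hs h1).goodPlus hcov hm hm' with ⟨d1, d2⟩ | ⟨d1, d2⟩
  · exact hdisj e1 d1 (Or.inl e2)
  · refine hdisj e1 (hm'.unique ?_) (Or.inl e2)
    convert! hm using 1
    funext u
    unfold rowSign
    simp [rho_apply, h1.apply, e2.1.symm, e2.2.symm]
  · refine hdisj (hs'.unique ?_) d1 (Or.inr d2)
    convert! hs using 1
    funext u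
    unfold rowSign
    have : k ≠ -m := by omega
    have : k + 1 ≠ -m := by omega
    simp [h2.apply, *]
  · refine Subtype.ext (eq_of_isMove_block hl.ne h1 h2 h3 h4 e1 e2 (by omega) (by omega) ?_)
    rintro rfl
    rw [← rowSign_eq_neg_one_iff]
    exact hs.1.ne_neg_one_of_covBy hl

end BinMat

section Commutation

variable {B : Type} {e f e' f' : B → Option B}

/-- Two partial bijections `f`, `f'` with inverses `e`, `e'` commute, together with their inverses,
if each of them respects the domains of the other one and of its inverse, and if `f` and `f'`
commute wherever all four compositions are defined. -/
structure CommutingData (e f e' f' : B → Option B) : Prop where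
  inv : ∀ {b c}, f b = some c ↔ e c = some b
  inv' : ∀ {b c}, f' b = some c ↔ e' c = some b
  f_dom : ∀ {b c}, f' b = some c → ((f b).isSome ↔ (f c).isSome)
  e_dom : ∀ {b c}, f' b = some c → ((e b).isSome ↔ (e c).isSome)
  f_dom' : ∀ {b c}, f b = some c → ((f' b).isSome ↔ (f' c).isSome)
  e_dom' : ∀ {b c}, f b = some c → ((e' b).isSome ↔ (e' c).isSome)
  square : ∀ {b b₁ b₂ b₃ b₄}, f b = some b₁ → f' b = some b₂ → f b₂ = some b₃ → f' b₁ = some b₄ →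
    b₃ = b₄

namespace CommutingData

theorem symm (h : CommutingData e f e' f') : CommutingData e' f' e f :=
  ⟨h.inv', h.inv, h.f_dom', h.e_dom', h.f_dom, h.e_dom,
    fun h1 h2 h3 h4 => (h.square h2 h1 h4 h3).symm⟩

theorem f_comp (h : CommutingData e f e' f') {b x c : B} (h1 : f' b = some x) (h2 : f x = some c) :
    ∃ y, f b = some y ∧ f' y = some c := by
  obtain ⟨y, hy⟩ := Option.isSome_iff_exists.mp
    ((h.f_dom h1).mpr (Option.isSome_iff_exists.mpr ⟨_, h2⟩))
  obtain ⟨d, hd⟩ := Option.isSome_iff_exists.mp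
    ((h.f_dom' hy).mp (Option.isSome_iff_exists.mpr ⟨_, h1⟩))
  exact ⟨y, hy, by rw [hd, h.square hy h1 h2 hd]⟩

theorem e_comp (h : CommutingData e f e' f') {b x c : B} (h1 : f' b = some x) (h2 : e x = some c) :
    ∃ y, e b = some y ∧ f' y = some c := by
  obtain ⟨y, hy⟩ := Option.isSome_iff_exists.mp
    ((h.e_dom h1).mpr (Option.isSome_iff_exists.mpr ⟨_, h2⟩))
  obtain ⟨d, hd⟩ := Option.isSome_iff_exists.mp
    ((h.f_dom' (h.inv.mpr hy)).mpr (Option.isSome_iff_exists.mpr ⟨_, h1⟩))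
  obtain ⟨z, hz, hz'⟩ := h.symm.f_comp (h.inv.mpr hy) h1
  rw [hd, Option.some_inj] at hz
  subst hz
  have := h.inv.mp hz'
  rw [h2, Option.some_inj] at this
  exact ⟨y, hy, by rw [hd, this]⟩

theorem e_comp_f (h : CommutingData e f e' f') {b x c : B} (h1 : e b = some x)
    (h2 : f' x = some c) : ∃ y, f' b = some y ∧ e y = some c := by
  obtain ⟨y, hy, hy'⟩ := h.symm.f_comp (h.inv.mpr h1) (b := x) (x := b) (c := (f' b).getD b) (by
    obtain ⟨d, hd⟩ := Option.isSome_iff_exists.mp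
      ((h.f_dom' (h.inv.mpr h1)).mp (Option.isSome_iff_exists.mpr ⟨_, h2⟩))
    rw [hd]
    rfl)
  rw [h2, Option.some_inj] at hy
  subst hy
  obtain ⟨d, hd⟩ := Option.isSome_iff_exists.mp
    ((h.f_dom' (h.inv.mpr h1)).mp (Option.isSome_iff_exists.mpr ⟨_, h2⟩))
  rw [hd] at hy'
  exact ⟨d, hd, h.inv.mp hy'⟩

theorem e_comp_e (h : CommutingData e f e' f') {b x c : B} (h1 : e' b = some x)
    (h2 : e x = some c) : ∃ y, e b = some y ∧ e' y = some c := by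
  obtain ⟨y, hy⟩ := Option.isSome_iff_exists.mp
    ((h.e_dom (h.inv'.mpr h1)).mp (Option.isSome_iff_exists.mpr ⟨_, h2⟩))
  obtain ⟨z, hz, hz'⟩ := h.e_comp (h.inv'.mpr h1) hy
  rw [h2, Option.some_inj] at hz
  subst hz
  exact ⟨y, hy, h.inv'.mp hz'⟩

theorem bind_eq_bind {p q : B → Option B}
    (h1 : ∀ {b x c}, q b = some x → p x = some c → ∃ y, p b = some y ∧ q y = some c)
    (h2 : ∀ {b x c}, p b = some x → q x = some c → ∃ y, q b = some y ∧ p y = some c) (b : B) :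
    (q b).bind p = (p b).bind q := by
  ext c
  simp only [Option.bind_eq_some_iff]
  constructor
  · rintro ⟨x, hx, hc⟩
    exact h1 hx hc
  · rintro ⟨x, hx, hc⟩
    exact h2 hx hc

end CommutingData

end Commutation

namespace BinMat

variable {n : ℕ} {A A' : BinMat n} {k : ℤ} {l : (glFin n).Idx}

theorem left_wt_of_right_f (h : (binMatBicrystal n).right.f l A = some A') :
    (binMatBicrystal n).left.wt A' = (binMatBicrystal n).left.wt A := by
  obtain ⟨m, -, h⟩ := right_f_iff.mp h
  rw [left_wt, left_wt, sum_supp_of_isMove h fun _ j => glInfty.eps j, sub_add_cancel]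

theorem right_wt_of_left_f (h : (binMatBicrystal n).left.f k A = some A') :
    (binMatBicrystal n).right.wt A' = (binMatBicrystal n).right.wt A := by
  obtain ⟨s, -, h⟩ := left_f_iff.mp h
  rw [right_wt, right_wt, sum_supp_of_isMove h fun i _ => (glFin n).eps i, sub_add_cancel]

theorem left_φ_eq (A : BinMat n) (k : ℤ) :
    matφ k (k + 1) A.1 = glInfty.coroot k ((binMatBicrystal n).left.wt A) + matε k (k + 1) A.1 := by
  have : ((matφ k (k + 1) A.1 : ℤ) : WithBot ℤ) =
      (glInfty.coroot k ((binMatBicrystal n).left.wt A) : ℤ) + (matε k (k + 1) A.1 : ℤ) :=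
    (left_isCrystal n).φ_eq k A
  exact_mod_cast this

theorem right_φ_eq (A : BinMat n) (l : (glFin n).Idx) :
    matφ ((glFin n).fst l) ((glFin n).snd l) (rho A.1) =
      (glFin n).coroot l ((binMatBicrystal n).right.wt A) +
        matε ((glFin n).fst l) ((glFin n).snd l) (rho A.1) := by
  have : ((matφ ((glFin n).fst l) ((glFin n).snd l) (rho A.1) : ℤ) : WithBot ℤ) =
      ((glFin n).coroot l ((binMatBicrystal n).right.wt A) : ℤ) +
        (matε ((glFin n).fst l) ((glFin n).snd l) (rho A.1) : ℤ) :=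
    (right_isCrystal n).φ_eq l A
  exact_mod_cast this

theorem left_φ_of_right_f (h : (binMatBicrystal n).right.f l A = some A') (k : ℤ) :
    matφ k (k + 1) A'.1 = matφ k (k + 1) A.1 := by
  obtain ⟨m, hm, h⟩ := right_f_iff.mp h
  exact congrArg Nat.cast (sameUpTo_of_right_f ((glFin_isStandard n).covBy l) hm h).natCard_eq

theorem right_φ_of_left_f (h : (binMatBicrystal n).left.f k A = some A') (l : (glFin n).Idx) :
    matφ ((glFin n).fst l) ((glFin n).snd l) (rho A'.1) =
      matφ ((glFin n).fst l) ((glFin n).snd l) (rho A.1) := by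
  obtain ⟨s, hs, h⟩ := left_f_iff.mp h
  exact congrArg Nat.cast (sameUpTo_of_left_f ((glFin_isStandard n).covBy l) hs h).natCard_eq

theorem left_ε_of_right_f (h : (binMatBicrystal n).right.f l A = some A') (k : ℤ) :
    matε k (k + 1) A'.1 = matε k (k + 1) A.1 := by
  have h1 := left_φ_eq A k
  have h2 := left_φ_eq A' k
  rw [left_φ_of_right_f h, left_wt_of_right_f h] at h2
  omega

theorem right_ε_of_left_f (h : (binMatBicrystal n).left.f k A = some A') (l : (glFin n).Idx) :
    matε ((glFin n).fst l) ((glFin n).snd l) (rho A'.1) =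
      matε ((glFin n).fst l) ((glFin n).snd l) (rho A.1) := by
  have h1 := right_φ_eq A l
  have h2 := right_φ_eq A' l
  rw [right_φ_of_left_f h, right_wt_of_left_f h] at h2
  omega

theorem left_f_isSome (A : BinMat n) (k : ℤ) :
    ((binMatBicrystal n).left.f k A).isSome ↔ matφ k (k + 1) A.1 ≠ 0 := by
  rw [Ne, matφ_eq_zero_iff (Set.toFinite _)]
  rw [Option.isSome_iff_exists, ← Ne, Option.ne_none_iff_exists']
  exact ⟨fun ⟨A', h⟩ => ⟨A'.1, left_f_iff_matF.mp h⟩,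
    fun ⟨B, h⟩ => ⟨⟨B, rowFinite_of_matF A.2 h⟩, left_f_iff_matF.mpr h⟩⟩

theorem left_e_isSome (A : BinMat n) (k : ℤ) :
    ((binMatBicrystal n).left.e k A).isSome ↔ matε k (k + 1) A.1 ≠ 0 := by
  rw [Ne, matε_eq_zero_iff (Set.toFinite _)]
  rw [Option.isSome_iff_exists, ← Ne, Option.ne_none_iff_exists']
  exact ⟨fun ⟨A', h⟩ => ⟨A'.1, left_e_iff_matE.mp h⟩,
    fun ⟨B, h⟩ => ⟨⟨B, rowFinite_of_matE A.2 h⟩, left_e_iff_matE.mpr h⟩⟩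

theorem right_f_isSome (A : BinMat n) (l : (glFin n).Idx) :
    ((binMatBicrystal n).right.f l A).isSome ↔
      matφ ((glFin n).fst l) ((glFin n).snd l) (rho A.1) ≠ 0 := by
  rw [Ne, matφ_eq_zero_iff (A.finite_rowSign_rho _ _)]
  rw [Option.isSome_iff_exists, ← Ne, Option.ne_none_iff_exists']
  refine ⟨fun ⟨A', h⟩ => ⟨_, right_f_iff_matF.mp h⟩,
    fun ⟨B, h⟩ => ⟨⟨rho.symm B, rowFinite_of_rho_matF A.2 h⟩, right_f_iff_matF.mpr ?_⟩⟩
  rw [h, Equiv.apply_symm_apply]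

theorem right_e_isSome (A : BinMat n) (l : (glFin n).Idx) :
    ((binMatBicrystal n).right.e l A).isSome ↔
      matε ((glFin n).fst l) ((glFin n).snd l) (rho A.1) ≠ 0 := by
  rw [Ne, matε_eq_zero_iff (A.finite_rowSign_rho _ _)]
  rw [Option.isSome_iff_exists, ← Ne, Option.ne_none_iff_exists']
  refine ⟨fun ⟨A', h⟩ => ⟨_, right_e_iff_matE.mp h⟩,
    fun ⟨B, h⟩ => ⟨⟨rho.symm B, rowFinite_of_rho_matE A.2 h⟩, right_e_iff_matE.mpr ?_⟩⟩
  rw [h, Equiv.apply_symm_apply]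

theorem commutingData (n : ℕ) (k : ℤ) (l : (glFin n).Idx) :
    CommutingData ((binMatBicrystal n).left.e k) ((binMatBicrystal n).left.f k)
      ((binMatBicrystal n).right.e l) ((binMatBicrystal n).right.f l) where
  inv := left_f_iff_e
  inv' := right_f_iff_e
  f_dom h := by rw [left_f_isSome, left_f_isSome, left_φ_of_right_f h]
  e_dom h := by rw [left_e_isSome, left_e_isSome, left_ε_of_right_f h]
  f_dom' h := by rw [right_f_isSome, right_f_isSome, right_φ_of_left_f h]
  e_dom' h := by rw [right_e_isSome, right_e_isSome, right_ε_of_left_f h]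
  square := square

theorem isBicrystal (n : ℕ) : (binMatBicrystal n).IsBicrystal where
  left_isCrystal := left_isCrystal n
  right_isCrystal := right_isCrystal n
  e_E i j := CommutingData.bind_eq_bind (commutingData n i j).e_comp_e
    (commutingData n i j).symm.e_comp_e
  e_F i j := CommutingData.bind_eq_bind (commutingData n i j).e_comp (commutingData n i j).e_comp_f
  f_E i j := CommutingData.bind_eq_bind (commutingData n i j).symm.e_comp_f
    (commutingData n i j).symm.e_comp
  f_F i j := CommutingData.bind_eq_bind (commutingData n i j).f_comp
    (commutingData n i j).symm.f_comp

end BinMat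

/-! ### Normal forms for two commuting families of partial bijections -/

section Runs

variable {B α β : Type}

/-- The composition of a sequence of partial maps. -/
def run (op : α → B → Option B) : List α → B → Option B
  | [], b => some b
  | a :: u, b => (op a b).bind (run op u)

theorem run_append (op : α → B → Option B) (u v : List α) (b : B) :
    run op (u ++ v) b = (run op u b).bind (run op v) := by
  induction u generalizing b with
  | nil => rfl
  | cons a u ih =>
    rw [List.cons_append, run, run, Option.bind_assoc]
    congr 1
    funext c
    exact ih c

/-- `c` is reached from `b` by operators of the family `op`. -/
def Connected (op : α → B → Option B) (b c : B) : Prop := ∃ u, run op u b = some c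

theorem Connected.refl (op : α → B → Option B) (b : B) : Connected op b b := ⟨[], rfl⟩

theorem Connected.trans {op : α → B → Option B} {b c d : B} (h₁ : Connected op b c)
    (h₂ : Connected op c d) : Connected op b d := by
  obtain ⟨u, hu⟩ := h₁
  obtain ⟨v, hv⟩ := h₂
  exact ⟨u ++ v, by rw [run_append, hu]; exact hv⟩

theorem Connected.of_step {op : α → B → Option B} {a : α} {b c : B} (h : op a b = some c) :
    Connected op b c := ⟨[a], by rw [run, h]; rfl⟩

theorem Connected.induction {op : α → B → Option B} {P : B → Prop}
    (hP : ∀ a b c, op a b = some c → P b → P c) {b c : B} (h : Connected op b c) (hb : P b) :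
    P c := by
  obtain ⟨u, hu⟩ := h
  induction u generalizing b with
  | nil => exact Option.some_inj.mp hu ▸ hb
  | cons a u ih =>
    obtain ⟨d, hd, hu⟩ := Option.bind_eq_some_iff.mp hu
    exact ih (hP a b d hd hb) hu

theorem Connected.of_measure {op : α → B → Option B} (μ : B → ℕ) {I N : B → Prop}
    (h : ∀ b, I b → N b ∨ ∃ a c, op a b = some c ∧ I c ∧ μ c < μ b) (b : B) (hb : I b) :
    ∃ c, Connected op b c ∧ N c := by
  induction hm : μ b using Nat.strong_induction_on generalizing b with
  | _ m ih =>
    rcases h b hb with hN | ⟨a, c, hac, hc, hlt⟩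
    · exact ⟨b, Connected.refl op b, hN⟩
    · obtain ⟨d, hd, hN⟩ := ih (μ c) (hm ▸ hlt) c hc rfl
      exact ⟨d, (Connected.of_step hac).trans hd, hN⟩

/-- Two families `l` and `r` of partial bijections, closed under inverses, that commute with each
other, with sets `NL` and `NR` of normal forms such that each family can bring every element into
its normal form, and preserves the normal forms of the other family. Elements that are in normal
form for both families are rigid: two of them that are connected are equal. -/
structure NormalForms (l : α → B → Option B) (r : β → B → Option B) (NL NR : B → Prop) : Prop where
  comm : ∀ i j b, (r j b).bind (l i) = (l i b).bind (r j)
  inv_l : ∀ i, ∃ i', ∀ b c, l i b = some c → l i' c = some b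
  inv_r : ∀ i, ∃ i', ∀ b c, r i b = some c → r i' c = some b
  stable_l : ∀ i b c, l i b = some c → NR b → NR c
  stable_r : ∀ j b c, r j b = some c → NL b → NL c
  exists_l : ∀ b, ∃ c, Connected l b c ∧ NL c
  exists_r : ∀ b, ∃ c, Connected r b c ∧ NR c
  rigid_l : ∀ b c, Connected l b c → NL b → NR b → NL c → NR c → b = c
  rigid_r : ∀ b c, Connected r b c → NL b → NR b → NL c → NR c → b = c

theorem run_comm {l : α → B → Option B} {r : β → B → Option B}
    (h : ∀ i j b, (r j b).bind (l i) = (l i b).bind (r j)) (u : List α) (w : List β) (b : B) :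
    (run r w b).bind (run l u) = (run l u b).bind (run r w) := by
  have h1 : ∀ (w : List β) i b, (run r w b).bind (l i) = (l i b).bind (run r w) := by
    intro w i
    induction w with
    | nil =>
      intro b
      show l i b = (l i b).bind fun x => some x
      rw [Option.bind_fun_some]
    | cons j w ih =>
      intro b
      rw [run, Option.bind_assoc]
      simp only [ih]
      rw [← Option.bind_assoc, h, Option.bind_assoc]
      rfl
  induction u generalizing b with
  | nil =>
    show (run r w b).bind (fun x => some x) = run r w b
    rw [Option.bind_fun_some]
  | cons i u ih =>
    rw [run, Option.bind_assoc]
    simp only [← ih]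
    rw [← Option.bind_assoc, ← h1, Option.bind_assoc]
    rfl

theorem exists_run_inv {op : α → B → Option B}
    (h : ∀ i, ∃ i', ∀ b c, op i b = some c → op i' c = some b) (u : List α) :
    ∃ u', ∀ b c, run op u b = some c → run op u' c = some b := by
  induction u with
  | nil => exact ⟨[], fun b c hbc => by rw [Option.some_inj.mp hbc]; rfl⟩
  | cons a u ih =>
    obtain ⟨u', hu'⟩ := ih
    obtain ⟨a', ha'⟩ := h a
    refine ⟨u' ++ [a'], fun b c hbc => ?_⟩
    obtain ⟨d, hd, hdc⟩ := Option.bind_eq_some_iff.mp hbc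
    rw [run_append, hu' d c hdc]
    show (op a' d).bind _ = _
    rw [ha' b d hd]
    rfl

namespace NormalForms

variable {l : α → B → Option B} {r : β → B → Option B} {NL NR : B → Prop}

theorem symm (h : NormalForms l r NL NR) : NormalForms r l NR NL where
  comm i j b := (h.comm j i b).symm
  inv_l := h.inv_r
  inv_r := h.inv_l
  stable_l := h.stable_r
  stable_r := h.stable_l
  exists_l := h.exists_r
  exists_r := h.exists_l
  rigid_l b c h0 h1 h2 h3 h4 := h.rigid_r b c h0 h2 h1 h4 h3
  rigid_r b c h0 h1 h2 h3 h4 := h.rigid_l b c h0 h2 h1 h4 h3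

theorem conn_symm_r (h : NormalForms l r NL NR) {b c : B} (hbc : Connected r b c) :
    Connected r c b := by
  obtain ⟨u, hu⟩ := hbc
  obtain ⟨u', hu'⟩ := exists_run_inv h.inv_r u
  exact ⟨u', hu' b c hu⟩

/-- The same sequence of operators of one family can be applied to all elements that are connected
by the other family. -/
theorem transport (h : NormalForms l r NL NR) {u : List α} {b b' c : B}
    (hu : run l u b = some b') (hbc : Connected r b c) :
    ∃ c', run l u c = some c' ∧ Connected r b' c' := by
  obtain ⟨w, hw⟩ := h.conn_symm_r hbc
  have := run_comm h.comm u w c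
  rw [hw] at this
  obtain ⟨c', hc', hc''⟩ := Option.bind_eq_some_iff.mp (this.symm.trans hu)
  exact ⟨c', hc', h.conn_symm_r ⟨w, hc''⟩⟩

theorem transport_step (h : NormalForms l r NL NR) {a : α} {b b' c : B} (ha : l a b = some b')
    (hbc : Connected r b c) : ∃ c', l a c = some c' ∧ Connected r b' c' := by
  obtain ⟨c', hc', h'⟩ := h.transport (u := [a]) (b' := b') (by rw [run, ha]; rfl) hbc
  obtain ⟨d, hd, hd'⟩ := Option.bind_eq_some_iff.mp hc'
  exact ⟨c', hd.trans hd', h'⟩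

theorem run_injective (h : NormalForms l r NL NR) {u : List α} {b b' c : B}
    (hb : run l u b = some c) (hb' : run l u b' = some c) : b = b' := by
  obtain ⟨u', hu'⟩ := exists_run_inv h.inv_l u
  exact Option.some_inj.mp ((hu' b c hb).symm.trans (hu' b' c hb'))

theorem exists_common (h : NormalForms l r NL NR) {b c d : B} (h₁ : Connected l b c)
    (h₂ : Connected r b d) : ∃ x, Connected l d x ∧ Connected r c x := by
  obtain ⟨u, hu⟩ := h₁
  obtain ⟨x, hx, hx'⟩ := h.transport hu h₂
  exact ⟨x, ⟨u, hx⟩, hx'⟩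

/-- The normal form is unique: the other family brings both elements into elements that are normal
for both families, which are equal by rigidity. -/
theorem unique_r (h : NormalForms l r NL NR) {b c : B} (hbc : Connected r b c) (hb : NR b)
    (hc : NR c) : b = c := by
  obtain ⟨d, ⟨u, hu⟩, hd⟩ := h.exists_l b
  obtain ⟨d', hu', hdd'⟩ := h.transport hu hbc
  have hd' : NL d' := hdd'.induction h.stable_r hd
  have h1 : NR d := Connected.induction h.stable_l ⟨u, hu⟩ hb
  have h2 : NR d' := Connected.induction h.stable_l ⟨u, hu'⟩ hc
  obtain rfl := h.rigid_r d d' hdd' hd h1 hd' h2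
  exact h.run_injective hu hu'

/-- An element is determined by its two normal forms. -/
theorem eq_of_connected (h : NormalForms l r NL NR) {b b' P Q : B} (hQ : NL Q)
    (h1 : Connected r b P) (h2 : Connected r b' P) (h3 : Connected l b Q) (h4 : Connected l b' Q) :
    b = b' := by
  obtain ⟨u, hu⟩ := h3
  obtain ⟨Q', hu', hQQ'⟩ := h.transport hu (h1.trans (h.conn_symm_r h2))
  have hQ' : NL Q' := hQQ'.induction h.stable_r hQ
  have h5 := (h.symm.conn_symm_r h4).trans ⟨u, hu'⟩
  obtain rfl := h.symm.unique_r h5 hQ hQ'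
  exact h.run_injective hu hu'

end NormalForms

end Runs

/-! ### Sequences without surviving signs -/

section PartialSums

variable {ι : Type} [LinearOrder ι] [LocallyFiniteOrder ι]

theorem forall_not_survivingPlus_iff {σ : ι → SignType} {S : Finset ι}
    (hS : ∀ u, σ u ≠ 0 → u ∈ S) :
    (∀ s, ¬SurvivingPlus σ s) ↔ ∀ t, ∑ u ∈ S.filter (t ≤ ·), (σ u : ℤ) ≤ 0 := by
  constructor
  · intro h t
    have hL : (S.sort (· ≤ ·)).Pairwise (· < ·) := (Finset.sortedLT_sort _).pairwise
    have h1 := natCard_survivingPlus hL fun u hu => (Finset.mem_sort _).mpr (hS u hu)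
    have : IsEmpty {s // SurvivingPlus σ s} := isEmpty_subtype _ |>.mpr h
    rw [Nat.card_of_isEmpty] at h1
    -- the sorted list of places splits into those before `t` and the others
    have hsplit : ∀ L : List ι, L.Pairwise (· < ·) →
        L = L.filter (fun u => ¬ t ≤ u) ++ L.filter (fun u => t ≤ u) := by
      intro L
      induction L with
      | nil => intro _; rfl
      | cons a L ih =>
        intro hL
        rw [List.pairwise_cons] at hL
        by_cases ha : t ≤ a
        · have h1 : (a :: L).filter (fun u => ¬ t ≤ u) = [] := by
            rw [List.filter_eq_nil_iff]
            intro u hu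
            rcases List.mem_cons.mp hu with rfl | hu
            · simpa using ha
            · simpa using ha.trans (hL.1 u hu).le
          have h2 : (a :: L).filter (fun u => t ≤ u) = a :: L := by
            rw [List.filter_eq_self]
            intro u hu
            rcases List.mem_cons.mp hu with rfl | hu
            · simpa using ha
            · simpa using ha.trans (hL.1 u hu).le
          rw [h1, h2, List.nil_append]
        · rw [List.filter_cons_of_pos (by simpa using ha),
            List.filter_cons_of_neg (by simpa using ha),
            List.cons_append, ← ih hL.2]
    rw [hsplit _ hL, List.map_append, List.sum_append, listEps_append] at h1
    have h2 := listEps_nonneg (((S.sort (· ≤ ·)).filter (fun u => t ≤ u)).map fun u => (σ u : ℤ))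
    have h3 : ∑ u ∈ S.filter (t ≤ ·), (σ u : ℤ) =
        (((S.sort (· ≤ ·)).filter (fun u => t ≤ u)).map fun u => (σ u : ℤ)).sum := by
      rw [← List.sum_toFinset _ ((Finset.sort_nodup _ _).filter _), List.toFinset_filter,
        Finset.sort_toFinset]
      simp only [decide_eq_true_eq]
    rw [h3]
    omega
  · intro h s hs
    have hsS : s ∈ S := hS s (by rw [hs.1]; decide)
    have h1 := h s
    have hsum : ∀ t, (∀ u ∈ S, u ≤ t) → ∑ u ∈ S.filter (s ≤ ·), (σ u : ℤ) =
        ∑ u ∈ Finset.Icc s t, (σ u : ℤ) := by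
      intro t ht
      refine Finset.sum_subset (fun u hu => ?_) fun u hu hu' => ?_
      · rw [Finset.mem_filter] at hu
        exact Finset.mem_Icc.mpr ⟨hu.2, ht u hu.1⟩
      · by_contra h0
        refine hu' (Finset.mem_filter.mpr ⟨hS u fun h' => h0 ?_, (Finset.mem_Icc.mp hu).1⟩)
        rw [h']
        rfl
    have hmax := hsum (S.max' ⟨s, hsS⟩) fun u hu => S.le_max' u hu
    rw [hmax, ← Finset.Ioc_insert_left (S.le_max' s hsS), Finset.sum_insert (by simp), hs.1,
      SignType.coe_one] at h1
    rcases (S.le_max' s hsS).eq_or_lt with he | hlt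
    · rw [← he, Finset.Ioc_self, Finset.sum_empty] at h1
      omega
    · have := hs.2 _ hlt
      omega

theorem forall_not_survivingMinus_iff {σ : ι → SignType} {S : Finset ι}
    (hS : ∀ u, σ u ≠ 0 → u ∈ S) :
    (∀ s, ¬SurvivingMinus σ s) ↔ ∀ t, 0 ≤ ∑ u ∈ S.filter (· ≤ t), (σ u : ℤ) := by
  have h := forall_not_survivingPlus_iff (ι := ιᵒᵈ) (σ := fun u => -σ (OrderDual.ofDual u))
    (S := S.map OrderDual.toDual.toEmbedding) (fun u hu => by
      rw [Finset.mem_map_equiv]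
      refine hS _ fun h => hu ?_
      show -σ (OrderDual.ofDual u) = 0
      rw [show σ (OrderDual.ofDual u) = 0 from h]
      rfl)
  constructor
  · intro h' t
    have := h.mp (fun s hs => h' (OrderDual.ofDual s) ((survivingMinus_iff_dual σ _).mpr hs))
      (OrderDual.toDual t)
    rw [Finset.filter_map, Finset.sum_map] at this
    simp only [Function.comp_def, Equiv.coe_toEmbedding, OrderDual.ofDual_toDual, SignType.coe_neg,
      Finset.sum_neg_distrib, OrderDual.toDual_le_toDual, Left.neg_nonpos_iff] at this
    convert! this
  · intro h' s hs
    refine h.mpr (fun t => ?_) (OrderDual.toDual s) ((survivingMinus_iff_dual σ s).mp hs)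
    have := h' (OrderDual.ofDual t)
    rw [Finset.filter_map, Finset.sum_map]
    obtain ⟨t, rfl⟩ := OrderDual.toDual.surjective t
    simp only [Function.comp_def, Equiv.coe_toEmbedding, OrderDual.ofDual_toDual, SignType.coe_neg,
      Finset.sum_neg_distrib, OrderDual.toDual_le_toDual, Left.neg_nonpos_iff]
    convert! this

end PartialSums

/-! ### Normal forms of binary matrices -/

/-- Entry by entry, the increasing sequence of the elements of `c` is at least as long as that of
`c'`, and at most as large: `c` and `c'` can be consecutive columns, from left to right, of a
semistandard tableau. -/
def Dominates {κ : Type} [LinearOrder κ] (c c' : Finset κ) : Prop :=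
  ∀ t, (c'.filter (· ≤ t)).card ≤ (c.filter (· ≤ t)).card

/-- All operators `ẽ_i`, `f̃_i` of a crystal as one family. -/
def CrystalData.ops {κ B : Type} {D : GlDatum κ} (C : CrystalData D B) :
    D.Idx × Bool → B → Option B
  | (i, true) => C.e i
  | (i, false) => C.f i

theorem CrystalData.IsCrystal.ops_inv {κ B : Type} {D : GlDatum κ} {C : CrystalData D B}
    (h : C.IsCrystal) : ∀ a, ∃ a', ∀ b c, C.ops a b = some c → C.ops a' c = some b := by
  rintro ⟨i, _ | _⟩
  · exact ⟨(i, true), fun b c hbc => (h.f_iff_e i b c).mp hbc⟩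
  · exact ⟨(i, false), fun b c hbc => (h.f_iff_e i c b).mpr hbc⟩

theorem BicrystalData.IsBicrystal.ops_comm {κ₁ κ₂ B : Type} {D₁ : GlDatum κ₁} {D₂ : GlDatum κ₂}
    {C : BicrystalData D₁ D₂ B} (h : C.IsBicrystal) :
    ∀ i j b, (C.right.ops j b).bind (C.left.ops i) = (C.left.ops i b).bind (C.right.ops j) := by
  rintro ⟨i, _ | _⟩ ⟨j, _ | _⟩ b
  · exact h.f_F i j b
  · exact h.f_E i j b
  · exact h.e_F i j b
  · exact h.e_E i j b

/-- A property that passes along `f̃_i` in both directions passes along all operators. -/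
theorem CrystalData.IsCrystal.ops_induction {κ B : Type} {D : GlDatum κ} {C : CrystalData D B}
    (h : C.IsCrystal) {P : B → Prop} (hP : ∀ i b c, C.f i b = some c → (P b ↔ P c)) :
    ∀ a b c, C.ops a b = some c → P b → P c := by
  rintro ⟨i, _ | _⟩ b c hbc hb
  · exact (hP i b c hbc).mp hb
  · exact (hP i c b ((h.f_iff_e i c b).mpr hbc)).mpr hb

namespace BinMat

variable {n : ℕ}

/-- The set of columns with an entry `1` in row `i`. -/
noncomputable def row (A : BinMat n) (i : Fin n) : Finset ℤ := (A.2 i).toFinset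

/-- The set of rows with an entry `1` in column `j`. -/
def col (A : BinMat n) (j : ℤ) : Finset (Fin n) := Finset.univ.filter fun i => A.1 i j = true

theorem mem_row {A : BinMat n} {i : Fin n} {j : ℤ} : j ∈ A.row i ↔ A.1 i j = true := by
  simp [row]

theorem mem_col {A : BinMat n} {i : Fin n} {j : ℤ} : i ∈ A.col j ↔ A.1 i j = true := by
  simp [col]

theorem right_wt_apply (A : BinMat n) (i : Fin n) :
    (show Fin n → ℤ from (binMatBicrystal n).right.wt A) i = (A.row i).card := by
  show (∑ i : Fin n, ∑ _j ∈ (A.2 i).toFinset, (Pi.single i 1 : Fin n → ℤ)) i = _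
  rw [Finset.sum_apply, Finset.sum_eq_single i]
  · rw [Finset.sum_apply]
    simp [row]
  · intro b _ hb
    rw [Finset.sum_apply]
    simp [hb.symm]
  · simp

theorem left_wt_apply (A : BinMat n) (j : ℤ) :
    (show (ℤ →₀ ℤ) × ℤ from (binMatBicrystal n).left.wt A).1 j = (A.col j).card := by
  show (∑ i : Fin n, ∑ j ∈ (A.2 i).toFinset, ((Finsupp.single j 1, 0) : (ℤ →₀ ℤ) × ℤ)).1 j = _
  simp only [Prod.fst_sum, Finsupp.finsetSum_apply, Finsupp.single_apply, Finset.sum_ite_eq']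
  simp [col]

theorem card_row_of_left_f {A A' : BinMat n} {k : ℤ}
    (h : (binMatBicrystal n).left.f k A = some A') (i : Fin n) :
    (A'.row i).card = (A.row i).card := by
  have h1 := right_wt_apply A i
  have h2 := right_wt_apply A' i
  rw [right_wt_of_left_f h] at h2
  exact_mod_cast h2.symm.trans h1

theorem card_col_of_right_f {A A' : BinMat n} {l : (glFin n).Idx}
    (h : (binMatBicrystal n).right.f l A = some A') (j : ℤ) :
    (A'.col j).card = (A.col j).card := by
  have h1 := left_wt_apply A j
  have h2 := left_wt_apply A' j
  rw [left_wt_of_right_f h] at h2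
  exact_mod_cast h2.symm.trans h1

theorem right_f_eq_none_iff (A : BinMat n) (l : (glFin n).Idx) :
    (binMatBicrystal n).right.f l A = none ↔
      Dominates (A.row ((glFin n).snd l)) (A.row ((glFin n).fst l)) := by
  rw [← Option.not_isSome_iff_eq_none, right_f_isSome, not_not,
    matφ_eq_zero_iff (A.finite_rowSign_rho _ _), matF_eq_none_iff (A.finite_rowSign_rho _ _),
    forall_not_survivingPlus_iff (S := A.colSupp ((glFin n).fst l) ((glFin n).snd l))
      fun m hm => mem_colSupp_of_rowSign hm]
  generalize (glFin n).fst l = a, (glFin n).snd l = b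
  have hcount : ∀ i t, A.row i ⊆ A.row a ∪ A.row b →
      ∑ m ∈ (A.colSupp a b).filter (t ≤ ·), (if rho A.1 m i = true then (1 : ℤ) else 0) =
        ((A.row i).filter (· ≤ -t)).card := by
    intro i t hi
    rw [← Finset.sum_filter, Finset.filter_filter, Finset.sum_const, nsmul_one]
    refine congrArg _ (Finset.card_nbij' Neg.neg Neg.neg (fun m hm => ?_) (fun m hm => ?_) ?_ ?_)
    · rw [Finset.mem_coe] at hm ⊢
      rw [Finset.mem_filter, rho_apply] at hm
      rw [Finset.mem_filter]
      exact ⟨mem_row.mpr hm.2.2, by omega⟩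
    · rw [Finset.mem_coe] at hm ⊢
      rw [Finset.mem_filter] at hm
      rw [Finset.mem_filter, rho_apply, neg_neg]
      exact ⟨Finset.mem_image_of_mem _ (hi hm.1), by omega, mem_row.mp hm.1⟩
    · exact fun m _ => neg_neg m
    · exact fun m _ => neg_neg m
  simp only [coe_rowSign, Finset.sum_sub_distrib, hcount a _ Finset.subset_union_left,
    hcount b _ Finset.subset_union_right, sub_nonpos, Nat.cast_le]
  exact ⟨fun h t => by simpa using h (-t), fun h t => h (-t)⟩

theorem left_e_eq_none_iff (A : BinMat n) (k : ℤ) :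
    (binMatBicrystal n).left.e k A = none ↔ Dominates (A.col k) (A.col (k + 1)) := by
  rw [← Option.not_isSome_iff_eq_none, left_e_isSome, not_not,
    matε_eq_zero_iff (Set.toFinite _), matE_eq_none_iff (Set.toFinite _),
    forall_not_survivingMinus_iff (S := Finset.univ) fun m _ => Finset.mem_univ _]
  refine forall_congr' fun t => ?_
  have hcount : ∀ j, ∑ i ∈ Finset.univ.filter (· ≤ t), (if A.1 i j = true then (1 : ℤ) else 0) =
        ((A.col j).filter (· ≤ t)).card := by
    intro j
    rw [← Finset.sum_filter, Finset.filter_filter, Finset.sum_const, nsmul_one, col,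
      Finset.filter_filter]
    simp only [and_comm]
  simp only [coe_rowSign, Finset.sum_sub_distrib, hcount, sub_nonneg, Nat.cast_le]

/-- The normal form for the `𝔤𝔩_∞`-structure: the columns with a non-negative number form a
semistandard tableau, and the other ones are zero. -/
def LeftNormal (A : BinMat n) : Prop :=
  (∀ i j, j < 0 → A.1 i j = false) ∧ ∀ k, 0 ≤ k → Dominates (A.col k) (A.col (k + 1))

/-- The normal form for the `𝔤𝔩_n`-structure, annihilated by all `F̃_l`: the rows, from the last one
to the first one, are the columns of a semistandard tableau. -/
def RightNormal (A : BinMat n) : Prop :=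
  ∀ l : (glFin n).Idx, Dominates (A.row ((glFin n).snd l)) (A.row ((glFin n).fst l))

theorem leftNormal_of_right_f {l : (glFin n).Idx} {A A' : BinMat n}
    (h : (binMatBicrystal n).right.f l A = some A') : A.LeftNormal ↔ A'.LeftNormal := by
  refine and_congr ?_ (forall_congr' fun k => ?_)
  · obtain ⟨m, -, h⟩ := right_f_iff.mp h
    constructor
    · intro h0 i j hj
      have h1 : ¬ -m < 0 := fun h' => absurd ((h0 _ _ h').symm.trans h.source) (by decide)
      have h2 : ¬ j = -m := by omega
      simp [h.apply, h2, h0 i j hj]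
    · intro h0 i j hj
      have h1 : ¬ -m < 0 := fun h' => absurd ((h0 _ _ h').symm.trans h.symm.source) (by decide)
      have h2 : ¬ j = -m := by omega
      simp [h.symm.apply, h2, h0 i j hj]
  · rw [← left_e_eq_none_iff, ← left_e_eq_none_iff, ← Option.not_isSome_iff_eq_none,
      ← Option.not_isSome_iff_eq_none, (commutingData n k l).e_dom h]

theorem rightNormal_of_left_f {k : ℤ} {A A' : BinMat n}
    (h : (binMatBicrystal n).left.f k A = some A') : A.RightNormal ↔ A'.RightNormal := by
  refine forall_congr' fun l => ?_
  rw [← right_f_eq_none_iff, ← right_f_eq_none_iff, ← Option.not_isSome_iff_eq_none,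
    ← Option.not_isSome_iff_eq_none, (commutingData n k l).f_dom' h]

/-! Existence of the normal forms. -/

theorem exists_rightNormal (A : BinMat n) :
    ∃ A', Connected (binMatBicrystal n).right.ops A A' ∧ A'.RightNormal := by
  refine Connected.of_measure (fun A => ∑ p ∈ A.supp, (n - p.1.1)) (I := fun _ => True)
    (fun A _ => ?_) A trivial
  by_cases h : A.RightNormal
  · exact Or.inl h
  · right
    unfold RightNormal at h
    push Not at h
    obtain ⟨l, hl⟩ := h
    rw [← right_f_eq_none_iff, ← Ne, Option.ne_none_iff_exists'] at hl
    obtain ⟨A', h⟩ := hl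
    refine ⟨(l, false), A', h, trivial, ?_⟩
    obtain ⟨m, -, h⟩ := right_f_iff.mp h
    have := sum_supp_of_isMove h fun i _ => (((n - i.1 : ℕ)) : ℤ)
    have h1 : (((glFin n).snd l).1 : ℕ) = ((glFin n).fst l).1 + 1 := rfl
    have h2 := ((glFin n).snd l).2
    rw [← Nat.cast_sum, ← Nat.cast_sum] at this
    show ∑ p ∈ A'.supp, (n - p.1.1) < ∑ p ∈ A.supp, (n - p.1.1)
    omega

/-- Moving the entries far to the right empties the columns with a negative number, because a matrix
annihilated by the `f̃_k` with `k < N` has column sums that increase up to the column `N`. -/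
theorem exists_nonneg (A : BinMat n) :
    ∃ A', Connected (binMatBicrystal n).left.ops A A' ∧ ∀ i j, j < 0 → A'.1 i j = false := by
  refine Connected.of_measure (fun B => ∑ p ∈ B.supp, ((A.supp.card : ℤ) - p.2).toNat)
    (I := fun B => B.supp.card = A.supp.card) (fun B hB => ?_) A rfl
  by_cases h : ∃ k, k < (A.supp.card : ℤ) ∧ ∃ B', (binMatBicrystal n).left.f k B = some B'
  · right
    obtain ⟨k, hk, B', h⟩ := h
    obtain ⟨s, -, hm⟩ := left_f_iff.mp h
    refine ⟨(k, false), B', h, ?_, ?_⟩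
    · have := sum_supp_of_isMove hm fun _ _ => (1 : ℤ)
      simp only [Finset.sum_const, nsmul_one, sub_add_cancel, Nat.cast_inj] at this
      exact this.trans hB
    · have := sum_supp_of_isMove hm fun _ j => ((((A.supp.card : ℤ) - j).toNat : ℕ) : ℤ)
      rw [← Nat.cast_sum, ← Nat.cast_sum] at this
      omega
  · left
    push Not at h
    have hmono : ∀ k, k < (A.supp.card : ℤ) → (B.col k).card ≤ (B.col (k + 1)).card := by
      intro k hk
      have h1 : (binMatBicrystal n).left.f k B = none :=
        Option.eq_none_iff_forall_ne_some.mpr (h k hk)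
      rw [← Option.not_isSome_iff_eq_none, left_f_isSome, not_not] at h1
      have h2 := left_φ_eq B k
      have h3 : 0 ≤ matε k (k + 1) B.1 := Nat.cast_nonneg _
      have h4 : glInfty.coroot k ((binMatBicrystal n).left.wt B) =
          (B.col k).card - (B.col (k + 1)).card := by
        rw [← left_wt_apply, ← left_wt_apply]
        show _ + (if k = 0 then (show (ℤ →₀ ℤ) × ℤ from (binMatBicrystal n).left.wt B).2 else 0) = _
        have : (show (ℤ →₀ ℤ) × ℤ from (binMatBicrystal n).left.wt B).2 = 0 := by
          show (∑ i : Fin n, ∑ j ∈ (B.2 i).toFinset, ((Finsupp.single j 1, 0) : (ℤ →₀ ℤ) × ℤ)).2 = 0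
          simp only [Prod.snd_sum, Finset.sum_const_zero]
        rw [this, ite_self, add_zero]
      omega
    intro i j hj
    by_contra hij
    rw [Bool.not_eq_false] at hij
    have hpos : ∀ d : ℕ, j + d ≤ (A.supp.card : ℤ) → 0 < (B.col (j + d)).card := by
      intro d
      induction d with
      | zero =>
        intro _
        rw [Finset.card_pos]
        exact ⟨i, mem_col.mpr (by simpa using hij)⟩
      | succ d ih =>
        intro hd
        push_cast at hd ⊢
        have := ih (by omega)
        have := hmono (j + d) (by omega)
        rw [← add_assoc]
        omega
    have hsub : Finset.Icc (0 : ℤ) A.supp.card ⊆ B.supp.image fun p => p.2 := by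
      intro k hk
      rw [Finset.mem_Icc] at hk
      have := hpos (k - j).toNat (by omega)
      rw [Int.toNat_of_nonneg (by omega), add_sub_cancel, Finset.card_pos] at this
      obtain ⟨i', hi'⟩ := this
      exact Finset.mem_image.mpr ⟨⟨i', k⟩, mem_supp.mpr (mem_col.mp hi'), rfl⟩
    have := (Finset.card_le_card hsub).trans Finset.card_image_le
    rw [Int.card_Icc, hB] at this
    omega

theorem exists_leftNormal (A : BinMat n) :
    ∃ A', Connected (binMatBicrystal n).left.ops A A' ∧ A'.LeftNormal := by
  obtain ⟨B, hAB, hB⟩ := exists_nonneg A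
  have hstep : ∀ B : BinMat n, (∀ i j, j < 0 → B.1 i j = false) → B.LeftNormal ∨
      ∃ a C, (binMatBicrystal n).left.ops a B = some C ∧ (∀ i j, j < 0 → C.1 i j = false) ∧
        ∑ p ∈ C.supp, p.2.toNat < ∑ p ∈ B.supp, p.2.toNat := by
    intro B hB
    by_cases h : B.LeftNormal
    · exact Or.inl h
    · right
      unfold LeftNormal at h
      push Not at h
      obtain ⟨k, hk, hl⟩ := h hB
      rw [← left_e_eq_none_iff, ← Ne, Option.ne_none_iff_exists'] at hl
      obtain ⟨C, h⟩ := hl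
      obtain ⟨s, -, hm⟩ := left_f_iff.mp (left_f_iff_e.mpr h)
      refine ⟨(k, true), C, h, fun i j hj => ?_, ?_⟩
      · have h1 : ¬ j = k := by omega
        simp [hm.symm.apply, h1, hB i j hj]
      · have := sum_supp_of_isMove hm.symm fun _ j => ((j.toNat : ℕ) : ℤ)
        rw [← Nat.cast_sum, ← Nat.cast_sum] at this
        omega
  obtain ⟨C, hBC, hC⟩ := Connected.of_measure (fun B => ∑ p ∈ B.supp, p.2.toNat) hstep B hB
  exact ⟨C, hAB.trans hBC, hC⟩

/-! Elements that are normal for both structures. -/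

theorem mem_iff_lt_card {S : Finset ℤ} (h0 : ∀ j ∈ S, 0 ≤ j)
    (h : ∀ k, 0 ≤ k → k + 1 ∈ S → k ∈ S) (j : ℤ) : j ∈ S ↔ 0 ≤ j ∧ j < S.card := by
  have hdown : ∀ d : ℕ, ∀ j : ℤ, 0 ≤ j → j + d ∈ S → j ∈ S := by
    intro d
    induction d with
    | zero => intro j _ hj; simpa using hj
    | succ d ih =>
      intro j hj hjd
      refine ih j hj (h _ (by omega) ?_)
      push_cast at hjd
      rwa [add_assoc]
  constructor
  · intro hj
    refine ⟨h0 j hj, ?_⟩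
    have : Finset.Icc 0 j ⊆ S := fun i hi => by
      rw [Finset.mem_Icc] at hi
      refine hdown (j - i).toNat i hi.1 ?_
      rwa [Int.toNat_of_nonneg (by omega), add_sub_cancel]
    have := Finset.card_le_card this
    rw [Int.card_Icc] at this
    omega
  · rintro ⟨hj, hlt⟩
    by_contra hjS
    have : S ⊆ Finset.Ico 0 j := fun i hi => by
      rw [Finset.mem_Ico]
      refine ⟨h0 i hi, not_le.mp fun hji => hjS (hdown (i - j).toNat j hj ?_)⟩
      rwa [Int.toNat_of_nonneg (by omega), add_sub_cancel]
    have := Finset.card_le_card this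
    rw [Int.card_Ico] at this
    omega

theorem mem_iff_le_add_card {S : Finset (Fin n)} (h : ∀ i j, i ≤ j → i ∈ S → j ∈ S) (i : Fin n) :
    i ∈ S ↔ n ≤ i + S.card := by
  constructor
  · intro hi
    have : Finset.Ici i ⊆ S := fun j hj => h i j (Finset.mem_Ici.mp hj) hi
    have := Finset.card_le_card this
    rw [Fin.card_Ici] at this
    omega
  · intro hc
    by_contra hi
    have : S ⊆ Finset.Ioi i := fun j hj =>
      Finset.mem_Ioi.mpr (not_le.mp fun hji => hi (h j i hji hj))
    have := Finset.card_le_card this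
    rw [Fin.card_Ioi] at this
    omega

variable {A : BinMat n}

theorem row_spec_of_normal (hl : A.LeftNormal) (hr : A.RightNormal) (i : Fin n) :
    (∀ j, j ∈ A.row i ↔ 0 ≤ j ∧ j < (A.row i).card) ∧
      ∀ i' ≤ i, A.row i' ⊆ A.row i := by
  obtain ⟨i, hi⟩ := i
  -- a row is a segment `[0, r)` once this is known for the shorter rows above it
  have key : ∀ i (hi : i < n), (∀ i' : Fin n, i'.1 < i → ∀ j, j ∈ A.row i' → 0 ≤ j →
      j ∈ A.row ⟨i, hi⟩) → ∀ j, j ∈ A.row ⟨i, hi⟩ ↔ 0 ≤ j ∧ j < (A.row ⟨i, hi⟩).card := by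
    intro i hi habove
    refine mem_iff_lt_card (fun j hj => ?_) fun k hk hk1 => ?_
    · by_contra hneg
      exact absurd ((hl.1 _ _ (not_le.mp hneg)).symm.trans (mem_row.mp hj)) (by decide)
    · by_contra hkn
      -- the columns `k` and `k + 1` vanish above row `i`
      have h0 : ∀ i' : Fin n, i'.1 < i → k ∉ A.row i' :=
        fun i' hi' hk' => hkn (habove i' hi' k hk' hk)
      have h1 := hl.2 k hk ⟨i, hi⟩
      have h2 : (A.col k).filter (· ≤ ⟨i, hi⟩) = ∅ := by
        rw [Finset.filter_eq_empty_iff]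
        intro i' hi' hle
        have h3 : k ∈ A.row i' := mem_row.mpr (mem_col.mp hi')
        rcases (Fin.le_def.mp hle).eq_or_lt with he | hlt
        · rw [show i' = ⟨i, hi⟩ from Fin.ext he] at h3
          exact hkn h3
        · exact h0 i' hlt h3
      rw [h2, Finset.card_empty, Nat.le_zero, Finset.card_eq_zero, Finset.filter_eq_empty_iff] at h1
      exact h1 (mem_col.mpr (mem_row.mp hk1)) le_rfl
  induction i with
  | zero =>
    refine ⟨key 0 hi fun i' hi' => absurd hi' (Nat.not_lt_zero _), fun i' hi' => ?_⟩
    rw [show i' = ⟨0, hi⟩ from Fin.ext (Nat.le_zero.mp hi')]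
  | succ i ih =>
    obtain ⟨ih1, ih2⟩ := ih (by omega)
    have hdom := hr ⟨i, hi⟩
    have hdom : Dominates (A.row ⟨i + 1, hi⟩) (A.row ⟨i, by omega⟩) := hdom
    have hsub : A.row ⟨i, by omega⟩ ⊆ A.row ⟨i + 1, hi⟩ := by
      have h1 := hdom ((A.row ⟨i, by omega⟩).card - 1)
      rw [Finset.filter_true_of_mem (s := A.row ⟨i, by omega⟩)
        fun j hj => by have := ((ih1 j).mp hj).2; omega] at h1
      have h2 : (A.row ⟨i + 1, hi⟩).filter (· ≤ ((A.row ⟨i, by omega⟩).card : ℤ) - 1) ⊆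
          A.row ⟨i, by omega⟩ := by
        intro j hj
        rw [Finset.mem_filter] at hj
        rw [ih1]
        refine ⟨?_, by omega⟩
        by_contra hneg
        exact absurd ((hl.1 _ _ (not_le.mp hneg)).symm.trans (mem_row.mp hj.1)) (by decide)
      rw [← Finset.eq_of_subset_of_card_le h2 h1]
      exact Finset.filter_subset _ _
    refine ⟨key (i + 1) hi fun i' hi' j hj _ => hsub (ih2 i' ?_ hj), fun i' hi' => ?_⟩
    · exact Fin.le_def.mpr (Nat.lt_succ_iff.mp hi')
    · rcases (Fin.le_def.mp hi').eq_or_lt with he | hlt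
      · rw [show i' = ⟨i + 1, hi⟩ from Fin.ext he]
      · exact (ih2 i' (Fin.le_def.mpr (Nat.lt_succ_iff.mp hlt))).trans hsub

/-- A matrix that is normal for both structures is determined by its row sums. -/
theorem apply_iff_card_row (hl : A.LeftNormal) (hr : A.RightNormal) (i : Fin n) (j : ℤ) :
    A.1 i j = true ↔ 0 ≤ j ∧ j < (A.row i).card := by
  rw [← mem_row, (row_spec_of_normal hl hr i).1]

/-- A matrix that is normal for both structures is determined by its column sums. -/
theorem apply_iff_card_col (hl : A.LeftNormal) (hr : A.RightNormal) (i : Fin n) (j : ℤ) :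
    A.1 i j = true ↔ n ≤ i + (A.col j).card := by
  rw [← mem_col]
  refine mem_iff_le_add_card (fun i i' hii' hi => ?_) i
  exact mem_col.mpr (mem_row.mp ((row_spec_of_normal hl hr i').2 i hii'
    (mem_row.mpr (mem_col.mp hi))))

theorem card_row_of_connected {A A' : BinMat n}
    (h : Connected (binMatBicrystal n).left.ops A A') (i : Fin n) :
    (A'.row i).card = (A.row i).card :=
  h.induction (P := fun B => (B.row i).card = (A.row i).card)
    ((left_isCrystal n).ops_induction fun k b c hbc => by rw [card_row_of_left_f hbc i]) rfl

theorem card_col_of_connected {A A' : BinMat n}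
    (h : Connected (binMatBicrystal n).right.ops A A') (j : ℤ) :
    (A'.col j).card = (A.col j).card :=
  h.induction (P := fun B => (B.col j).card = (A.col j).card)
    ((right_isCrystal n).ops_induction fun k b c hbc => by rw [card_col_of_right_f hbc j]) rfl

theorem normalForms (n : ℕ) : NormalForms (binMatBicrystal n).left.ops
    (binMatBicrystal n).right.ops (LeftNormal (n := n)) RightNormal where
  comm := (isBicrystal n).ops_comm
  inv_l := (left_isCrystal n).ops_inv
  inv_r := (right_isCrystal n).ops_inv
  stable_l := (left_isCrystal n).ops_induction fun _ _ _ h => rightNormal_of_left_f h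
  stable_r := (right_isCrystal n).ops_induction fun _ _ _ h => leftNormal_of_right_f h
  exists_l := exists_leftNormal
  exists_r := exists_rightNormal
  rigid_l b c hbc h1 h2 h3 h4 := Subtype.ext <| by
    ext i j
    rw [Bool.eq_iff_iff, apply_iff_card_row h1 h2, apply_iff_card_row h3 h4,
      card_row_of_connected hbc]
  rigid_r b c hbc h1 h2 h3 h4 := Subtype.ext <| by
    ext i j
    rw [Bool.eq_iff_iff, apply_iff_card_col h1 h2, apply_iff_card_col h3 h4,
      card_col_of_connected hbc]

end BinMat

/-! ### Crystal operators on words -/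

section Words

variable {κ : Type} [LinearOrder κ] {D : GlDatum κ}

/-- The pairing `⟨ϵ_x, h_k⟩`, as the sign of the letter `x`. -/
def letterSign (D : GlDatum κ) (k : D.Idx) (x : κ) : ℤ := D.coroot k (D.eps x)

theorem letterSign_eq (hD : D.IsStandard) (k : D.Idx) (x : κ) : letterSign D k x =
    (if x = D.fst k then 1 else 0) - (if x = D.snd k then 1 else 0) :=
  hD.coroot_eps k x

theorem natural_ε (hD : D.IsStandard) (k : D.Idx) (x : κ) :
    (naturalCrystal D).ε k x = ((max 0 (-letterSign D k x) : ℤ) : WithBot ℤ) := by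
  have := (hD.covBy k).ne
  unfold naturalCrystal
  rw [letterSign_eq hD]
  by_cases h1 : x = D.fst k
  · subst h1
    simp [this]
  · by_cases h2 : x = D.snd k
    · subst h2
      simp [this.symm]
    · simp [h1, h2]

theorem natural_φ (hD : D.IsStandard) (k : D.Idx) (x : κ) :
    (naturalCrystal D).φ k x = ((max 0 (letterSign D k x) : ℤ) : WithBot ℤ) := by
  have := (hD.covBy k).ne
  unfold naturalCrystal
  rw [letterSign_eq hD]
  by_cases h1 : x = D.fst k
  · subst h1
    simp [this]
  · by_cases h2 : x = D.snd k
    · subst h2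
      simp [this.symm]
    · simp [h1, h2]

theorem wordε_eq (hD : D.IsStandard) (k : D.Idx) (w : List κ) :
    (naturalCrystal D).wordε k w = (listEps (w.map (letterSign D k)) : ℤ) := by
  induction w with
  | nil => rfl
  | cons x w ih =>
    rw [CrystalData.wordε, ih, natural_ε hD, List.map_cons, listEps, ← WithBot.coe_add,
      ← WithBot.coe_max]
    rfl

omit [LinearOrder κ] in
theorem coroot_wordWt (k : D.Idx) (w : List κ) :
    D.coroot k ((naturalCrystal D).wordWt w) = (w.map (letterSign D k)).sum := by
  induction w with
  | nil => exact map_zero _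
  | cons x w ih =>
    rw [CrystalData.wordWt, map_add, ih, List.map_cons, List.sum_cons]
    rfl

theorem wordφ_eq (hD : D.IsStandard) (k : D.Idx) (w : List κ) :
    (naturalCrystal D).wordφ k w =
      (((w.map (letterSign D k)).sum + listEps (w.map (letterSign D k)) : ℤ) : WithBot ℤ) := by
  induction w with
  | nil => rfl
  | cons x w ih =>
    rw [CrystalData.wordφ, ih, natural_φ hD, List.map_cons, List.sum_cons, listEps, coroot_wordWt,
      ← WithBot.coe_add, ← WithBot.coe_max, WithBot.coe_inj]
    omega

theorem natural_f (k : D.Idx) (x : κ) :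
    (naturalCrystal D).f k x = if x = D.fst k then some (D.snd k) else none := by
  simp only [naturalCrystal]
  congr

theorem natural_e (k : D.Idx) (x : κ) :
    (naturalCrystal D).e k x = if x = D.snd k then some (D.fst k) else none := by
  simp only [naturalCrystal]
  congr

theorem wordF_cons (hD : D.IsStandard) (k : D.Idx) (x : κ) (w : List κ) :
    (naturalCrystal D).wordF k (x :: w) =
      if x = D.fst k ∧ listEps (w.map (letterSign D k)) = 0 then some (D.snd k :: w)
      else ((naturalCrystal D).wordF k w).map (x :: ·) := by
  have h0 := listEps_nonneg (w.map (letterSign D k))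
  rw [CrystalData.wordF, wordε_eq hD, natural_φ hD, natural_f, letterSign_eq hD]
  simp only [WithBot.coe_lt_coe]
  by_cases hx : x = D.fst k
  · subst hx
    rw [if_pos rfl, if_pos rfl, if_neg (hD.covBy k).ne]
    have : listEps (w.map (letterSign D k)) < max 0 (1 - 0) ↔
        listEps (w.map (letterSign D k)) = 0 := by omega
    simp only [this, true_and, Option.map_some]
  · rw [if_neg hx, if_neg hx, if_neg (fun h : x = D.fst k ∧ _ => hx h.1), if_neg]
    split_ifs <;> omega

theorem wordE_cons (hD : D.IsStandard) (k : D.Idx) (x : κ) (w : List κ) :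
    (naturalCrystal D).wordE k (x :: w) =
      if listEps (w.map (letterSign D k)) ≤ max 0 (letterSign D k x) then
        if x = D.snd k then some (D.fst k :: w) else none
      else ((naturalCrystal D).wordE k w).map (x :: ·) := by
  rw [CrystalData.wordE, wordε_eq hD, natural_φ hD, natural_e]
  simp only [WithBot.coe_le_coe]
  congr 1
  by_cases hx : x = D.snd k
  · rw [if_pos hx, if_pos hx]
    rfl
  · rw [if_neg hx, if_neg hx]
    rfl

theorem wordE_eq_none (hD : D.IsStandard) {k : D.Idx} {w : List κ}
    (hw : listEps (w.map (letterSign D k)) = 0) : (naturalCrystal D).wordE k w = none := by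
  cases w with
  | nil => rfl
  | cons x w =>
    rw [List.map_cons, listEps] at hw
    have h1 : x ≠ D.snd k := by
      rintro rfl
      rw [letterSign_eq hD, if_pos rfl, if_neg (hD.covBy k).ne'] at hw
      omega
    rw [wordE_cons hD, if_pos (by omega), if_neg h1]

theorem listEps_of_wordF (hD : D.IsStandard) {k : D.Idx} {w w' : List κ}
    (h : (naturalCrystal D).wordF k w = some w') :
    listEps (w'.map (letterSign D k)) = listEps (w.map (letterSign D k)) + 1 := by
  induction w generalizing w' with
  | nil => exact absurd h (by simp [CrystalData.wordF])
  | cons x w ih =>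
    have h0 := listEps_nonneg (w.map (letterSign D k))
    have hne := (hD.covBy k).ne
    rw [wordF_cons hD] at h
    split_ifs at h with hx
    · rw [← Option.some_inj.mp h, List.map_cons, List.map_cons, listEps, listEps, hx.1, hx.2,
        letterSign_eq hD, letterSign_eq hD, if_pos rfl, if_pos rfl, if_neg hne, if_neg hne.symm]
      rfl
    · obtain ⟨v, hv, rfl⟩ := Option.map_eq_some_iff.mp h
      rw [List.map_cons, List.map_cons, listEps, listEps, ih hv]
      have : max 0 (letterSign D k x) ≤ listEps (w.map (letterSign D k)) := by
        rw [letterSign_eq hD]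
        by_cases hx1 : x = D.fst k
        · have : listEps (w.map (letterSign D k)) ≠ 0 := fun h' => hx ⟨hx1, h'⟩
          split_ifs <;> omega
        · rw [if_neg hx1]
          split_ifs <;> omega
      omega

theorem wordE_of_wordF (hD : D.IsStandard) {k : D.Idx} {w w' : List κ}
    (h : (naturalCrystal D).wordF k w = some w') : (naturalCrystal D).wordE k w' = some w := by
  induction w generalizing w' with
  | nil => exact absurd h (by simp [CrystalData.wordF])
  | cons x w ih =>
    have h0 := listEps_nonneg (w.map (letterSign D k))
    rw [wordF_cons hD] at h
    split_ifs at h with hx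
    · rw [← Option.some_inj.mp h, wordE_cons hD, hx.2, if_pos (by omega), if_pos rfl, hx.1]
    · obtain ⟨v, hv, rfl⟩ := Option.map_eq_some_iff.mp h
      rw [wordE_cons hD, listEps_of_wordF hD hv, if_neg, ih hv, Option.map_some]
      rw [letterSign_eq hD]
      by_cases hx1 : x = D.fst k
      · have : listEps (w.map (letterSign D k)) ≠ 0 := fun h' => hx ⟨hx1, h'⟩
        split_ifs <;> omega
      · rw [if_neg hx1]
        split_ifs <;> omega

/-! Words of columns. -/

theorem column_signs (hD : D.IsStandard) (k : D.Idx) {c : List κ} (hc : c.Pairwise (· < ·)) :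
    (c.map (letterSign D k)).sum =
        (if D.fst k ∈ c then 1 else 0) - (if D.snd k ∈ c then 1 else 0) ∧
      listEps (c.map (letterSign D k)) =
        max 0 ((if D.snd k ∈ c then 1 else 0) - (if D.fst k ∈ c then 1 else 0)) := by
  have hlt := (hD.covBy k).lt
  induction c with
  | nil => simp [listEps]
  | cons y c ih =>
    rw [List.pairwise_cons] at hc
    obtain ⟨ih1, ih2⟩ := ih hc.2
    have hy : y ∉ c := fun h => lt_irrefl _ (hc.1 y h)
    rw [List.map_cons, List.sum_cons, listEps, ih1, ih2, letterSign_eq hD]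
    by_cases h1 : y = D.fst k
    · subst h1
      have hne := hlt.ne'
      simp only [List.mem_cons, true_or, if_true, hlt.ne, hne, false_or, if_false, hy]
      split_ifs <;> omega
    · by_cases h2 : y = D.snd k
      · subst h2
        have hf : D.fst k ∉ c := fun h => lt_asymm hlt (hc.1 _ h)
        simp only [List.mem_cons, true_or, if_true, hlt.ne, hlt.ne', false_or, if_false, hy, hf]
        omega
      · simp only [List.mem_cons, h1, h2, Ne.symm h1, Ne.symm h2, false_or, if_false]
        split_ifs <;> omega

/-- The effect of `f̃_k` on a column. -/
def lowerLetter (D : GlDatum κ) (k : D.Idx) (x : κ) : κ := if x = D.fst k then D.snd k else x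

theorem wordF_column_append (hD : D.IsStandard) {k : D.Idx} {c w : List κ}
    (hc : c.Pairwise (· < ·)) (h1 : D.fst k ∈ c) (h2 : D.snd k ∉ c)
    (hw : listEps (w.map (letterSign D k)) = 0) :
    (naturalCrystal D).wordF k (c ++ w) = some (c.map (lowerLetter D k) ++ w) := by
  induction c with
  | nil => exact absurd h1 List.not_mem_nil
  | cons y c ih =>
    rw [List.pairwise_cons] at hc
    rw [List.cons_append, wordF_cons hD]
    rw [List.mem_cons, not_or] at h2
    by_cases hy : y = D.fst k
    · subst hy
      have hf : D.fst k ∉ c := fun h => lt_irrefl _ (hc.1 _ h)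
      obtain ⟨e1, e2⟩ := column_signs hD k hc.2
      rw [if_neg hf, if_neg h2.2] at e1 e2
      rw [if_pos ⟨rfl, by rw [List.map_append, listEps_append, e1, e2, hw]; rfl⟩, List.map_cons,
        lowerLetter, if_pos rfl, List.cons_append]
      have hid : c.map (lowerLetter D k) = c.map id := List.map_congr_left fun x hx => by
        have hx' : x ≠ D.fst k := fun h => hf (by rwa [h] at hx)
        rw [lowerLetter, if_neg hx', id]
      rw [hid, List.map_id]
    · have hf : D.fst k ∈ c := (List.mem_cons.mp h1).resolve_left (Ne.symm hy)
      rw [if_neg fun h => hy h.1, ih hc.2 hf h2.2, Option.map_some, List.map_cons, lowerLetter,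
        if_neg hy, List.cons_append]

theorem wordF_append_of_not (hD : D.IsStandard) {k : D.Idx} {c w : List κ}
    (hc : c.Pairwise (· < ·))
    (h : ¬(D.fst k ∈ c ∧ D.snd k ∉ c ∧ listEps (w.map (letterSign D k)) = 0)) :
    (naturalCrystal D).wordF k (c ++ w) = ((naturalCrystal D).wordF k w).map (c ++ ·) := by
  have hlt := (hD.covBy k).lt
  induction c with
  | nil => simp
  | cons y c ih =>
    rw [List.pairwise_cons] at hc
    have h0 := listEps_nonneg (w.map (letterSign D k))
    have hy : y ∉ c := fun h => lt_irrefl _ (hc.1 y h)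
    obtain ⟨e1, e2⟩ := column_signs hD k hc.2
    rw [List.cons_append, wordF_cons hD, if_neg, ih hc.2, Option.map_map]
    · rfl
    · rintro ⟨h1, h2, h3⟩
      refine h ⟨List.mem_cons_of_mem _ h1, fun h' => ?_, h3⟩
      rcases List.mem_cons.mp h' with rfl | h'
      · exact lt_asymm hlt (hc.1 _ h1)
      · exact h2 h'
    · rintro ⟨rfl, h1⟩
      rw [List.map_append, listEps_append, e1, e2, if_neg hy] at h1
      refine h ⟨List.mem_cons_self, ?_, ?_⟩
      · intro h'
        rw [if_pos ((List.mem_cons.mp h').resolve_left hlt.ne')] at h1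
        omega
      · split_ifs at h1 <;> omega

end Words

section Reading

variable {ι κ γ : Type} [LinearOrder ι] [LocallyFiniteOrder ι] [LinearOrder κ] {D : GlDatum κ}

/-- The list `J` enumerates the non-zero rows of the matrix `B`, and possibly some zero rows, from
top to bottom: its member `j` stands for the row `r j`, and `c j` is the increasing list of the
columns where this row has an entry `1`. Then `J.flatMap c` is the reading word of `B`. -/
structure IsReading (B : Matrix ι κ Bool) (r : γ → ι) (c : γ → List κ) (J : List γ) : Prop where
  sorted : (J.map r).Pairwise (· < ·)
  col_sorted : ∀ j ∈ J, (c j).Pairwise (· < ·)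
  mem : ∀ j ∈ J, ∀ x, x ∈ c j ↔ B (r j) x = true
  off : ∀ s x, B s x = true → s ∈ J.map r

namespace IsReading

variable {B B' : Matrix ι κ Bool} {r : γ → ι} {c c' : γ → List κ} {J : List γ}

omit [LocallyFiniteOrder ι] in
theorem mem_of_rowSign (h : IsReading B r c J) {k k' : κ} {u : ι} (hu : rowSign k k' B u ≠ 0) :
    u ∈ J.map r := by
  by_contra hn
  refine hu ?_
  have h1 : ∀ x, B u x = false := fun x => by
    by_contra hx
    exact hn (h.off u x (by simpa using hx))
  unfold rowSign
  rw [h1, h1]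

omit [LinearOrder ι] [LocallyFiniteOrder ι] in
theorem signs_of_columns (hD : D.IsStandard) (k : D.Idx)
    (hc : ∀ j ∈ J, (c j).Pairwise (· < ·)) (hm : ∀ j ∈ J, ∀ x, x ∈ c j ↔ B (r j) x = true) :
    ((J.flatMap c).map (letterSign D k)).sum =
        ((J.map r).map fun s => (rowSign (D.fst k) (D.snd k) B s : ℤ)).sum ∧
      listEps ((J.flatMap c).map (letterSign D k)) =
        listEps ((J.map r).map fun s => (rowSign (D.fst k) (D.snd k) B s : ℤ)) := by
  induction J with
  | nil => exact ⟨rfl, rfl⟩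
  | cons j J ih =>
    obtain ⟨ih1, ih2⟩ := ih (fun i hi => hc i (List.mem_cons_of_mem _ hi))
      fun i hi => hm i (List.mem_cons_of_mem _ hi)
    obtain ⟨e1, e2⟩ := column_signs hD k (hc j List.mem_cons_self)
    rw [List.flatMap_cons, List.map_append, List.sum_append, listEps_append, ih1, ih2, e1, e2,
      List.map_cons, List.map_cons, List.sum_cons, listEps, coe_rowSign]
    simp only [hm j List.mem_cons_self]
    rw [neg_sub]
    exact ⟨trivial, rfl⟩

theorem wordε_eq_matε (hD : D.IsStandard) (h : IsReading B r c J) (k : D.Idx) :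
    (naturalCrystal D).wordε k (J.flatMap c) = (matε (D.fst k) (D.snd k) B : ℤ) := by
  rw [wordε_eq hD, (signs_of_columns hD k h.col_sorted h.mem).2, matε,
    natCard_survivingMinus h.sorted fun u hu => h.mem_of_rowSign hu]

theorem wordφ_eq_matφ (hD : D.IsStandard) (h : IsReading B r c J) (k : D.Idx) :
    (naturalCrystal D).wordφ k (J.flatMap c) = (matφ (D.fst k) (D.snd k) B : ℤ) := by
  rw [wordφ_eq hD, (signs_of_columns hD k h.col_sorted h.mem).1,
    (signs_of_columns hD k h.col_sorted h.mem).2, matφ,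
    natCard_survivingPlus h.sorted fun u hu => h.mem_of_rowSign hu]

/-- The first letter of the list gives rise to a surviving sign exactly if `f̃_k` can act on it. -/
theorem survivingPlus_iff (hD : D.IsStandard) (k : D.Idx) {j : γ}
    (hs : ((j :: J).map r).Pairwise (· < ·)) (hc : ∀ i ∈ j :: J, (c i).Pairwise (· < ·))
    (hm : ∀ i ∈ j :: J, ∀ x, x ∈ c i ↔ B (r i) x = true)
    (hoff : ∀ u, r j < u → rowSign (D.fst k) (D.snd k) B u ≠ 0 → u ∈ J.map r) :
    SurvivingPlus (rowSign (D.fst k) (D.snd k) B) (r j) ↔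
      D.fst k ∈ c j ∧ D.snd k ∉ c j ∧ listEps ((J.flatMap c).map (letterSign D k)) = 0 := by
  rw [List.map_cons, List.pairwise_cons] at hs
  rw [survivingPlus_iff_listEps hs.2 hs.1 hoff, rowSign_eq_one_iff,
    (signs_of_columns hD k (fun i hi => hc i (List.mem_cons_of_mem _ hi))
      fun i hi => hm i (List.mem_cons_of_mem _ hi)).2,
    hm j List.mem_cons_self, hm j List.mem_cons_self, and_assoc, Bool.not_eq_true]

theorem wordF_eq_none (hD : D.IsStandard) (h : IsReading B r c J) {k : D.Idx}
    (hk : ∀ s, ¬SurvivingPlus (rowSign (D.fst k) (D.snd k) B) s) :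
    (naturalCrystal D).wordF k (J.flatMap c) = none := by
  have key : ∀ J : List γ, (J.map r).Pairwise (· < ·) → (∀ i ∈ J, (c i).Pairwise (· < ·)) →
      (∀ i ∈ J, ∀ x, x ∈ c i ↔ B (r i) x = true) →
      (∀ j ∈ J, ∀ u, r j < u → rowSign (D.fst k) (D.snd k) B u ≠ 0 → u ∈ J.map r) →
      (naturalCrystal D).wordF k (J.flatMap c) = none := by
    intro J
    induction J with
    | nil => intros; rfl
    | cons j J ih =>
      intro hs hc hm hoff
      have hs' := hs
      rw [List.map_cons, List.pairwise_cons] at hs'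
      have hoff' : ∀ i ∈ j :: J, ∀ u, r j < u → r i < u → rowSign (D.fst k) (D.snd k) B u ≠ 0 →
          u ∈ J.map r := by
        intro i hi u hju hiu hu
        have := hoff i hi u hiu hu
        rw [List.map_cons, List.mem_cons] at this
        exact this.resolve_left hju.ne'
      rw [List.flatMap_cons, wordF_append_of_not hD (hc j List.mem_cons_self), ih hs'.2
        (fun i hi => hc i (List.mem_cons_of_mem _ hi))
        (fun i hi => hm i (List.mem_cons_of_mem _ hi))
        (fun i hi u hu => hoff' i (List.mem_cons_of_mem _ hi) u
          ((hs'.1 _ (List.mem_map_of_mem hi)).trans hu) hu), Option.map_none]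
      rw [← survivingPlus_iff hD k hs hc hm fun u hu =>
        hoff' j List.mem_cons_self u hu hu]
      exact hk (r j)
  exact key J h.sorted h.col_sorted h.mem fun _ _ u _ hu => h.mem_of_rowSign hu

theorem lowerLetter_column (hD : D.IsStandard) {k : D.Idx} {l l' : List κ}
    (hl : l.Pairwise (· < ·)) (hl' : l'.Pairwise (· < ·)) (h1 : D.fst k ∈ l) (h2 : D.snd k ∉ l)
    (h : ∀ x, x ∈ l' ↔ x = D.snd k ∨ (x ≠ D.fst k ∧ x ∈ l)) : l.map (lowerLetter D k) = l' := by
  refine List.Pairwise.eq_of_mem_iff (r := (· < ·)) ?_ hl' fun x => ?_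
  · rw [List.pairwise_map]
    refine hl.imp_of_mem fun {x y} hx hy hxy => ?_
    unfold lowerLetter
    split_ifs with e1 e2 e2
    · exact absurd (e1.trans e2.symm) hxy.ne
    · refine lt_of_le_of_ne ((hD.covBy k).ge_of_gt (e1 ▸ hxy)) ?_
      rintro rfl
      exact h2 hy
    · exact (e2 ▸ hxy).trans (hD.covBy k).lt
    · exact hxy
  · rw [h, List.mem_map]
    constructor
    · rintro ⟨y, hy, rfl⟩
      unfold lowerLetter
      split_ifs with e1
      · exact Or.inl rfl
      · exact Or.inr ⟨e1, hy⟩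
    · rintro (rfl | ⟨hx, hx'⟩)
      · exact ⟨_, h1, if_pos rfl⟩
      · exact ⟨x, hx', if_neg hx⟩

theorem wordF_eq_some (hD : D.IsStandard) (h : IsReading B r c J) (h' : IsReading B' r c' J)
    {k : D.Idx} (hk : matF (D.fst k) (D.snd k) B = some B') :
    (naturalCrystal D).wordF k (J.flatMap c) = some (J.flatMap c') := by
  have hne := (hD.covBy k).ne
  obtain ⟨s, hs, hB'⟩ := matF_eq_some_iff.mp hk
  have hsame : ∀ j ∈ J, r j ≠ s → c j = c' j := fun j hj hjs =>
    List.Pairwise.eq_of_mem_iff (h.col_sorted j hj) (h'.col_sorted j hj) fun x => by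
      rw [h.mem j hj, h'.mem j hj, hB'.apply]
      simp [hjs]
  have hchange : ∀ j ∈ J, r j = s → (c j).map (lowerLetter D k) = c' j := fun j hj hjs => by
    subst hjs
    refine lowerLetter_column hD (h.col_sorted j hj) (h'.col_sorted j hj)
      ((h.mem j hj _).mpr hB'.source) (fun h' => ?_) fun x => ?_
    · exact absurd (((h.mem j hj _).mp h').symm.trans hB'.target) (by decide)
    · rw [h.mem j hj, h'.mem j hj, hB'.apply]
      by_cases hx : x = D.snd k
      · simp [hx]
      · simp [hx]
  have key : ∀ K : List γ, (∀ j ∈ K, j ∈ J) → (K.map r).Pairwise (· < ·) → s ∈ K.map r →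
      (∀ j ∈ K, ∀ u, r j < u → rowSign (D.fst k) (D.snd k) B u ≠ 0 → u ∈ K.map r) →
      (naturalCrystal D).wordF k (K.flatMap c) = some (K.flatMap c') := by
    intro K
    induction K with
    | nil => intro _ _ h; exact absurd h List.not_mem_nil
    | cons j K ih =>
      intro hKJ hsort hsK hoff
      have hsort' := hsort
      rw [List.map_cons, List.pairwise_cons] at hsort'
      have hoff' : ∀ i ∈ j :: K, ∀ u, r j < u → r i < u → rowSign (D.fst k) (D.snd k) B u ≠ 0 →
          u ∈ K.map r := by
        intro i hi u hju hiu hu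
        have := hoff i hi u hiu hu
        rw [List.map_cons, List.mem_cons] at this
        exact this.resolve_left hju.ne'
      have hj := hKJ j List.mem_cons_self
      have hsurv := survivingPlus_iff hD k hsort (fun i hi => h.col_sorted i (hKJ i hi))
        (fun i hi => h.mem i (hKJ i hi)) fun u hu => hoff' j List.mem_cons_self u hu hu
      rw [List.flatMap_cons, List.flatMap_cons]
      rw [List.map_cons, List.mem_cons] at hsK
      by_cases hjs : s = r j
      · subst hjs
        obtain ⟨e1, e2, e3⟩ := hsurv.mp hs.1
        rw [wordF_column_append hD (h.col_sorted j hj) e1 e2 e3, hchange j hj rfl,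
          List.flatMap_congr fun i hi => hsame i (hKJ i (List.mem_cons_of_mem _ hi))
            (hsort'.1 _ (List.mem_map_of_mem hi)).ne']
      · have hlt : r j < s := hsort'.1 s (hsK.resolve_left hjs)
        rw [wordF_append_of_not hD (h.col_sorted j hj), ih
          (fun i hi => hKJ i (List.mem_cons_of_mem _ hi)) hsort'.2 (hsK.resolve_left hjs)
          (fun i hi u hu => hoff' i (List.mem_cons_of_mem _ hi) u
            ((hsort'.1 _ (List.mem_map_of_mem hi)).trans hu) hu), Option.map_some,
          hsame j hj (Ne.symm hjs)]
        rw [← hsurv]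
        exact fun h' => absurd (hs.2 _ h') (not_le.mpr hlt)
  refine key J (fun _ hj => hj) h.sorted (h.mem_of_rowSign (k := D.fst k) (k' := D.snd k) ?_)
    fun _ _ u _ hu => h.mem_of_rowSign hu
  rw [hs.1.1]
  decide

theorem wordE_eq_some (hD : D.IsStandard) (h : IsReading B r c J) (h' : IsReading B' r c' J)
    {k : D.Idx} (hk : matE (D.fst k) (D.snd k) B = some B') :
    (naturalCrystal D).wordE k (J.flatMap c) = some (J.flatMap c') :=
  wordE_of_wordF hD (h'.wordF_eq_some hD h ((matF_eq_some_iff_matE (hD.covBy k).ne).mpr hk))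

theorem wordE_none (hD : D.IsStandard) (h : IsReading B r c J) {k : D.Idx}
    (hk : matε (D.fst k) (D.snd k) B = 0) :
    (naturalCrystal D).wordE k (J.flatMap c) = none := by
  refine wordE_eq_none hD ?_
  have h1 := h.wordε_eq_matε hD k
  rw [wordε_eq hD, hk] at h1
  exact_mod_cast h1

end IsReading

end Reading

/-! ### Tableaux and their columns -/

section Dominance

variable {κ : Type} [LinearOrder κ]

theorem Dominates.refl (c : Finset κ) : Dominates c c := fun _ => le_rfl

theorem Dominates.trans {c c' c'' : Finset κ} (h : Dominates c c') (h' : Dominates c' c'') :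
    Dominates c c'' := fun t => (h' t).trans (h t)

theorem Dominates.card_le {c c' : Finset κ} (h : Dominates c c') : c'.card ≤ c.card := by
  rcases c'.eq_empty_or_nonempty with he | hne
  · rw [he]
    exact Nat.zero_le _
  · have h1 := h (c'.max' hne)
    rw [Finset.filter_true_of_mem fun j hj => Finset.le_max' _ j hj] at h1
    exact h1.trans (Finset.card_filter_le _ _)

theorem Dominates.orderEmbOfFin_le {c c' : Finset κ} (h : Dominates c c') {i : ℕ} (hi : i < c.card)
    (hi' : i < c'.card) : c.orderEmbOfFin rfl ⟨i, hi⟩ ≤ c'.orderEmbOfFin rfl ⟨i, hi'⟩ := by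
  by_contra hlt
  rw [not_le] at hlt
  have h1 : i + 1 ≤ (c'.filter (· ≤ c'.orderEmbOfFin rfl ⟨i, hi'⟩)).card := by
    have : (Finset.Iic (⟨i, hi'⟩ : Fin c'.card)).map (c'.orderEmbOfFin rfl).toEmbedding ⊆
        c'.filter (· ≤ c'.orderEmbOfFin rfl ⟨i, hi'⟩) := by
      intro x hx
      obtain ⟨a, ha, rfl⟩ := Finset.mem_map.mp hx
      exact Finset.mem_filter.mpr ⟨Finset.orderEmbOfFin_mem _ _ _,
        (c'.orderEmbOfFin rfl).monotone (Finset.mem_Iic.mp ha)⟩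
    have := Finset.card_le_card this
    rwa [Finset.card_map, Fin.card_Iic] at this
  have h2 : (c.filter (· ≤ c'.orderEmbOfFin rfl ⟨i, hi'⟩)).card ≤ i := by
    have : c.filter (· ≤ c'.orderEmbOfFin rfl ⟨i, hi'⟩) ⊆
        (Finset.Iio (⟨i, hi⟩ : Fin c.card)).map (c.orderEmbOfFin rfl).toEmbedding := by
      intro x hx
      rw [Finset.mem_filter] at hx
      have hxr : x ∈ Set.range (c.orderEmbOfFin rfl) := by
        rw [Finset.range_orderEmbOfFin]
        exact hx.1
      obtain ⟨a, rfl⟩ := hxr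
      refine Finset.mem_map_of_mem _ (Finset.mem_Iio.mpr ?_)
      exact (c.orderEmbOfFin rfl).lt_iff_lt.mp (hx.2.trans_lt hlt)
    have := Finset.card_le_card this
    rwa [Finset.card_map, Fin.card_Iio] at this
  exact absurd (h1.trans ((h _).trans h2)) (by omega)

end Dominance

theorem YoungDiagram.colLen_eq_zero_of_le {μ : YoungDiagram} {j : ℕ} (h : μ.rowLen 0 ≤ j) :
    μ.colLen j = 0 := by
  by_contra h0
  have h1 : (0, j) ∈ μ := YoungDiagram.mem_iff_lt_colLen.mpr (Nat.pos_of_ne_zero h0)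
  exact absurd (YoungDiagram.mem_iff_lt_rowLen.mp h1) (not_lt.mpr h)

theorem YoungDiagram.ext_colLen {μ ν : YoungDiagram} (h : ∀ j, μ.colLen j = ν.colLen j) :
    μ = ν := by
  refine YoungDiagram.ext (Finset.ext fun ⟨i, j⟩ => ?_)
  rw [YoungDiagram.mem_cells, YoungDiagram.mem_cells, YoungDiagram.mem_iff_lt_colLen,
    YoungDiagram.mem_iff_lt_colLen, h]

namespace Tableau

variable {μ : YoungDiagram} {κ : Type} [LinearOrder κ]

/-- The `j`-th column, from top to bottom. -/
def col (T : Tableau μ κ) (j : ℕ) : List κ :=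
  (List.finRange (μ.colLen j)).map fun i =>
    T.entry ⟨(i.1, j), YoungDiagram.mem_iff_lt_colLen.mpr i.2⟩

/-- The set of the entries of the `j`-th column. -/
def colSet (T : Tableau μ κ) (j : ℕ) : Finset κ := (T.col j).toFinset

theorem colWord_eq (T : Tableau μ κ) :
    T.colWord = (List.range (μ.rowLen 0)).reverse.flatMap T.col := rfl

theorem length_col (T : Tableau μ κ) (j : ℕ) : (T.col j).length = μ.colLen j := by
  rw [col, List.length_map, List.length_finRange]

theorem col_pairwise (T : Tableau μ κ) (j : ℕ) : (T.col j).Pairwise (· < ·) := by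
  rw [col, List.pairwise_map]
  exact (List.pairwise_lt_finRange _).imp fun {a b} h =>
    T.col_strict ⟨(a.1, j), YoungDiagram.mem_iff_lt_colLen.mpr a.2⟩
      ⟨(b.1, j), YoungDiagram.mem_iff_lt_colLen.mpr b.2⟩ rfl h

theorem card_colSet (T : Tableau μ κ) (j : ℕ) : (T.colSet j).card = μ.colLen j := by
  rw [colSet, List.toFinset_card_of_nodup ((T.col_pairwise j).imp fun h => h.ne), length_col]

theorem colSet_eq_empty (T : Tableau μ κ) {j : ℕ} (h : μ.rowLen 0 ≤ j) : T.colSet j = ∅ := by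
  rw [← Finset.card_eq_zero, card_colSet, YoungDiagram.colLen_eq_zero_of_le h]

theorem mem_col_iff (T : Tableau μ κ) {j : ℕ} {x : κ} : x ∈ T.col j ↔ x ∈ T.colSet j := by
  rw [colSet, List.mem_toFinset]

theorem colSet_eq_image (T : Tableau μ κ) (j : ℕ) :
    T.colSet j = Finset.univ.image fun i : Fin (μ.colLen j) =>
      T.entry ⟨(i.1, j), YoungDiagram.mem_iff_lt_colLen.mpr i.2⟩ := by
  ext x
  rw [← mem_col_iff, col]
  simp

theorem dominates (T : Tableau μ κ) (j : ℕ) : Dominates (T.colSet j) (T.colSet (j + 1)) := by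
  have hcount : ∀ j t, ((T.colSet j).filter (· ≤ t)).card =
      (Finset.univ.filter fun i : Fin (μ.colLen j) =>
        T.entry ⟨(i.1, j), YoungDiagram.mem_iff_lt_colLen.mpr i.2⟩ ≤ t).card := by
    intro j t
    rw [colSet_eq_image, Finset.filter_image, Finset.card_image_of_injective]
    refine StrictMono.injective fun a b hab => T.col_strict _ _ rfl hab
  intro t
  rw [hcount, hcount]
  have hle : μ.colLen (j + 1) ≤ μ.colLen j := μ.colLen_anti j (j + 1) (Nat.le_succ j)
  refine Finset.card_le_card_of_injOn (Fin.castLE hle) (fun i hi => ?_)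
    (Fin.castLE_injective hle).injOn
  rw [Finset.mem_coe, Finset.mem_filter] at hi ⊢
  exact ⟨Finset.mem_univ _, (T.row_weak
    ⟨(i.1, j), YoungDiagram.mem_iff_lt_colLen.mpr (i.2.trans_le hle)⟩
    ⟨(i.1, j + 1), YoungDiagram.mem_iff_lt_colLen.mpr i.2⟩ rfl (Nat.lt_succ_self j)).trans hi.2⟩

theorem eq_of_col {T T' : Tableau μ κ} (h : ∀ j, T.col j = T'.col j) : T = T' := by
  have : T.entry = T'.entry := by
    funext ⟨⟨i, j⟩, hc⟩
    have := List.map_inj_left.mp (h j) ⟨i, YoungDiagram.mem_iff_lt_colLen.mp hc⟩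
      (List.mem_finRange _)
    exact this
  cases T
  cases T'
  simpa using this

theorem eq_of_colSet {T T' : Tableau μ κ} (h : ∀ j, T.colSet j = T'.colSet j) : T = T' :=
  eq_of_col fun j => List.Pairwise.eq_of_mem_iff (T.col_pairwise j) (T'.col_pairwise j) fun x => by
    rw [mem_col_iff, mem_col_iff, h]

theorem colWord_injective {T T' : Tableau μ κ} (h : T.colWord = T'.colWord) : T = T' := by
  have key : ∀ J : List ℕ, J.flatMap T.col = J.flatMap T'.col → ∀ j ∈ J, T.col j = T'.col j := by
    intro J
    induction J with
    | nil => intro _ j hj; exact absurd hj List.not_mem_nil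
    | cons a J ih =>
      intro h
      rw [List.flatMap_cons, List.flatMap_cons] at h
      obtain ⟨h1, h2⟩ := List.append_inj h (by rw [length_col, length_col])
      intro j hj
      rcases List.mem_cons.mp hj with rfl | hj
      · exact h1
      · exact ih h2 j hj
  refine eq_of_col fun j => ?_
  rcases lt_or_ge j (μ.rowLen 0) with hj | hj
  · exact key _ h j (by simpa using hj)
  · have h0 : ∀ T : Tableau μ κ, T.col j = [] := fun T => by
      rw [← List.length_eq_zero_iff, length_col, YoungDiagram.colLen_eq_zero_of_le hj]
    rw [h0, h0]

/-- Finite sets, each of which dominates the next one, are the columns of a tableau. -/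
theorem exists_of_dominates (c : ℕ → Finset κ) (hc : ∀ j, Dominates (c j) (c (j + 1))) (N : ℕ)
    (hN : ∀ j, N ≤ j → c j = ∅) :
    ∃ (μ : YoungDiagram) (T : Tableau μ κ), μ.rowLen 0 ≤ N ∧ ∀ j, T.colSet j = c j := by
  have hdom : ∀ i j, i ≤ j → Dominates (c i) (c j) := by
    intro i j hij
    induction hij with
    | refl => exact Dominates.refl _
    | step _ ih => exact ih.trans (hc _)
  let μ : YoungDiagram :=
    { cells := (Finset.range (c 0).card ×ˢ Finset.range N).filter fun p => p.1 < (c p.2).card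
      isLowerSet := by
        rintro ⟨i, j⟩ ⟨i', j'⟩ hle h
        obtain ⟨hi, hj⟩ := Prod.mk_le_mk.mp hle
        simp only [Finset.coe_filter, Set.mem_ofPred_eq, Finset.mem_product,
          Finset.mem_range] at h ⊢
        have := (hdom j' j hj).card_le
        omega }
  have hmem : ∀ i j, (i, j) ∈ μ ↔ i < (c j).card := by
    intro i j
    rw [← YoungDiagram.mem_cells]
    show (i, j) ∈ (Finset.range (c 0).card ×ˢ Finset.range N).filter _ ↔ _
    rw [Finset.mem_filter, Finset.mem_product, Finset.mem_range, Finset.mem_range]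
    have := (hdom 0 j (Nat.zero_le j)).card_le
    constructor
    · exact fun h => h.2
    · refine fun h => ⟨⟨by omega, ?_⟩, h⟩
      by_contra hj
      rw [hN j (not_lt.mp hj), Finset.card_empty] at h
      exact Nat.not_lt_zero _ h
  have hcol : ∀ j, μ.colLen j = (c j).card := fun j =>
    eq_of_forall_lt_iff fun i => by rw [← YoungDiagram.mem_iff_lt_colLen, hmem]
  let T : Tableau μ κ :=
    { entry := fun p => (c p.1.2).orderEmbOfFin rfl ⟨p.1.1, (hmem _ _).mp p.2⟩
      row_weak := by
        rintro ⟨⟨i, j⟩, h⟩ ⟨⟨i', j'⟩, h'⟩ hi hj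
        obtain rfl : i = i' := hi
        exact (hdom j j' (le_of_lt hj)).orderEmbOfFin_le _ _
      col_strict := by
        rintro ⟨⟨i, j⟩, h⟩ ⟨⟨i', j'⟩, h'⟩ hj hi
        obtain rfl : j = j' := hj
        exact ((c j).orderEmbOfFin rfl).strictMono hi }
  refine ⟨μ, T, ?_, fun j => ?_⟩
  · by_contra hlt
    have := YoungDiagram.mem_iff_lt_rowLen.mpr (not_le.mp hlt)
    rw [hmem, hN N le_rfl, Finset.card_empty] at this
    exact Nat.not_lt_zero _ this
  · refine Finset.eq_of_subset_of_card_le (fun x hx => ?_) (by rw [card_colSet, hcol])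
    rw [colSet_eq_image] at hx
    obtain ⟨i, -, rfl⟩ := Finset.mem_image.mp hx
    exact Finset.orderEmbOfFin_mem _ _ _

end Tableau

/-! ### The crystal of tableaux -/

section TableauCrystal

variable {κ : Type} [LinearOrder κ] {D : GlDatum κ} {μ : YoungDiagram} {T T' : Tableau μ κ}

theorem tableauCrystal_e_eq_some {k : D.Idx}
    (h : (naturalCrystal D).wordE k T.colWord = some T'.colWord) :
    (tableauCrystal D μ).e k T = some T' := by
  have hex : ∃ b' : Tableau μ κ, (naturalCrystal D).words.e k T.colWord = some b'.colWord := ⟨T', h⟩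
  refine (dif_pos hex).trans (congrArg some ?_)
  exact Tableau.colWord_injective (Option.some_inj.mp (hex.choose_spec.symm.trans h))

theorem tableauCrystal_f_eq_some {k : D.Idx}
    (h : (naturalCrystal D).wordF k T.colWord = some T'.colWord) :
    (tableauCrystal D μ).f k T = some T' := by
  have hex : ∃ b' : Tableau μ κ, (naturalCrystal D).words.f k T.colWord = some b'.colWord := ⟨T', h⟩
  refine (dif_pos hex).trans (congrArg some ?_)
  exact Tableau.colWord_injective (Option.some_inj.mp (hex.choose_spec.symm.trans h))

theorem tableauCrystal_e_eq_none {k : D.Idx} (h : (naturalCrystal D).wordE k T.colWord = none) :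
    (tableauCrystal D μ).e k T = none := by
  refine dif_neg ?_
  rintro ⟨b', hb'⟩
  exact absurd (h.symm.trans hb') (by simp)

theorem tableauCrystal_f_eq_none {k : D.Idx} (h : (naturalCrystal D).wordF k T.colWord = none) :
    (tableauCrystal D μ).f k T = none := by
  refine dif_neg ?_
  rintro ⟨b', hb'⟩
  exact absurd (h.symm.trans hb') (by simp)

theorem wordWt_colWord (T : Tableau μ κ) : (naturalCrystal D).wordWt T.colWord =
    ∑ p ∈ (Finset.range (μ.rowLen 0)).sigma T.colSet, D.eps p.2 := by
  have h1 : ∀ w : List κ, (naturalCrystal D).wordWt w = (w.map D.eps).sum := by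
    intro w
    induction w with
    | nil => rfl
    | cons x w ih => rw [CrystalData.wordWt, ih, List.map_cons, List.sum_cons]; rfl
  have h2 : ∀ J : List ℕ, ((J.flatMap T.col).map D.eps).sum =
      (J.map fun j => ∑ x ∈ T.colSet j, D.eps x).sum := by
    intro J
    induction J with
    | nil => rfl
    | cons j J ih =>
      rw [List.flatMap_cons, List.map_append, List.sum_append, ih, List.map_cons, List.sum_cons,
        Tableau.colSet, List.sum_toFinset _ ((T.col_pairwise j).imp fun h => h.ne)]
  rw [h1, Tableau.colWord_eq, h2, Finset.sum_sigma, List.map_reverse, List.sum_reverse,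
    ← List.sum_toFinset _ List.nodup_range, List.toFinset_range]

end TableauCrystal

/-! ### Tableaux as matrices in normal form -/

namespace BinMat

variable {n : ℕ} {μ ν : YoungDiagram}

/-- The matrix whose rows, from the last one to the first one, are the first `n` columns of a
tableau. -/
def ofColumnsInRows (n : ℕ) (T : Tableau μ ℤ) : BinMat n :=
  ⟨fun i x => decide (x ∈ T.colSet (n - 1 - i)), fun i =>
    (T.colSet (n - 1 - i)).finite_toSet.subset fun _ hx => of_decide_eq_true hx⟩

/-- The matrix whose columns with a non-negative number are the columns of a tableau, and whose
other columns are zero. -/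
def ofColumns (T : Tableau μ (Fin n)) : BinMat n :=
  ⟨fun i x => decide (0 ≤ x ∧ i ∈ T.colSet x.toNat), fun i => by
    refine (Set.finite_Ico (0 : ℤ) (μ.rowLen 0)).subset fun x hx => ?_
    obtain ⟨h0, hx⟩ := of_decide_eq_true hx
    refine Set.mem_Ico.mpr ⟨h0, ?_⟩
    by_contra hlt
    rw [T.colSet_eq_empty (by omega)] at hx
    exact Finset.notMem_empty _ hx⟩

theorem ofColumnsInRows_apply (T : Tableau μ ℤ) (i : Fin n) (x : ℤ) :
    (ofColumnsInRows n T).1 i x = true ↔ x ∈ T.colSet (n - 1 - i) := decide_eq_true_iff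

theorem ofColumns_apply (T : Tableau μ (Fin n)) (i : Fin n) (x : ℤ) :
    (ofColumns T).1 i x = true ↔ 0 ≤ x ∧ i ∈ T.colSet x.toNat := decide_eq_true_iff

theorem row_ofColumnsInRows (T : Tableau μ ℤ) (i : Fin n) :
    (ofColumnsInRows n T).row i = T.colSet (n - 1 - i) := by
  ext x
  rw [mem_row, ofColumnsInRows_apply]

theorem col_ofColumns (T : Tableau μ (Fin n)) (j : ℕ) : (ofColumns T).col j = T.colSet j := by
  ext x
  rw [mem_col, ofColumns_apply, Int.toNat_natCast]
  exact and_iff_right (Int.natCast_nonneg j)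

theorem rightNormal_ofColumnsInRows (T : Tableau μ ℤ) : (ofColumnsInRows n T).RightNormal := by
  intro l
  have h1 : ((glFin n).snd l).1 = ((glFin n).fst l).1 + 1 := rfl
  have h2 := ((glFin n).snd l).2
  rw [row_ofColumnsInRows, row_ofColumnsInRows,
    show n - 1 - ((glFin n).fst l).1 = n - 1 - ((glFin n).snd l).1 + 1 by omega]
  exact T.dominates _

theorem leftNormal_ofColumns (T : Tableau μ (Fin n)) : (ofColumns T).LeftNormal := by
  refine ⟨fun i j hj => ?_, fun k hk => ?_⟩
  · rw [← Bool.not_eq_true, ofColumns_apply]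
    omega
  · obtain ⟨k, rfl⟩ := Int.eq_ofNat_of_zero_le hk
    have := T.dominates k
    rw [← col_ofColumns, ← col_ofColumns] at this
    exact this

theorem exists_ofColumnsInRows {A : BinMat n} (hA : A.RightNormal) :
    ∃ (μ : YoungDiagram) (T : Tableau μ ℤ), μ.rowLen 0 ≤ n ∧ ofColumnsInRows n T = A := by
  have hdom : ∀ j, Dominates (if h : j < n then A.row ⟨n - 1 - j, by omega⟩ else ∅)
      (if h : j + 1 < n then A.row ⟨n - 1 - (j + 1), by omega⟩ else ∅) := by
    intro j
    by_cases h : j + 1 < n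
    · rw [dif_pos h, dif_pos (by omega)]
      have := hA ⟨n - 1 - (j + 1), by omega⟩
      have h1 : (glFin n).snd ⟨n - 1 - (j + 1), by omega⟩ = ⟨n - 1 - j, by omega⟩ :=
        Fin.ext (show n - 1 - (j + 1) + 1 = n - 1 - j by omega)
      rw [h1] at this
      exact this
    · rw [dif_neg h]
      exact fun t => by simp
  obtain ⟨μ, T, hμ, hT⟩ := Tableau.exists_of_dominates
    (fun j => if h : j < n then A.row ⟨n - 1 - j, by omega⟩ else ∅) hdom n
    fun j hj => dif_neg (not_lt.mpr hj)
  refine ⟨μ, T, hμ, Subtype.ext ?_⟩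
  ext i x
  have hi := i.2
  have h1 : (⟨n - 1 - (n - 1 - i.1), by omega⟩ : Fin n) = i :=
    Fin.ext (show n - 1 - (n - 1 - i.1) = i.1 by omega)
  rw [Bool.eq_iff_iff, ofColumnsInRows_apply, hT, dif_pos (by omega), mem_row, h1]

theorem exists_ofColumns {A : BinMat n} (hA : A.LeftNormal) :
    ∃ (μ : YoungDiagram) (T : Tableau μ (Fin n)), ofColumns T = A := by
  obtain ⟨N, hN⟩ := (A.supp.image fun p => p.2).bddAbove
  obtain ⟨μ, T, -, hT⟩ := Tableau.exists_of_dominates (fun j : ℕ => A.col j) (fun j => by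
    have := hA.2 j (Int.natCast_nonneg j)
    exact_mod_cast this) (N + 1).toNat fun j hj => by
      rw [Finset.eq_empty_iff_forall_notMem]
      intro i hi
      have := hN (Finset.mem_coe.mpr (Finset.mem_image.mpr
        ⟨⟨i, j⟩, mem_supp.mpr (mem_col.mp hi), rfl⟩))
      have : (j : ℤ) ≤ N := this
      omega
  refine ⟨μ, T, Subtype.ext ?_⟩
  ext i x
  rw [Bool.eq_iff_iff, ofColumns_apply, hT, mem_col]
  rcases lt_or_ge x 0 with hx | hx
  · simp [hA.1 i x hx, not_le.mpr hx]
  · rw [Int.toNat_of_nonneg hx, and_iff_right hx]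

theorem shape_eq_of_card_row {T : Tableau μ ℤ} {T' : Tableau ν ℤ} (hμ : μ.rowLen 0 ≤ n)
    (hν : ν.rowLen 0 ≤ n) (h : ∀ i, ((ofColumnsInRows n T).row i).card =
      ((ofColumnsInRows n T').row i).card) : μ = ν := by
  refine YoungDiagram.ext_colLen fun j => ?_
  rcases lt_or_ge j n with hj | hj
  · have := h ⟨n - 1 - j, by omega⟩
    rw [row_ofColumnsInRows, row_ofColumnsInRows, Tableau.card_colSet, Tableau.card_colSet] at this
    rwa [show n - 1 - (n - 1 - j) = j by omega] at this
  · rw [YoungDiagram.colLen_eq_zero_of_le (hμ.trans hj),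
      YoungDiagram.colLen_eq_zero_of_le (hν.trans hj)]

theorem shape_eq_of_card_col {T : Tableau μ (Fin n)} {T' : Tableau ν (Fin n)}
    (h : ∀ j, ((ofColumns T).col j).card = ((ofColumns T').col j).card) : μ = ν := by
  refine YoungDiagram.ext_colLen fun j => ?_
  have := h j
  rwa [col_ofColumns, col_ofColumns, Tableau.card_colSet, Tableau.card_colSet] at this

theorem ofColumnsInRows_injective (hμ : μ.rowLen 0 ≤ n) {T T' : Tableau μ ℤ}
    (h : ofColumnsInRows n T = ofColumnsInRows n T') : T = T' := by
  refine Tableau.eq_of_colSet fun j => ?_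
  rcases lt_or_ge j n with hj | hj
  · have := congrArg (row · ⟨n - 1 - j, by omega⟩) h
    simp only [row_ofColumnsInRows] at this
    rwa [show n - 1 - (n - 1 - j) = j by omega] at this
  · rw [T.colSet_eq_empty (hμ.trans hj), T'.colSet_eq_empty (hμ.trans hj)]

theorem ofColumns_injective {T T' : Tableau μ (Fin n)} (h : ofColumns T = ofColumns T') : T = T' :=
  Tableau.eq_of_colSet fun j => by rw [← col_ofColumns, ← col_ofColumns, h]

/-! The matrix of a tableau has the reading word of the tableau. -/

theorem isReading_ofColumnsInRows (hn : 1 ≤ n) (hμ : μ.rowLen 0 ≤ n) (T : Tableau μ ℤ) :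
    IsReading (ofColumnsInRows n T).1 (fun j => (⟨n - 1 - j, by omega⟩ : Fin n)) T.col
      (List.range (μ.rowLen 0)).reverse where
  sorted := by
    rw [List.pairwise_map, List.pairwise_reverse]
    refine List.pairwise_lt_range.imp_of_mem fun {a b} ha hb hab => ?_
    rw [List.mem_range] at ha hb
    exact Fin.lt_def.mpr (show n - 1 - b < n - 1 - a by omega)
  col_sorted j _ := T.col_pairwise j
  mem j hj x := by
    rw [List.mem_reverse, List.mem_range] at hj
    rw [ofColumnsInRows_apply, Tableau.mem_col_iff]
    show _ ↔ x ∈ T.colSet (n - 1 - (n - 1 - j))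
    rw [show n - 1 - (n - 1 - j) = j by omega]
  off s x hx := by
    rw [ofColumnsInRows_apply] at hx
    have hs := s.2
    refine List.mem_map.mpr ⟨n - 1 - s, ?_, Fin.ext (show n - 1 - (n - 1 - s.1) = s.1 by omega)⟩
    rw [List.mem_reverse, List.mem_range]
    by_contra hlt
    rw [T.colSet_eq_empty (not_lt.mp hlt)] at hx
    exact Finset.notMem_empty _ hx

theorem isReading_ofColumns (T : Tableau μ (Fin n)) :
    IsReading (rho (ofColumns T).1) (fun j : ℕ => -(j : ℤ)) T.col
      (List.range (μ.rowLen 0)).reverse where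
  sorted := by
    rw [List.pairwise_map, List.pairwise_reverse]
    exact List.pairwise_lt_range.imp fun {a b} hab => by omega
  col_sorted j _ := T.col_pairwise j
  mem j _ x := by
    rw [rho_apply, neg_neg, ← mem_col, col_ofColumns, Tableau.mem_col_iff]
  off s x hx := by
    rw [rho_apply, ofColumns_apply] at hx
    refine List.mem_map.mpr ⟨(-s).toNat, ?_, by omega⟩
    rw [List.mem_reverse, List.mem_range]
    by_contra hlt
    rw [T.colSet_eq_empty (not_lt.mp hlt)] at hx
    exact Finset.notMem_empty _ hx.2

/-! The maps from tableaux to matrices preserve the crystal structures. -/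

theorem left_wt_ofColumnsInRows (hμ : μ.rowLen 0 ≤ n) (T : Tableau μ ℤ) :
    (binMatBicrystal n).left.wt (ofColumnsInRows n T) = (crystalB μ).wt T := by
  refine (left_wt _).trans (Eq.trans ?_ (wordWt_colWord T).symm)
  have hlt : ∀ {j x}, x ∈ T.colSet j → j < μ.rowLen 0 := fun {j x} hx => by
    by_contra hlt
    rw [T.colSet_eq_empty (not_lt.mp hlt)] at hx
    exact Finset.notMem_empty _ hx
  refine Finset.sum_bij' (fun p _ => ⟨n - 1 - p.1, p.2⟩)
    (fun p hp => ⟨⟨n - 1 - p.1, ?_⟩, p.2⟩) (fun p hp => ?_) (fun p hp => ?_) (fun p hp => ?_)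
    (fun p hp => ?_) fun p _ => rfl
  · have := Finset.mem_range.mp (Finset.mem_sigma.mp hp).1
    omega
  · rw [mem_supp, ofColumnsInRows_apply] at hp
    exact Finset.mem_sigma.mpr ⟨Finset.mem_range.mpr (hlt hp), hp⟩
  · rw [Finset.mem_sigma, Finset.mem_range] at hp
    rw [mem_supp, ofColumnsInRows_apply]
    show p.2 ∈ T.colSet (n - 1 - (n - 1 - p.1))
    rw [show n - 1 - (n - 1 - p.1) = p.1 by omega]
    exact hp.2
  · have := p.1.2
    exact Sigma.ext (Fin.ext (show n - 1 - (n - 1 - p.1.1) = p.1.1 by omega)) HEq.rfl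
  · rw [Finset.mem_sigma, Finset.mem_range] at hp
    exact Sigma.ext (show n - 1 - (n - 1 - p.1) = p.1 by omega) HEq.rfl

theorem right_wt_ofColumns (T : Tableau μ (Fin n)) :
    (binMatBicrystal n).right.wt (ofColumns T) = (crystalBFin n μ).wt T := by
  refine (right_wt _).trans (Eq.trans ?_ (wordWt_colWord T).symm)
  refine Finset.sum_bij' (fun p _ => ⟨p.2.toNat, p.1⟩) (fun p _ => ⟨p.2, (p.1 : ℤ)⟩)
    (fun p hp => ?_) (fun p hp => ?_) (fun p hp => ?_) (fun p hp => ?_) fun p _ => rfl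
  · rw [mem_supp, ofColumns_apply] at hp
    refine Finset.mem_sigma.mpr ⟨Finset.mem_range.mpr ?_, hp.2⟩
    by_contra hlt
    have := hp.2
    rw [T.colSet_eq_empty (not_lt.mp hlt)] at this
    exact Finset.notMem_empty _ this
  · rw [mem_supp, ofColumns_apply]
    exact ⟨Int.natCast_nonneg _, (Finset.mem_sigma.mp hp).2⟩
  · rw [mem_supp, ofColumns_apply] at hp
    exact Sigma.ext rfl (heq_of_eq (Int.toNat_of_nonneg hp.1))
  · rfl

/-- The map from tableaux to matrices commutes with the crystal operators. The image of a matrix of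
this form under an operator is again of this form, since the operator preserves the normal form for
the other structure, and of the same shape, since it preserves the row sums. -/
theorem left_ops_ofColumnsInRows (hn : 1 ≤ n) (hμ : μ.rowLen 0 ≤ n) (T : Tableau μ ℤ)
    (a : ℤ × Bool) : (binMatBicrystal n).left.ops a (ofColumnsInRows n T) =
      ((crystalB μ).ops a T).map (ofColumnsInRows n) := by
  have hT := isReading_ofColumnsInRows hn hμ T
  cases h : (binMatBicrystal n).left.ops a (ofColumnsInRows n T) with
  | none =>
    have : (crystalB μ).ops a T = none := by
      obtain ⟨k, _ | _⟩ := a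
      · have h1 : ¬((binMatBicrystal n).left.f k (ofColumnsInRows n T)).isSome := by
          rw [show (binMatBicrystal n).left.f k (ofColumnsInRows n T) = none from h]
          simp
        rw [left_f_isSome, not_not, matφ_eq_zero_iff (Set.toFinite _),
          matF_eq_none_iff (Set.toFinite _)] at h1
        exact tableauCrystal_f_eq_none (hT.wordF_eq_none glInfty_isStandard h1)
      · have h1 : ¬((binMatBicrystal n).left.e k (ofColumnsInRows n T)).isSome := by
          rw [show (binMatBicrystal n).left.e k (ofColumnsInRows n T) = none from h]
          simp
        rw [left_e_isSome, not_not] at h1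
        exact tableauCrystal_e_eq_none (hT.wordE_none glInfty_isStandard h1)
    rw [this, Option.map_none]
  | some B =>
    have hB : B.RightNormal := (normalForms n).stable_l a _ _ h (rightNormal_ofColumnsInRows T)
    obtain ⟨ν, T', hν, rfl⟩ := exists_ofColumnsInRows hB
    obtain rfl := shape_eq_of_card_row hμ hν fun i =>
      (card_row_of_connected (Connected.of_step h) i).symm
    have hT' := isReading_ofColumnsInRows hn hν T'
    have : (crystalB μ).ops a T = some T' := by
      obtain ⟨k, _ | _⟩ := a
      · exact tableauCrystal_f_eq_some
          (hT.wordF_eq_some glInfty_isStandard hT' (left_f_iff_matF.mp h))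
      · exact tableauCrystal_e_eq_some
          (hT.wordE_eq_some glInfty_isStandard hT' (left_e_iff_matE.mp h))
    rw [this, Option.map_some]

theorem right_ops_ofColumns (T : Tableau μ (Fin n)) (a : (glFin n).Idx × Bool) :
    (binMatBicrystal n).right.ops a (ofColumns T) =
      ((crystalBFin n μ).ops a T).map ofColumns := by
  have hT := isReading_ofColumns T
  cases h : (binMatBicrystal n).right.ops a (ofColumns T) with
  | none =>
    have : (crystalBFin n μ).ops a T = none := by
      obtain ⟨k, _ | _⟩ := a
      · have h1 : ¬((binMatBicrystal n).right.f k (ofColumns T)).isSome := by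
          rw [show (binMatBicrystal n).right.f k (ofColumns T) = none from h]
          simp
        rw [right_f_isSome, not_not, matφ_eq_zero_iff (finite_rowSign_rho _ _ _),
          matF_eq_none_iff (finite_rowSign_rho _ _ _)] at h1
        exact tableauCrystal_f_eq_none (hT.wordF_eq_none (glFin_isStandard n) h1)
      · have h1 : ¬((binMatBicrystal n).right.e k (ofColumns T)).isSome := by
          rw [show (binMatBicrystal n).right.e k (ofColumns T) = none from h]
          simp
        rw [right_e_isSome, not_not] at h1
        exact tableauCrystal_e_eq_none (hT.wordE_none (glFin_isStandard n) h1)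
    rw [this, Option.map_none]
  | some B =>
    have hB : B.LeftNormal := (normalForms n).stable_r a _ _ h (leftNormal_ofColumns T)
    obtain ⟨ν, T', rfl⟩ := exists_ofColumns hB
    obtain rfl := shape_eq_of_card_col fun j =>
      (card_col_of_connected (Connected.of_step h) j).symm
    have hT' := isReading_ofColumns T'
    have : (crystalBFin n μ).ops a T = some T' := by
      obtain ⟨k, _ | _⟩ := a
      · exact tableauCrystal_f_eq_some
          (hT.wordF_eq_some (glFin_isStandard n) hT' (right_f_iff_matF.mp h))
      · exact tableauCrystal_e_eq_some
          (hT.wordE_eq_some (glFin_isStandard n) hT' (right_e_iff_matE.mp h))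
    rw [this, Option.map_some]

/-! ### The decomposition -/

/-- If the two normal forms of a matrix are the matrices of two tableaux, the shapes of these are
conjugate: both can be read off from the common normal form for both structures. -/
theorem shape_eq_transpose {A : BinMat n} {T : Tableau μ ℤ} {U : Tableau ν (Fin n)}
    (hμ : μ.rowLen 0 ≤ n) (hT : Connected (binMatBicrystal n).right.ops A (ofColumnsInRows n T))
    (hU : Connected (binMatBicrystal n).left.ops A (ofColumns U)) : ν = μ.transpose := by
  obtain ⟨X, hTX, hUX⟩ := (normalForms n).exists_common hU hT
  have hr : X.RightNormal := hTX.induction (normalForms n).stable_l (rightNormal_ofColumnsInRows T)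
  have hl : X.LeftNormal := hUX.induction (normalForms n).stable_r (leftNormal_ofColumns U)
  refine YoungDiagram.ext (Finset.ext fun ⟨a, j⟩ => ?_)
  rw [YoungDiagram.mem_cells, YoungDiagram.mem_cells, YoungDiagram.mem_transpose, Prod.swap_prod_mk,
    YoungDiagram.mem_iff_lt_colLen, YoungDiagram.mem_iff_lt_colLen]
  rcases lt_or_ge a n with ha | ha
  · have h1 := apply_iff_card_row hl hr ⟨n - 1 - a, by omega⟩ j
    rw [apply_iff_card_col hl hr, card_row_of_connected hTX, card_col_of_connected hUX,
      row_ofColumnsInRows, col_ofColumns, Tableau.card_colSet, Tableau.card_colSet] at h1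
    have h2 : n - 1 - (n - 1 - a) = a := by omega
    simp only [h2] at h1
    omega
  · rw [YoungDiagram.colLen_eq_zero_of_le (hμ.trans ha)]
    have := (U.colSet j).card_le_univ
    rw [Tableau.card_colSet, Fintype.card_fin] at this
    omega

/-- Two tableaux of conjugate shapes come from a matrix: the normal forms of their matrices for the
respective other structure coincide. -/
theorem exists_of_tableaux (T : Tableau μ ℤ)
    (U : Tableau μ.transpose (Fin n)) : ∃ A : BinMat n,
      Connected (binMatBicrystal n).right.ops A (ofColumnsInRows n T) ∧
        Connected (binMatBicrystal n).left.ops A (ofColumns U) := by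
  have hN := normalForms n
  obtain ⟨X, hTX, hlX⟩ := hN.exists_l (ofColumnsInRows n T)
  obtain ⟨Y, hUY, hrY⟩ := hN.exists_r (ofColumns U)
  have hrX : X.RightNormal := hTX.induction hN.stable_l (rightNormal_ofColumnsInRows T)
  have hlY : Y.LeftNormal := hUY.induction hN.stable_r (leftNormal_ofColumns U)
  have hXY : X = Y := Subtype.ext <| by
    ext i j
    rw [Bool.eq_iff_iff]
    rcases lt_or_ge j 0 with hj | hj
    · rw [hlX.1 i j hj, hlY.1 i j hj]
    · obtain ⟨j, rfl⟩ := Int.eq_ofNat_of_zero_le hj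
      rw [apply_iff_card_row hlX hrX, apply_iff_card_col hlY hrY, card_row_of_connected hTX,
        card_col_of_connected hUY, row_ofColumnsInRows]
      have h1 : ((ofColumns U).col (j : ℤ)).card = μ.transpose.colLen j := by
        rw [col_ofColumns, Tableau.card_colSet]
      have h2 : n - 1 - i.1 < μ.transpose.colLen j ↔ j < μ.colLen (n - 1 - i) := by
        rw [← YoungDiagram.mem_iff_lt_colLen, ← YoungDiagram.mem_iff_lt_colLen,
          YoungDiagram.mem_transpose, Prod.swap_prod_mk]
      have h3 := i.2
      rw [h1, Tableau.card_colSet]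
      omega
  subst hXY
  obtain ⟨A, hA, hA'⟩ := hN.exists_common (hN.symm.conn_symm_r hTX) (hN.conn_symm_r hUY)
  exact ⟨A, hN.conn_symm_r hA', hN.symm.conn_symm_r hA⟩

/-- The index set of the decomposition: a partition `μ` with `μ₁ ≤ n`, a tableau of shape `μ` and a
tableau of the conjugate shape. -/
abbrev TableauPairs (n : ℕ) : Type :=
  Σ μ : {μ : YoungDiagram // μ.rowLen 0 ≤ n}, Tableau μ.1 ℤ × Tableau μ.1.transpose (Fin n)

/-- The matrix `A` corresponds to a pair of tableaux if its normal forms for the `𝔤𝔩_n`-structure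
and for the `𝔤𝔩_∞`-structure are the matrices of these two tableaux. -/
def Corresponds (A : BinMat n) (x : TableauPairs n) : Prop :=
  Connected (binMatBicrystal n).right.ops A (ofColumnsInRows n x.2.1) ∧
    Connected (binMatBicrystal n).left.ops A (ofColumns x.2.2)

theorem exists_corresponds (A : BinMat n) : ∃ x, A.Corresponds x := by
  obtain ⟨P, hP, hrP⟩ := (normalForms n).exists_r A
  obtain ⟨Q, hQ, hlQ⟩ := (normalForms n).exists_l A
  obtain ⟨μ, T, hμ, rfl⟩ := exists_ofColumnsInRows hrP
  obtain ⟨ν, U, rfl⟩ := exists_ofColumns hlQ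
  obtain rfl := shape_eq_transpose hμ hP hQ
  exact ⟨⟨⟨μ, hμ⟩, T, U⟩, hP, hQ⟩

theorem Corresponds.right_unique {A : BinMat n} {x y : TableauPairs n} (hx : A.Corresponds x)
    (hy : A.Corresponds y) : x = y := by
  have hN := normalForms n
  obtain ⟨⟨μ, hμ⟩, T, U⟩ := x
  obtain ⟨⟨ν, hν⟩, T', U'⟩ := y
  have h1 : ofColumnsInRows n T = ofColumnsInRows n T' :=
    hN.unique_r ((hN.conn_symm_r hx.1).trans hy.1) (rightNormal_ofColumnsInRows T)
      (rightNormal_ofColumnsInRows T')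
  have h2 : ofColumns U = ofColumns U' :=
    hN.symm.unique_r ((hN.symm.conn_symm_r hx.2).trans hy.2) (leftNormal_ofColumns U)
      (leftNormal_ofColumns U')
  obtain rfl := shape_eq_of_card_row hμ hν fun i => by rw [h1]
  rw [ofColumnsInRows_injective hμ h1, ofColumns_injective h2]

/-- The bijection of the decomposition. -/
noncomputable def equivTableauPairs (n : ℕ) : BinMat n ≃ TableauPairs n :=
  Equiv.ofBijective (fun A => (exists_corresponds A).choose) <| by
    constructor
    · intro A B hAB
      have hA := (exists_corresponds A).choose_spec
      have hB := (exists_corresponds B).choose_spec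
      rw [← show (exists_corresponds A).choose = (exists_corresponds B).choose from hAB] at hB
      exact (normalForms n).eq_of_connected (leftNormal_ofColumns _) hA.1 hB.1 hA.2 hB.2
    · rintro ⟨⟨μ, hμ⟩, T, U⟩
      obtain ⟨A, hA⟩ := exists_of_tableaux T U
      exact ⟨A, (exists_corresponds A).choose_spec.right_unique hA⟩

theorem corresponds_equivTableauPairs (A : BinMat n) : A.Corresponds (equivTableauPairs n A) :=
  (exists_corresponds A).choose_spec

theorem Corresponds.equiv_eq {A : BinMat n} {x : TableauPairs n} (h : A.Corresponds x) :
    equivTableauPairs n A = x :=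
  (corresponds_equivTableauPairs A).right_unique h

/-- The bicrystal structure on the pairs of tableaux. -/
noncomputable abbrev tableauPairsBicrystal (n : ℕ) :
    BicrystalData glInfty (glFin n) (TableauPairs n) :=
  BicrystalData.disjointUnion fun μ : {μ : YoungDiagram // μ.rowLen 0 ≤ n} =>
    BicrystalData.prod (crystalB μ.1) (crystalBFin n μ.1.transpose)

theorem left_ops_tableauPairs (a : ℤ × Bool) (x : TableauPairs n) :
    (tableauPairsBicrystal n).left.ops a x =
      ((crystalB x.1.1).ops a x.2.1).map fun T => ⟨x.1, T, x.2.2⟩ := by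
  obtain ⟨k, _ | _⟩ := a <;> exact Option.map_map _ _ _

theorem right_ops_tableauPairs (a : (glFin n).Idx × Bool) (x : TableauPairs n) :
    (tableauPairsBicrystal n).right.ops a x =
      ((crystalBFin n x.1.1.transpose).ops a x.2.2).map fun U => ⟨x.1, x.2.1, U⟩ := by
  obtain ⟨k, _ | _⟩ := a <;> exact Option.map_map _ _ _

theorem equiv_left_ops (hn : 1 ≤ n) (a : ℤ × Bool) (A : BinMat n) :
    (tableauPairsBicrystal n).left.ops a (equivTableauPairs n A) =
      ((binMatBicrystal n).left.ops a A).map (equivTableauPairs n) := by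
  have hN := normalForms n
  obtain ⟨h1, h2⟩ := corresponds_equivTableauPairs A
  have h3 := left_ops_ofColumnsInRows hn (equivTableauPairs n A).1.2 (equivTableauPairs n A).2.1 a
  rw [left_ops_tableauPairs]
  cases h : (binMatBicrystal n).left.ops a A with
  | none =>
    cases h' : (crystalB (equivTableauPairs n A).1.1).ops a (equivTableauPairs n A).2.1 with
    | none => rfl
    | some T =>
      rw [h', Option.map_some] at h3
      obtain ⟨B, hB, -⟩ := hN.transport_step h3 (hN.conn_symm_r h1)
      exact absurd (h.symm.trans hB) (by simp)
  | some B =>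
    obtain ⟨P, hP, hBP⟩ := hN.transport_step h h1
    obtain ⟨T, hT, rfl⟩ := Option.map_eq_some_iff.mp (h3.symm.trans hP)
    rw [hT, Option.map_some, Option.map_some]
    refine congrArg some (Eq.symm (Corresponds.equiv_eq ⟨hBP, ?_⟩))
    exact (hN.symm.conn_symm_r (Connected.of_step h)).trans h2

theorem equiv_right_ops (a : (glFin n).Idx × Bool) (A : BinMat n) :
    (tableauPairsBicrystal n).right.ops a (equivTableauPairs n A) =
      ((binMatBicrystal n).right.ops a A).map (equivTableauPairs n) := by
  have hN := (normalForms n).symm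
  obtain ⟨h1, h2⟩ := corresponds_equivTableauPairs A
  have h3 := right_ops_ofColumns (equivTableauPairs n A).2.2 a
  rw [right_ops_tableauPairs]
  cases h : (binMatBicrystal n).right.ops a A with
  | none =>
    cases h' : (crystalBFin n (equivTableauPairs n A).1.1.transpose).ops a
        (equivTableauPairs n A).2.2 with
    | none => rfl
    | some T =>
      rw [h', Option.map_some] at h3
      obtain ⟨B, hB, -⟩ := hN.transport_step h3 (hN.conn_symm_r h2)
      exact absurd (h.symm.trans hB) (by simp)
  | some B =>
    obtain ⟨P, hP, hBP⟩ := hN.transport_step h h2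
    obtain ⟨T, hT, rfl⟩ := Option.map_eq_some_iff.mp (h3.symm.trans hP)
    rw [hT, Option.map_some, Option.map_some]
    refine congrArg some (Eq.symm (Corresponds.equiv_eq ⟨?_, hBP⟩))
    exact (hN.symm.conn_symm_r (Connected.of_step h)).trans h1

/-- The weight, `ε_k` and `φ_k` of the `𝔤𝔩_∞`-structure do not change along the `𝔤𝔩_n`-structure. -/
theorem left_invariant {A B : BinMat n} (h : Connected (binMatBicrystal n).right.ops A B) :
    (binMatBicrystal n).left.wt B = (binMatBicrystal n).left.wt A ∧ ∀ k : ℤ,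
      (binMatBicrystal n).left.ε k B = (binMatBicrystal n).left.ε k A ∧
        (binMatBicrystal n).left.φ k B = (binMatBicrystal n).left.φ k A :=
  h.induction (P := fun C => (binMatBicrystal n).left.wt C = (binMatBicrystal n).left.wt A ∧
      ∀ k : ℤ, (binMatBicrystal n).left.ε k C = (binMatBicrystal n).left.ε k A ∧
        (binMatBicrystal n).left.φ k C = (binMatBicrystal n).left.φ k A)
    ((right_isCrystal n).ops_induction fun l C C' hC => by
      have h1 : ∀ k : ℤ, (binMatBicrystal n).left.ε k C' = (binMatBicrystal n).left.ε k C :=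
        fun k => congrArg (fun z : ℤ => (z : WithBot ℤ)) (left_ε_of_right_f hC k)
      have h2 : ∀ k : ℤ, (binMatBicrystal n).left.φ k C' = (binMatBicrystal n).left.φ k C :=
        fun k => congrArg (fun z : ℤ => (z : WithBot ℤ)) (left_φ_of_right_f hC k)
      simp only [h1, h2, left_wt_of_right_f hC])
    ⟨rfl, fun _ => ⟨rfl, rfl⟩⟩

/-- The weight, `ε_l` and `φ_l` of the `𝔤𝔩_n`-structure do not change along the `𝔤𝔩_∞`-structure. -/
theorem right_invariant {A B : BinMat n} (h : Connected (binMatBicrystal n).left.ops A B) :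
    (binMatBicrystal n).right.wt B = (binMatBicrystal n).right.wt A ∧ ∀ l : (glFin n).Idx,
      (binMatBicrystal n).right.ε l B = (binMatBicrystal n).right.ε l A ∧
        (binMatBicrystal n).right.φ l B = (binMatBicrystal n).right.φ l A :=
  h.induction (P := fun C => (binMatBicrystal n).right.wt C = (binMatBicrystal n).right.wt A ∧
      ∀ l, (binMatBicrystal n).right.ε l C = (binMatBicrystal n).right.ε l A ∧
        (binMatBicrystal n).right.φ l C = (binMatBicrystal n).right.φ l A)
    ((left_isCrystal n).ops_induction fun k C C' hC => by
      have h1 : ∀ l, (binMatBicrystal n).right.ε l C' = (binMatBicrystal n).right.ε l C :=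
        fun l => congrArg (fun z : ℤ => (z : WithBot ℤ)) (right_ε_of_left_f hC l)
      have h2 : ∀ l, (binMatBicrystal n).right.φ l C' = (binMatBicrystal n).right.φ l C :=
        fun l => congrArg (fun z : ℤ => (z : WithBot ℤ)) (right_φ_of_left_f hC l)
      simp only [h1, h2, right_wt_of_left_f hC])
    ⟨rfl, fun _ => ⟨rfl, rfl⟩⟩

theorem isIso_equivTableauPairs (hn : 1 ≤ n) :
    (binMatBicrystal n).IsIso (tableauPairsBicrystal n) (equivTableauPairs n) where
  left_isIso :=
    { wt_eq := fun A => (left_wt_ofColumnsInRows (equivTableauPairs n A).1.2 _).symm.trans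
        (left_invariant (corresponds_equivTableauPairs A).1).1
      ε_eq := fun k A => ((isReading_ofColumnsInRows hn (equivTableauPairs n A).1.2
        (equivTableauPairs n A).2.1).wordε_eq_matε glInfty_isStandard k).trans
        ((left_invariant (corresponds_equivTableauPairs A).1).2 k).1
      φ_eq := fun k A => ((isReading_ofColumnsInRows hn (equivTableauPairs n A).1.2
        (equivTableauPairs n A).2.1).wordφ_eq_matφ glInfty_isStandard k).trans
        ((left_invariant (corresponds_equivTableauPairs A).1).2 k).2
      e_eq := fun k => equiv_left_ops hn (k, true)
      f_eq := fun k => equiv_left_ops hn (k, false) }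
  right_isIso :=
    { wt_eq := fun A => (right_wt_ofColumns _).symm.trans
        (right_invariant (corresponds_equivTableauPairs A).2).1
      ε_eq := fun l A => ((isReading_ofColumns
        (equivTableauPairs n A).2.2).wordε_eq_matε (glFin_isStandard n) l).trans
        ((right_invariant (corresponds_equivTableauPairs A).2).2 l).1
      φ_eq := fun l A => ((isReading_ofColumns
        (equivTableauPairs n A).2.2).wordφ_eq_matφ (glFin_isStandard n) l).trans
        ((right_invariant (corresponds_equivTableauPairs A).2).2 l).2
      e_eq := fun l => equiv_right_ops (l, true)
      f_eq := fun l => equiv_right_ops (l, false) }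

end BinMat

theorem proposition3p6 (n : ℕ) (hn : 1 ≤ n) :
    (binMatBicrystal n).IsBicrystal ∧
    ∃ ψ : BinMat n ≃
        Σ μ : {μ : YoungDiagram // μ.rowLen 0 ≤ n},
          Tableau μ.1 ℤ × Tableau μ.1.transpose (Fin n),
      (binMatBicrystal n).IsIso
        (BicrystalData.disjointUnion fun μ : {μ : YoungDiagram // μ.rowLen 0 ≤ n} =>
          BicrystalData.prod (crystalB μ.1) (crystalBFin n μ.1.transpose)) ψ :=
  ⟨BinMat.isBicrystal n, BinMat.equivTableauPairs n, BinMat.isIso_equivTableauPairs hn⟩
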